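/- Let $M$ be a smooth Riemannian manifold (without boundary), let $J\subset\mathbb R$ be an interval with more than one point, and let $c\colon J\to M$ be a unit speed geodesic. Put $E_t=\dot c(t)^\perp\subset T_{c(t)}M$, let $X'=\nabla_{\dot c}X$ denote the covariant derivative along $c$, and let $R=R(\cdot,\dot c)\dot c$. (At end points of $J$ belonging to $J$, derivatives, limits and smoothness are one-sided.) Fix $t_0\in J$. Let $A_t\colon E_{t_0}\to E_t$, $t\in J$, be a *Lagrange tensor*: a smooth family of linear maps with $A''+RA=0$ such that for every $w\ne 0$ the Jacobi field $t\mapsto A_tw$ is not identically zero, $A_t$ is invertible for at least one $t\in J$, and $S:=A'A^{-1}$ is symmetric at every *regular* point, i.e. at every $t$ at which $A_t$ is invertible. Let $v\in E_{t_0}$, $v\neq 0$. At regular points put $$Z_t=(A_t^*)^{-1}v,\qquad g_v(t)=\frac{|v|^2}{|Z_t|}.$$ Then the singular (i.e. non-regular) points are isolated in $J$; at a singular point let $g_v$ denote the limit of its values at regular points, which exists by (b). The following hold. (a) $g_v(t)\le |A_tv|$ for all $t\in J$, and at regular points, with $g=g_v$, $$\frac{g''}{g}=-\sec(\dot c,Z)-3\,\frac{|SZ|^2}{|Z|^2}\,\sin^2\angle(SZ,Z).$$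 (b) $g_v$ is continuous on $J$. For $t^*\in J$, $g_v(t^*)>0$ if and only if $v\perp\ker A_{t^*}$, and $g_v$ is smooth and positive at $t^*$ if and only if $v\perp\ker A_{t^*}$; if $t^*$ is an interior point of $J$, then $g_v$ is smooth at $t^*$ if and only if $v\perp\ker A_{t^*}$. (c) If all planes containing some $\dot c(t)$, $t\in J$, have sectional curvature $\ge 0$ (in particular, if $\sec_M\ge 0$), then $g_v$ is concave on every interval $K\subset J$ on which it is positive; if all these sectional curvatures are $>0$ (in particular, if $\sec_M>0$), then $g_v$ is strictly concave on every such $K$. If all these sectional curvatures are $\ge0$ and $g_v$ is constant on $J$, then $Z$ extends from the regular points to a smooth vector field along $c$ on $J$ that is a parallel Jacobi field, and if moreover $A_{t_0}=\mathrm{Id}$, then this field is $A_tv$ for all $t\in J$. -/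

import Mathlib

open Bundle Set Filter
open scoped Manifold ContDiff Topology

noncomputable section

namespace VirtualJacobi

/-! ### Levi-Civita connection and curvature, in the charts of a Riemannian manifold

`M` is a manifold without boundary modelled on the finite-dimensional space `E`, with a Riemannian
metric on its tangent bundle. The chart `extChartAt 𝓘(ℝ, E) x₀` and the trivialization
`trivializationAt E (TangentSpace 𝓘(ℝ, E)) x₀` of the tangent bundle that it induces give
coordinates for the points near `x₀` and for the tangent vectors at these points. -/

section Geometry

variable {E : Type*} [NormedAddCommGroup E] [NormedSpace ℝ E]
  {M : Type*} [TopologicalSpace M] [ChartedSpace E M] [IsManifold 𝓘(ℝ, E) ∞ M]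

/-- The coordinates, in the chart at `x₀`, of a tangent vector `v` at `p`. -/
def toCoord (x₀ p : M) (v : TangentSpace 𝓘(ℝ, E) p) : E :=
  (trivializationAt E (TangentSpace 𝓘(ℝ, E) : M → Type _) x₀).continuousLinearMapAt ℝ p v

/-- The tangent vector at `p` with given coordinates in the chart at `x₀`. -/
def ofCoord (x₀ p : M) (a : E) : TangentSpace 𝓘(ℝ, E) p :=
  (trivializationAt E (TangentSpace 𝓘(ℝ, E) : M → Type _) x₀).symmL ℝ p a

/-- The velocity `ċ(t)` of a curve `c` defined on the interval `J` (one-sided at end points). -/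
def velocity (c : ℝ → M) (J : Set ℝ) (t : ℝ) : TangentSpace 𝓘(ℝ, E) (c t) :=
  mfderivWithin 𝓘(ℝ, ℝ) 𝓘(ℝ, E) c J t (1 : ℝ)

variable [RiemannianBundle (fun x : M ↦ TangentSpace 𝓘(ℝ, E) x)]

/-- The metric in the chart at `x₀`: the bilinear form `g_{ij}(y)` at the point with
coordinates `y`. -/
def chartMetric (x₀ : M) (y : E) : E →L[ℝ] E →L[ℝ] ℝ :=
  (innerSL ℝ (E := TangentSpace 𝓘(ℝ, E) ((extChartAt 𝓘(ℝ, E) x₀).symm y))).bilinearComp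
    ((trivializationAt E (TangentSpace 𝓘(ℝ, E) : M → Type _) x₀).symmL ℝ
      ((extChartAt 𝓘(ℝ, E) x₀).symm y))
    ((trivializationAt E (TangentSpace 𝓘(ℝ, E) : M → Type _) x₀).symmL ℝ
      ((extChartAt 𝓘(ℝ, E) x₀).symm y))

/-- The Christoffel symbols of the first kind:
`z ↦ ½ (∂_a g(b, z) + ∂_b g(a, z) - ∂_z g(a, b))`. -/
def christoffelFirst (x₀ : M) (y a b : E) : E →L[ℝ] ℝ :=
  (1 / 2 : ℝ) • (fderiv ℝ (chartMetric x₀) y a b + fderiv ℝ (chartMetric x₀) y b a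
    - ((fderiv ℝ (chartMetric x₀) y).flip a).flip b)

/-- The Christoffel symbols `Γ_y(a, b)` of the Levi-Civita connection in the chart at `x₀`: the
vector with `g_y(Γ_y(a, b), z) = ½ (∂_a g(b, z) + ∂_b g(a, z) - ∂_z g(a, b))` for all `z`. -/
def christoffel (x₀ : M) (y a b : E) : E :=
  (chartMetric x₀ y).inverse (christoffelFirst x₀ y a b)

/-- The curvature `R(a, b) z = ∇_a ∇_b z - ∇_b ∇_a z` in the chart at `x₀`, for constant
coordinate vector fields `a`, `b`, `z`. -/
def chartCurvature (x₀ : M) (y a b z : E) : E :=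
  fderiv ℝ (fun y' ↦ christoffel x₀ y' b z) y a - fderiv ℝ (fun y' ↦ christoffel x₀ y' a z) y b
    + christoffel x₀ y a (christoffel x₀ y b z) - christoffel x₀ y b (christoffel x₀ y a z)

/-- The Riemann curvature tensor `R(u, v) w` of `M` at `p`, with the sign for which
`⟪R(u, v) v, u⟫` is positive on round spheres. -/
def curvature (p : M) (u v w : TangentSpace 𝓘(ℝ, E) p) : TangentSpace 𝓘(ℝ, E) p :=
  ofCoord p p (chartCurvature p (extChartAt 𝓘(ℝ, E) p p) (toCoord p p u) (toCoord p p v)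
    (toCoord p p w))

/-- The sectional curvature of the plane spanned by `u` and `v`. -/
def sec (p : M) (u v : TangentSpace 𝓘(ℝ, E) p) : ℝ :=
  inner ℝ (curvature p v u u) v / (‖u‖ ^ 2 * ‖v‖ ^ 2 - (inner ℝ u v) ^ 2)

/-- The covariant derivative `X' = ∇_ċ X` of a vector field `X` along the curve `c`, defined on the
interval `J`; in coordinates it is `X' = dX/dt + Γ(ċ, X)`, read in the chart at `c t`. -/
def covDeriv (c : ℝ → M) (J : Set ℝ) (X : ∀ t, TangentSpace 𝓘(ℝ, E) (c t)) (t : ℝ) :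
    TangentSpace 𝓘(ℝ, E) (c t) :=
  ofCoord (c t) (c t)
    (derivWithin (fun s ↦ toCoord (c t) (c s) (X s)) J t
      + christoffel (c t) (extChartAt 𝓘(ℝ, E) (c t) (c t))
          (derivWithin (fun s ↦ extChartAt 𝓘(ℝ, E) (c t) (c s)) J t)
          (toCoord (c t) (c t) (X t)))

/-- `c` is a (smooth) geodesic of unit speed on the interval `J`. -/
structure IsUnitGeodesicOn (c : ℝ → M) (J : Set ℝ) : Prop where
  smooth : ContMDiffOn 𝓘(ℝ, ℝ) 𝓘(ℝ, E) ∞ c J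
  geodesic : ∀ t ∈ J, covDeriv (E := E) c J (velocity c J) t = 0
  unit_speed : ∀ t ∈ J, ‖velocity (E := E) c J t‖ = 1

/-- `X` is a smooth vector field along `c` with `X'' + R(X, ċ) ċ = 0`. -/
structure IsJacobiField (c : ℝ → M) (J : Set ℝ) (X : ∀ t, TangentSpace 𝓘(ℝ, E) (c t)) : Prop where
  smooth : ContMDiffOn 𝓘(ℝ, ℝ) (𝓘(ℝ, E).tangent) ∞
    (fun t ↦ (⟨c t, X t⟩ : TangentBundle 𝓘(ℝ, E) M)) J
  jacobi : ∀ t ∈ J, covDeriv c J (covDeriv c J X) t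
    + curvature (c t) (X t) (velocity c J t) (velocity c J t) = 0

variable (E) in
/-- The space `E_t`: the orthogonal complement of `ċ(t)` in the tangent space at `c t`. -/
abbrev normalSpace (c : ℝ → M) (J : Set ℝ) (t : ℝ) : Submodule ℝ (TangentSpace 𝓘(ℝ, E) (c t)) :=
  (ℝ ∙ velocity c J t)ᗮ

end Geometry

instance tangentSpace_finiteDimensional {E : Type*} [NormedAddCommGroup E] [NormedSpace ℝ E]
    [FiniteDimensional ℝ E] {M : Type*} [TopologicalSpace M] [ChartedSpace E M] (p : M) :
    FiniteDimensional ℝ (TangentSpace 𝓘(ℝ, E) p) :=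
  inferInstanceAs (FiniteDimensional ℝ E)

/-! ### Lagrange tensors and virtual Jacobi fields -/

section Lagrange

variable {E : Type*} [NormedAddCommGroup E] [NormedSpace ℝ E] [FiniteDimensional ℝ E]
  {M : Type*} [TopologicalSpace M] [ChartedSpace E M] [IsManifold 𝓘(ℝ, E) ∞ M]
  [RiemannianBundle (fun x : M ↦ TangentSpace 𝓘(ℝ, E) x)]
  {c : ℝ → M} {J : Set ℝ} {t₀ : ℝ}

/-- The point `t` is regular for the family `A_t : E_{t₀} → E_t` if `A_t` is invertible. -/
def IsRegularPt (A : ∀ t, normalSpace E c J t₀ →ₗ[ℝ] normalSpace E c J t) (t : ℝ) : Prop :=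
  Function.Bijective (A t)

/-- The covariant derivative `A'_t w = (A_t w)'`. -/
def tensorDeriv (A : ∀ t, normalSpace E c J t₀ →ₗ[ℝ] normalSpace E c J t) (t : ℝ)
    (w : normalSpace E c J t₀) : TangentSpace 𝓘(ℝ, E) (c t) :=
  covDeriv c J (fun s ↦ (A s w : TangentSpace 𝓘(ℝ, E) (c s))) t

/-- The Riccati operator `S = A' A⁻¹` (meaningful at regular points). -/
def riccati (A : ∀ t, normalSpace E c J t₀ →ₗ[ℝ] normalSpace E c J t) (t : ℝ)
    (x : normalSpace E c J t) : TangentSpace 𝓘(ℝ, E) (c t) :=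
  tensorDeriv A t (Function.invFun (A t) x)

/-- `A` is a Lagrange tensor along the geodesic `c` on `J`: it solves `A'' + R A = 0`, it is
non-degenerate, and `S = A' A⁻¹` is defined somewhere and symmetric at all regular points. -/
structure IsLagrangeTensor (A : ∀ t, normalSpace E c J t₀ →ₗ[ℝ] normalSpace E c J t) : Prop where
  jacobi : ∀ w, IsJacobiField c J (fun t ↦ (A t w : TangentSpace 𝓘(ℝ, E) (c t)))
  nondegenerate : ∀ w, w ≠ 0 → ∃ t ∈ J, A t w ≠ 0
  /-- Without this the symmetry of `S` could hold vacuously, e.g. for `A_t (a, b) = (a + t b, 0)` in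
  Euclidean space. -/
  exists_regular : ∃ t ∈ J, IsRegularPt A t
  symmetric : ∀ t ∈ J, IsRegularPt A t → ∀ x y : normalSpace E c J t,
    inner ℝ (riccati A t x) (y : TangentSpace 𝓘(ℝ, E) (c t))
      = inner ℝ (x : TangentSpace 𝓘(ℝ, E) (c t)) (riccati A t y)

/-- The virtual Jacobi field `Z_t = (A_t^*)⁻¹ v` (meaningful at regular points). -/
def virtualField (A : ∀ t, normalSpace E c J t₀ →ₗ[ℝ] normalSpace E c J t)
    (v : normalSpace E c J t₀) (t : ℝ) : normalSpace E c J t :=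
  Function.invFun (LinearMap.adjoint (A t)) v

open scoped Classical in
/-- The function `g_v(t) = |v|² / |Z_t|` at regular points, and its limit along regular points at
the other points. -/
def virtualLength (A : ∀ t, normalSpace E c J t₀ →ₗ[ℝ] normalSpace E c J t)
    (v : normalSpace E c J t₀) (t : ℝ) : ℝ :=
  if IsRegularPt A t then ‖v‖ ^ 2 / ‖virtualField A v t‖
  else limUnder (𝓝[{s | s ∈ J ∧ IsRegularPt A s}] t) (fun s ↦ ‖v‖ ^ 2 / ‖virtualField A v s‖)

end Lagrange

end VirtualJacobi

end

open VirtualJacobi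

section

set_option maxSynthPendingDepth 3
set_option linter.unusedSectionVars false

noncomputable section

namespace VirtualJacobi

/-! ### One-variable calculus on intervals: uniqueness, extension and division by `x - t` -/

section Calculus

variable {F : Type*} [NormedAddCommGroup F] [NormedSpace ℝ F]

/-! Everything rests on a local normal form of `A` at an arbitrary, possibly singular, `t ∈ J`. The
Wronskian `⟪A'x, A y⟫ - ⟪A x, A'y⟫` is constant by the Jacobi equation and the symmetry of `R`, and
zero at a regular point because `S` is symmetric there. Hence `A'_t (ker A_t)` is orthogonal to `im
A_t`. As a nonzero column of `A` cannot vanish together with its derivative at one point, `A_t +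
A'_t P` is an isomorphism onto the normal space, with `P` the orthogonal projection onto `ker A_t`
(`IsLagrangeTensor.exists_eq_add`). By Hadamard's lemma `A_s P / (s - t)` is smooth through `s = t`,
so `A_s = B_s (1 - P + (s - t) P)` with `B` smooth near `t` and `B_t = A_t + A'_t P` invertible.

This gives regularity near `t` except possibly at `t`, and `Z = (B^*)⁻¹ (1 - P + (s - t)⁻¹ P) v`
(`IsLagrangeTensor.exists_dual_fields`). If `v ⟂ ker A_t`, then `Z = (B^*)⁻¹ v` extends to a smooth
field without zeros near `t`, and `g_v` is smooth and positive. Otherwise `(s - t) Z` extends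
smoothly with a nonzero value at `t`, so `g_v = |s - t| h` with `h` continuous and `h t > 0`: a
corner at an interior point.

For the differential identity, differentiating `⟪Z, A w⟫ = ⟪v, w⟫` yields `Z' = -S Z`, and
differentiating again yields `⟪Z'', Z⟫ = 2 |Z'|² + ⟪R Z, Z⟫`. With `f = |Z|²` and `g = |v|²
f^(-1/2)` this becomes `g''/g = -⟪R Z, Z⟫/|Z|² - 3 (|Z'|² |Z|² - ⟪Z', Z⟫²)/|Z|⁴`, which is (a). It
persists at the singular points where `v ⟂ ker A_t`, so concavity follows on all of `K`. The bound
`g_v ≤ |A v|` is Cauchy-Schwarz for `|v|² = ⟪Z, A v⟫`.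

If `g_v` is constant, `g' = 0` gives `⟪Z', Z⟫ = 0`, and both nonnegative terms of `g''` vanish, so
`Z' = 0` and `⟪R Z, Z⟫ = 0`. Semidefiniteness of `R` then gives `R Z = 0`; comparison with `A v` is
uniqueness for Jacobi fields.

The connection and the curvature are defined pointwise, in the chart centred at the point.
Transition maps are isometries of the coordinate metrics, and the transformation laws of `gamma` and
`curv` allow one fixed chart to be used near each `t`. -/

theorem exists_Icc_mem_nhdsWithin {J : Set ℝ} (hJ : J.OrdConnected) (hJ' : J.Nontrivial) {t : ℝ}
    (ht : t ∈ J) {u : Set ℝ} (hu : u ∈ 𝓝[J] t) :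
    ∃ a b, a < b ∧ t ∈ Icc a b ∧ Icc a b ⊆ u ∧ Icc a b ⊆ J ∧ Icc a b ∈ 𝓝[J] t := by
  obtain ⟨ε, hε, hεu⟩ := Metric.mem_nhdsWithin_iff.1 hu
  have key : ∀ a b, a ∈ J → b ∈ J → a ≤ t → t ≤ b → a < b → t - ε < a → b < t + ε →
      (a = t → ∀ x ∈ J, t ≤ x) → (b = t → ∀ x ∈ J, x ≤ t) →
      ∃ a b, a < b ∧ t ∈ Icc a b ∧ Icc a b ⊆ u ∧ Icc a b ⊆ J ∧ Icc a b ∈ 𝓝[J] t := by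
    intro a b ha hb hat htb hab h1 h2 h3 h4
    have hsub : Icc a b ⊆ J := hJ.out ha hb
    refine ⟨a, b, hab, ⟨hat, htb⟩, fun x hx ↦ hεu ⟨?_, hsub hx⟩, hsub, ?_⟩
    · rw [Real.ball_eq_Ioo]
      exact ⟨by linarith [hx.1], by linarith [hx.2]⟩
    · rw [← Ici_inter_Iic]
      refine inter_mem ?_ ?_
      · rcases hat.eq_or_lt with h | h
        · filter_upwards [self_mem_nhdsWithin] with x hx
          exact h ▸ h3 h x hx
        · exact mem_nhdsWithin_of_mem_nhds (Ici_mem_nhds h)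
      · rcases htb.eq_or_lt with h | h
        · filter_upwards [self_mem_nhdsWithin] with x hx
          exact h ▸ h4 h.symm x hx
        · exact mem_nhdsWithin_of_mem_nhds (Iic_mem_nhds h)
  have left : (∀ x ∈ J, t ≤ x) ∨ ∃ a ∈ J, a < t ∧ t - ε < a := by
    by_cases h : ∀ x ∈ J, t ≤ x
    · exact Or.inl h
    · push Not at h
      obtain ⟨x, hx, hxt⟩ := h
      refine Or.inr ⟨max x (t - ε / 2), hJ.out hx ht ⟨le_max_left _ _, ?_⟩, ?_, ?_⟩
      · exact max_le hxt.le (by linarith)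
      · exact max_lt hxt (by linarith)
      · exact lt_of_lt_of_le (by linarith) (le_max_right _ _)
  have right : (∀ x ∈ J, x ≤ t) ∨ ∃ b ∈ J, t < b ∧ b < t + ε := by
    by_cases h : ∀ x ∈ J, x ≤ t
    · exact Or.inl h
    · push Not at h
      obtain ⟨x, hx, hxt⟩ := h
      refine Or.inr ⟨min x (t + ε / 2), hJ.out ht hx ⟨?_, min_le_left _ _⟩, ?_, ?_⟩
      · exact le_min hxt.le (by linarith)
      · exact lt_min hxt (by linarith)
      · exact lt_of_le_of_lt (min_le_right _ _) (by linarith)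
  rcases left with hl | ⟨a, ha, hat, ha'⟩ <;> rcases right with hr | ⟨b, hb, htb, hb'⟩
  · obtain ⟨x, hx, y, hy, hxy⟩ := hJ'
    exact absurd ((hr x hx).antisymm (hl x hx) |>.trans ((hl y hy).antisymm (hr y hy))) hxy
  · exact key t b ht hb le_rfl htb.le htb (by linarith) hb' (fun _ ↦ hl) (fun h ↦ absurd h htb.ne')
  · exact key a t ha ht hat.le le_rfl hat ha' (by linarith) (fun h ↦ absurd h hat.ne) (fun _ ↦ hr)
  · exact key a b ha hb hat.le htb.le (hat.trans htb) ha' hb' (fun h ↦ absurd h hat.ne)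
      (fun h ↦ absurd h htb.ne')

theorem uniqueDiffOn_of_ordConnected {J : Set ℝ} (hJ : J.OrdConnected) (hJ' : J.Nontrivial) :
    UniqueDiffOn ℝ J := by
  refine uniqueDiffOn_convex hJ.convex ?_
  obtain ⟨x, hx, y, hy, hxy⟩ := hJ'
  rcases lt_or_gt_of_ne hxy with h | h
  · obtain ⟨z, hz⟩ := exists_between h
    exact ⟨z, mem_interior.2 ⟨Ioo x y, Ioo_subset_Icc_self.trans (hJ.out hx hy), isOpen_Ioo, hz⟩⟩
  · obtain ⟨z, hz⟩ := exists_between h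
    exact ⟨z, mem_interior.2 ⟨Ioo y x, Ioo_subset_Icc_self.trans (hJ.out hy hx), isOpen_Ioo, hz⟩⟩

/-- A solution of a linear differential inequality `‖y'‖ ≤ C ‖y‖` that vanishes at a point vanishes
near this point. -/
theorem eventually_eq_zero_of_norm_deriv_le {J : Set ℝ} (hJ : J.OrdConnected) (hJ' : J.Nontrivial)
    {t : ℝ} (ht : t ∈ J) {y y' : ℝ → F} {C : ℝ}
    (hy : ∀ᶠ s in 𝓝[J] t, HasDerivWithinAt y (y' s) J s ∧ ‖y' s‖ ≤ C * ‖y s‖) (h0 : y t = 0) :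
    ∀ᶠ s in 𝓝[J] t, y s = 0 := by
  obtain ⟨a, b, hab, htab, hu, hsub, hnhds⟩ := exists_Icc_mem_nhdsWithin hJ hJ' ht hy
  have hcont : ContinuousOn y (Icc a b) := fun s hs ↦ ((hu hs).1.continuousWithinAt).mono hsub
  filter_upwards [hnhds] with s hs
  rcases le_total t s with h | h
  · refine eq_zero_of_abs_deriv_le_mul_abs_self_of_eq_zero_right (f' := y') (K := C) (a := t)
      (b := b) (hcont.mono (Icc_subset_Icc_left htab.1)) (fun x hx ↦ ?_) h0
      (fun x hx ↦ (hu ⟨htab.1.trans hx.1, hx.2.le⟩).2) s ⟨h, hs.2⟩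
    have := (hu ⟨htab.1.trans hx.1, hx.2.le⟩).1
    have h2 : Icc x b ⊆ J := (Icc_subset_Icc_left (htab.1.trans hx.1)).trans hsub
    exact (this.mono h2).mono_of_mem_nhdsWithin (Icc_mem_nhdsGE hx.2)
  · have := eq_zero_of_abs_deriv_le_mul_abs_self_of_eq_zero_right (f := fun x ↦ y (-x))
      (f' := fun x ↦ - y' (-x)) (K := C) (a := -t) (b := -a) ?_ ?_ (by simpa using h0) ?_ (-s)
      ⟨by linarith, by linarith [hs.1]⟩
    · simpa using this
    · refine hcont.comp continuousOn_neg fun x hx ↦ ⟨by linarith [hx.2], by linarith [hx.1, htab.2]⟩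
    · intro x hx
      have hx' : -x ∈ Icc a b := ⟨by linarith [hx.2], by linarith [hx.1, htab.2]⟩
      have h1 := (hu hx').1
      have h2 : Icc a (-x) ⊆ J := (Icc_subset_Icc_right hx'.2).trans hsub
      have h3 : HasDerivWithinAt y (y' (-x)) (Iic (-x)) (-x) :=
        (h1.mono h2).mono_of_mem_nhdsWithin (Icc_mem_nhdsLE (by linarith [hx.2]))
      have := HasDerivWithinAt.scomp (h := fun z : ℝ ↦ -z) (h' := -1) (s := Ici x) x h3
        (hasDerivAt_neg x).hasDerivWithinAt (fun z hz ↦ neg_le_neg (mem_Ici.1 hz))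
      simpa [Function.comp_def] using this
    · intro x hx
      have hx' : -x ∈ Icc a b := ⟨by linarith [hx.2], by linarith [hx.1, htab.2]⟩
      simpa using (hu hx').2

/-- Extend the `n`-th derivative by constants beyond the end points and integrate `n` times from
`a`. This replaces one-sided smoothness by smoothness on the whole line. -/
theorem exists_contDiff_eqOn_Icc [CompleteSpace F] {a b : ℝ} (hab : a < b) (n : ℕ) {f : ℝ → F}
    (hf : ContDiffOn ℝ n f (Icc a b)) : ∃ g : ℝ → F, ContDiff ℝ n g ∧ EqOn f g (Icc a b) := by
  induction n generalizing f with
  | zero =>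
    refine ⟨IccExtend hab.le ((Icc a b).domRestrict f), ?_, ?_⟩
    · rw [Nat.cast_zero, contDiff_zero]
      exact (continuousOn_iff_continuous_domRestrict.1 hf.continuousOn).Icc_extend'
    · intro x hx
      rw [IccExtend_of_mem _ _ hx]
      rfl
  | succ n ih =>
    have hu := uniqueDiffOn_Icc hab
    rw [Nat.cast_succ, contDiffOn_succ_iff_derivWithin hu] at hf
    obtain ⟨g, hg, hfg⟩ := ih hf.2.2
    have hd : ∀ x, HasDerivAt (fun x ↦ f a + ∫ y in a..x, g y) (g x) x := fun x ↦
      (hg.continuous.integral_hasStrictDerivAt a x).hasDerivAt.const_add _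
    refine ⟨fun x ↦ f a + ∫ y in a..x, g y, ?_, ?_⟩
    · rw [Nat.cast_succ, contDiff_succ_iff_deriv]
      refine ⟨fun x ↦ (hd x).differentiableAt, by simp, ?_⟩
      rwa [show deriv (fun x ↦ f a + ∫ y in a..x, g y) = g from funext fun x ↦ (hd x).deriv]
    · intro x hx
      have := intervalIntegral.integral_eq_sub_of_hasDeriv_right_of_le (f := f) (f' := g) hx.1
        (hf.1.continuousOn.mono (Icc_subset_Icc_right hx.2)) (fun y hy ↦ ?_)
        (hg.continuous.intervalIntegrable _ _)
      · simp [this]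
      · have hy' : y ∈ Icc a b := ⟨hy.1.le, hy.2.le.trans hx.2⟩
        have h1 := (hf.1 y hy').hasDerivWithinAt
        rw [hfg hy'] at h1
        refine h1.mono_of_mem_nhdsWithin ?_
        exact mem_of_superset (Icc_mem_nhdsGT (hy.2.trans_le hx.2)) (Icc_subset_Icc_left hy.1.le)

/-- Differentiation under the integral turns the weight `s ^ k` into `s ^ (k + 1)` and `f` into its
derivative; the weight is there for the induction, and only `k = 0` is used later. -/
theorem contDiff_integral_pow_smul_comp (n k : ℕ) (t : ℝ) {f : ℝ → F} (hf : ContDiff ℝ n f) :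
    ContDiff ℝ n (fun x ↦ ∫ s in (0 : ℝ)..1, s ^ k • f (t + s * (x - t))) := by
  induction n generalizing k f with
  | zero =>
    rw [Nat.cast_zero, contDiff_zero] at hf ⊢
    refine intervalIntegral.continuous_parametric_intervalIntegral_of_continuous' ?_ _ _
    simp only [Function.uncurry_def]
    fun_prop
  | succ n ih =>
    rw [Nat.cast_succ, contDiff_succ_iff_deriv] at hf
    have hc : Continuous f := hf.1.continuous
    have hc' : Continuous (deriv f) := hf.2.2.continuous
    have hd : ∀ x, HasDerivAt (fun x ↦ ∫ s in (0 : ℝ)..1, s ^ k • f (t + s * (x - t)))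
        (∫ s in (0 : ℝ)..1, s ^ (k + 1) • deriv f (t + s * (x - t))) x := by
      intro x
      have hcomp : Continuous (fun p : ℝ × ℝ ↦ p.2 ^ (k + 1) • deriv f (t + p.2 * (p.1 - t))) := by
        fun_prop
      obtain ⟨C, hC⟩ := ((isCompact_closedBall x 1).prod (isCompact_Icc (a := (0 : ℝ))
        (b := 1))).exists_bound_of_continuousOn hcomp.continuousOn
      refine (intervalIntegral.hasDerivAt_integral_of_dominated_loc_of_deriv_le
        (F' := fun x s ↦ s ^ (k + 1) • deriv f (t + s * (x - t))) (bound := fun _ ↦ C)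
        (Metric.closedBall_mem_nhds x one_pos) ?_ ?_ ?_ ?_ ?_ ?_).2
      · refine Eventually.of_forall fun x ↦ Continuous.aestronglyMeasurable ?_
        fun_prop
      · refine Continuous.intervalIntegrable ?_ _ _
        fun_prop
      · refine Continuous.aestronglyMeasurable ?_
        fun_prop
      · refine Eventually.of_forall fun s hs y hy ↦ hC (y, s) ⟨hy, ?_⟩
        rw [uIoc_of_le zero_le_one] at hs
        exact ⟨hs.1.le, hs.2⟩
      · exact intervalIntegrable_const
      · refine Eventually.of_forall fun s _ y _ ↦ ?_
        have h1 : HasDerivAt (fun y ↦ t + s * (y - t)) s y := by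
          simpa using (((hasDerivAt_id y).sub_const t).const_mul s).const_add t
        have := ((hf.1 (t + s * (y - t))).hasDerivAt.scomp y h1).const_smul (s ^ k)
        simpa [pow_succ, mul_smul] using! this
    rw [Nat.cast_succ, contDiff_succ_iff_deriv]
    refine ⟨fun x ↦ (hd x).differentiableAt, by simp, ?_⟩
    rw [show deriv (fun x ↦ ∫ s in (0 : ℝ)..1, s ^ k • f (t + s * (x - t)))
      = _ from funext fun x ↦ (hd x).deriv]
    exact ih (k + 1) hf.2.2

/-- Hadamard's lemma, in one variable, for a map that is smooth within an interval. -/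
theorem contDiffWithinAt_update_slope [CompleteSpace F] {J : Set ℝ} (hJ : J.OrdConnected) (hJ' : J.Nontrivial)
    {t : ℝ} (ht : t ∈ J) {f : ℝ → F} (hf : ContDiffWithinAt ℝ ∞ f J t) :
    ContDiffWithinAt ℝ ∞ (Function.update (slope f t) t (derivWithin f J t)) J t := by
  rw [contDiffWithinAt_infty]
  intro n
  -- The quotient costs one derivative, hence `n + 1`. The neighbourhood depends on `n`, so each
  -- finite order is treated separately.
  obtain ⟨u, hu, -, hfu⟩ := (hf.of_le (m := ((n + 1 : ℕ) : WithTop ℕ∞)) (by exact_mod_cast le_top)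
    ).contDiffOn le_rfl (by simp)
  rw [insert_eq_of_mem ht] at hu
  obtain ⟨a, b, hab, htab, habu, hsub, hnhds⟩ := exists_Icc_mem_nhdsWithin hJ hJ' ht hu
  obtain ⟨g, hg, hfg⟩ := exists_contDiff_eqOn_Icc hab (n + 1) (hfu.mono habu)
  rw [Nat.cast_succ, contDiff_succ_iff_deriv] at hg
  have h := contDiff_integral_pow_smul_comp n 0 t hg.2.2
  have heq : f =ᶠ[𝓝[J] t] g := by
    filter_upwards [hnhds] with x hx using hfg hx
  -- The slope is the mean of `g'` over the segment from `t` to `x`, an expression that is also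
  -- meaningful at `x = t`.
  have hkey : ∀ x, (x - t) • ∫ s in (0 : ℝ)..1, s ^ 0 • deriv g (t + s * (x - t)) = g x - g t := by
    intro x
    simp only [pow_zero, one_smul, mul_comm _ (x - t)]
    rw [intervalIntegral.smul_integral_comp_add_mul (fun y ↦ deriv g y),
      intervalIntegral.integral_deriv_eq_sub (fun y _ ↦ hg.1 y)
        (hg.2.2.continuous.intervalIntegrable _ _)]
    simp
  have hself : derivWithin f J t = ∫ s in (0 : ℝ)..1, s ^ 0 • deriv g (t + s * (t - t)) := by
    rw [heq.derivWithin_eq (hfg htab), (hg.1 t).derivWithin (uniqueDiffOn_of_ordConnected hJ hJ' t ht)]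
    simp
  refine (h.contDiffWithinAt (s := J)).congr_of_eventuallyEq ?_ ?_
  · filter_upwards [heq] with x hx
    rcases eq_or_ne x t with rfl | hxt
    · rw [Function.update_self, hself]
    · rw [Function.update_of_ne hxt, slope_def_module, hx, hfg htab, ← hkey x, smul_smul,
        inv_mul_cancel₀ (sub_ne_zero.2 hxt), one_smul]
  · rw [Function.update_self, hself]

end Calculus

theorem two_le_infty : (2 : WithTop ℕ∞) ≤ ∞ :=
  ENat.LEInfty.out

/-! ### Riemannian geometry of a metric on an open subset of a vector space -/

section LocalGeometry

variable {E : Type*} [NormedAddCommGroup E] [NormedSpace ℝ E]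

/-- The Christoffel symbols of the first kind of a metric `g` on `E`, as a trilinear map. -/
def lowerGamma (g : E → E →L[ℝ] E →L[ℝ] ℝ) (y : E) : E →L[ℝ] E →L[ℝ] E →L[ℝ] ℝ :=
  (1 / 2 : ℝ) • (fderiv ℝ g y + (fderiv ℝ g y).flip
    - (ContinuousLinearMap.flipₗᵢ ℝ E E ℝ).toLinearIsometry.toContinuousLinearMap ∘L
      (fderiv ℝ g y).flip)

theorem lowerGamma_apply (g : E → E →L[ℝ] E →L[ℝ] ℝ) (y a b z : E) :
    lowerGamma g y a b z
      = (1 / 2) * (fderiv ℝ g y a b z + fderiv ℝ g y b a z - fderiv ℝ g y z a b) := by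
  simp [lowerGamma]

/-- The Christoffel symbols of a metric `g` on `E`, as a bilinear map. -/
def gamma (g : E → E →L[ℝ] E →L[ℝ] ℝ) (y : E) : E →L[ℝ] E →L[ℝ] E :=
  ContinuousLinearMap.compL ℝ E (E →L[ℝ] ℝ) E (g y).inverse ∘L lowerGamma g y

theorem gamma_apply (g : E → E →L[ℝ] E →L[ℝ] ℝ) (y a b : E) :
    gamma g y a b = (g y).inverse (lowerGamma g y a b) := rfl

/-- The curvature tensor of a metric `g` on `E`. -/
def curv (g : E → E →L[ℝ] E →L[ℝ] ℝ) (y a b z : E) : E :=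
  fderiv ℝ (gamma g) y a b z - fderiv ℝ (gamma g) y b a z
    + gamma g y a (gamma g y b z) - gamma g y b (gamma g y a z)

/-- `g` is a smooth Riemannian metric on the open subset `U` of `E`. -/
structure IsMetricOn (g : E → E →L[ℝ] E →L[ℝ] ℝ) (U : Set E) : Prop where
  isOpen : IsOpen U
  smooth : ContDiffOn ℝ ∞ g U
  symm : ∀ y ∈ U, ∀ a b, g y a b = g y b a
  pos : ∀ y ∈ U, ∀ a, a ≠ 0 → 0 < g y a a

namespace IsMetricOn

variable {g : E → E →L[ℝ] E →L[ℝ] ℝ} {U : Set E} {y : E}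

theorem contDiffAt (h : IsMetricOn g U) (hy : y ∈ U) : ContDiffAt ℝ ∞ g y :=
  h.smooth.contDiffAt (h.isOpen.mem_nhds hy)

theorem fderiv_symm (h : IsMetricOn g U) (hy : y ∈ U) (a b z : E) :
    fderiv ℝ g y a b z = fderiv ℝ g y a z b := by
  have hd : DifferentiableAt ℝ g y := (h.contDiffAt hy).differentiableAt (by simp)
  have h1 : HasFDerivAt (fun y ↦ g y b z) (((fderiv ℝ g y).flip b).flip z) y := by
    simpa using! (hd.hasFDerivAt.clm_apply (hasFDerivAt_const b y)).clm_apply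
      (hasFDerivAt_const z y)
  have h2 : HasFDerivAt (fun y ↦ g y z b) (((fderiv ℝ g y).flip z).flip b) y := by
    simpa using! (hd.hasFDerivAt.clm_apply (hasFDerivAt_const z y)).clm_apply
      (hasFDerivAt_const b y)
  have h3 : (fun y ↦ g y b z) =ᶠ[𝓝 y] (fun y ↦ g y z b) := by
    filter_upwards [h.isOpen.mem_nhds hy] with x hx using h.symm x hx b z
  have := (h1.congr_of_eventuallyEq h3.symm).unique h2
  simpa using congr($this a)

theorem fderiv_fderiv_comm (h : IsMetricOn g U) (hy : y ∈ U) (a b : E) :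
    fderiv ℝ (fderiv ℝ g) y a b = fderiv ℝ (fderiv ℝ g) y b a :=
  ((h.contDiffAt hy).isSymmSndFDerivAt (by simpa using two_le_infty)).eq a b

theorem fderiv_fderiv_symm (h : IsMetricOn g U) (hy : y ∈ U) (a b z w : E) :
    fderiv ℝ (fderiv ℝ g) y a b z w = fderiv ℝ (fderiv ℝ g) y a b w z := by
  have hd : DifferentiableAt ℝ (fderiv ℝ g) y :=
    ((h.contDiffAt hy).fderiv_right (m := ∞) (by simp)).differentiableAt (by simp)
  have h1 : ∀ z w : E, HasFDerivAt (fun y ↦ fderiv ℝ g y b z w)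
      ((((fderiv ℝ (fderiv ℝ g) y).flip b).flip z).flip w) y := fun z w ↦ by
    simpa using! ((hd.hasFDerivAt.clm_apply (hasFDerivAt_const b y)).clm_apply
      (hasFDerivAt_const z y)).clm_apply (hasFDerivAt_const w y)
  have h3 : (fun y ↦ fderiv ℝ g y b z w) =ᶠ[𝓝 y] (fun y ↦ fderiv ℝ g y b w z) := by
    filter_upwards [h.isOpen.mem_nhds hy] with x hx using h.fderiv_symm hx b z w
  have := ((h1 z w).congr_of_eventuallyEq h3.symm).unique (h1 w z)
  simpa using congr($this a)

theorem contDiffAt_lowerGamma (h : IsMetricOn g U) (hy : y ∈ U) :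
    ContDiffAt ℝ ∞ (lowerGamma g) y := by
  have hd : ContDiffAt ℝ ∞ (fderiv ℝ g) y := (h.contDiffAt hy).fderiv_right (by simp)
  have hflip : ContDiffAt ℝ ∞ (fun y ↦ (fderiv ℝ g y).flip) y :=
    ((ContinuousLinearMap.flipₗᵢ ℝ E E (E →L[ℝ] ℝ)).toLinearIsometry.toContinuousLinearMap
      ).contDiff.contDiffAt.comp y hd
  exact ((hd.add hflip).sub (contDiffAt_const.clm_comp hflip)).const_smul (1 / 2 : ℝ)

theorem fderiv_lowerGamma (h : IsMetricOn g U) (hy : y ∈ U) (a b z w : E) :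
    fderiv ℝ (lowerGamma g) y a b z w
      = (1 / 2) * (fderiv ℝ (fderiv ℝ g) y a b z w + fderiv ℝ (fderiv ℝ g) y a z b w
        - fderiv ℝ (fderiv ℝ g) y a w b z) := by
  have hd : DifferentiableAt ℝ (fderiv ℝ g) y :=
    ((h.contDiffAt hy).fderiv_right (m := ∞) (by simp)).differentiableAt (by simp)
  have h1 : ∀ b z w : E, HasFDerivAt (fun y ↦ fderiv ℝ g y b z w)
      ((((fderiv ℝ (fderiv ℝ g) y).flip b).flip z).flip w) y := fun b z w ↦ by
    simpa using! ((hd.hasFDerivAt.clm_apply (hasFDerivAt_const b y)).clm_apply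
      (hasFDerivAt_const z y)).clm_apply (hasFDerivAt_const w y)
  have hl : DifferentiableAt ℝ (lowerGamma g) y :=
    (h.contDiffAt_lowerGamma hy).differentiableAt (by simp)
  have h2 : HasFDerivAt (fun y ↦ lowerGamma g y b z w)
      ((((fderiv ℝ (lowerGamma g) y).flip b).flip z).flip w) y := by
    simpa using! ((hl.hasFDerivAt.clm_apply (hasFDerivAt_const b y)).clm_apply
      (hasFDerivAt_const z y)).clm_apply (hasFDerivAt_const w y)
  have h3 := (((h1 b z w).add (h1 z b w)).sub (h1 w b z)).const_mul (1 / 2)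
  have h4 := h2.unique (h3.congr_of_eventuallyEq (Eventually.of_forall fun y ↦ by
    simp [lowerGamma_apply]))
  simpa using congr($h4 a)

variable [FiniteDimensional ℝ E]

/-- A positive definite form is nondegenerate, so on `U` the `inverse` in `gamma` is a true inverse
and never its default value. -/
theorem exists_equiv (h : IsMetricOn g U) (hy : y ∈ U) :
    ∃ e : E ≃L[ℝ] (E →L[ℝ] ℝ), (e : E →L[ℝ] (E →L[ℝ] ℝ)) = g y := by
  have hinj : Function.Injective (g y : E →ₗ[ℝ] (E →L[ℝ] ℝ)) := by
    rw [injective_iff_map_eq_zero]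
    intro a ha
    by_contra hne
    have := h.pos y hy a hne
    rw [show g y a = 0 from ha] at this
    simp at this
  have hrank : Module.finrank ℝ E = Module.finrank ℝ (E →L[ℝ] ℝ) := by
    rw [← (LinearMap.toContinuousLinearMap (𝕜 := ℝ) (E := E) (F' := ℝ)).finrank_eq]
    exact (Subspace.dual_finrank_eq (K := ℝ) (V := E)).symm
  refine ⟨(LinearEquiv.ofBijective _ ⟨hinj,
    (LinearMap.injective_iff_surjective_of_finrank_eq_finrank hrank).1 hinj⟩
    ).toContinuousLinearEquiv, ?_⟩
  ext a b
  rfl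

theorem apply_gamma (h : IsMetricOn g U) (hy : y ∈ U) (a b z : E) :
    g y (gamma g y a b) z = lowerGamma g y a b z := by
  obtain ⟨e, he⟩ := h.exists_equiv hy
  rw [gamma_apply, ← he, ContinuousLinearMap.inverse_equiv]
  simp

theorem eq_of_forall (h : IsMetricOn g U) (hy : y ∈ U) {a b : E} (hab : ∀ z, g y a z = g y b z) :
    a = b := by
  obtain ⟨e, he⟩ := h.exists_equiv hy
  apply e.injective
  change (e : E →L[ℝ] (E →L[ℝ] ℝ)) a = (e : E →L[ℝ] (E →L[ℝ] ℝ)) b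
  rw [he]
  exact ContinuousLinearMap.ext hab

theorem gamma_comm (h : IsMetricOn g U) (hy : y ∈ U) (a b : E) :
    gamma g y a b = gamma g y b a := by
  refine h.eq_of_forall hy fun z ↦ ?_
  rw [h.apply_gamma hy, h.apply_gamma hy, lowerGamma_apply, lowerGamma_apply,
    h.fderiv_symm hy z a b]
  ring

/-- Compatibility with the metric, `∇g = 0`: in the sum of the two Koszul expressions all terms
cancel but one derivative, counted twice. -/
theorem fderiv_eq (h : IsMetricOn g U) (hy : y ∈ U) (a b z : E) :
    fderiv ℝ g y a b z = g y (gamma g y a b) z + g y b (gamma g y a z) := by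
  rw [h.symm y hy b, h.apply_gamma hy, h.apply_gamma hy, lowerGamma_apply, lowerGamma_apply,
    h.fderiv_symm hy a z b, h.fderiv_symm hy b a z, h.fderiv_symm hy z a b]
  ring

theorem contDiffAt_gamma (h : IsMetricOn g U) (hy : y ∈ U) : ContDiffAt ℝ ∞ (gamma g) y := by
  obtain ⟨e, he⟩ := h.exists_equiv hy
  have hinv : ContDiffAt ℝ ∞ (fun y ↦ (g y).inverse) y := by
    have hinv := contDiffAt_map_inverse (n := ∞) e
    rw [he] at hinv
    exact hinv.comp y (h.contDiffAt hy)
  exact ((ContinuousLinearMap.compL ℝ E (E →L[ℝ] ℝ) E).contDiff.contDiffAt.comp y hinv).clm_comp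
    (h.contDiffAt_lowerGamma hy)

/-- The curvature tensor with its last index lowered. -/
theorem apply_curv (h : IsMetricOn g U) (hy : y ∈ U) (a b z w : E) :
    g y (curv g y a b z) w = fderiv ℝ (lowerGamma g) y a b z w - fderiv ℝ (lowerGamma g) y b a z w
      - g y (gamma g y a w) (gamma g y b z) + g y (gamma g y b w) (gamma g y a z) := by
  have hg : DifferentiableAt ℝ g y := (h.contDiffAt hy).differentiableAt (by simp)
  have hΓ : DifferentiableAt ℝ (gamma g) y := (h.contDiffAt_gamma hy).differentiableAt (by simp)
  have hl : DifferentiableAt ℝ (lowerGamma g) y :=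
    (h.contDiffAt_lowerGamma hy).differentiableAt (by simp)
  -- Differentiating the defining relation of `gamma` avoids differentiating the inverse of the
  -- metric.
  have key : ∀ a b, g y (fderiv ℝ (gamma g) y a b z) w
      = fderiv ℝ (lowerGamma g) y a b z w - fderiv ℝ g y a (gamma g y b z) w := by
    intro a b
    have h1 := ((hg.hasFDerivAt.clm_apply ((hΓ.hasFDerivAt.clm_apply
      (hasFDerivAt_const b y)).clm_apply (hasFDerivAt_const z y))).clm_apply
      (hasFDerivAt_const w y))
    have h2 := ((hl.hasFDerivAt.clm_apply (hasFDerivAt_const b y)).clm_apply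
      (hasFDerivAt_const z y)).clm_apply (hasFDerivAt_const w y)
    have h3 : (fun y ↦ g y (gamma g y b z) w) =ᶠ[𝓝 y] fun y ↦ lowerGamma g y b z w := by
      filter_upwards [h.isOpen.mem_nhds hy] with x hx using h.apply_gamma hx b z w
    have := congr($(h1.unique (h2.congr_of_eventuallyEq h3)) a)
    simp at this
    linarith
  rw [curv]
  simp only [map_add, map_sub, add_apply, sub_apply]
  rw [key a b, key b a, h.fderiv_eq hy a, h.fderiv_eq hy b, h.symm y hy (gamma g y b z),
    h.symm y hy (gamma g y a z)]
  ring

theorem hasDerivWithinAt_apply (h : IsMetricOn g U) {J : Set ℝ} {t : ℝ} {x X Y : ℝ → E}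
    (hx : x t ∈ U) (hxd : DifferentiableWithinAt ℝ x J t) (hX : DifferentiableWithinAt ℝ X J t)
    (hY : DifferentiableWithinAt ℝ Y J t) :
    HasDerivWithinAt (fun s ↦ g (x s) (X s) (Y s))
      (g (x t) (derivWithin X J t + gamma g (x t) (derivWithin x J t) (X t)) (Y t)
        + g (x t) (X t) (derivWithin Y J t + gamma g (x t) (derivWithin x J t) (Y t))) J t := by
  have hg : DifferentiableAt ℝ g (x t) := (h.contDiffAt hx).differentiableAt (by simp)
  have hd := ((hg.hasFDerivAt.comp_hasDerivWithinAt t hxd.hasDerivWithinAt).clm_apply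
    hX.hasDerivWithinAt).clm_apply hY.hasDerivWithinAt
  refine HasDerivWithinAt.congr_deriv hd ?_
  simp only [Function.comp_apply, add_apply, map_add]
  rw [h.fderiv_eq hx]
  ring

/-- In the lowered curvature the quadratic terms match since `gamma` and `g` are symmetric, and the
second derivatives of `g` match since they are symmetric in both pairs of arguments. The Bianchi
identity is not needed. -/
theorem apply_curv_symm (h : IsMetricOn g U) (hy : y ∈ U) (a b w : E) :
    g y (curv g y a b b) w = g y (curv g y w b b) a := by
  rw [h.apply_curv hy, h.apply_curv hy]
  simp only [h.fderiv_lowerGamma hy]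
  rw [h.gamma_comm hy w a, h.gamma_comm hy w b, h.gamma_comm hy b a,
    h.symm y hy (gamma g y b w), h.fderiv_fderiv_comm hy w b,
    h.fderiv_fderiv_comm hy w a, h.fderiv_fderiv_comm hy b a, h.fderiv_fderiv_symm hy b b w a,
    h.fderiv_fderiv_symm hy b w a b, h.fderiv_fderiv_symm hy a b w b]
  ring

theorem apply_curv_self (h : IsMetricOn g U) (hy : y ∈ U) (a b : E) :
    g y (curv g y a b b) b = 0 := by
  rw [h.apply_curv hy]
  simp only [h.fderiv_lowerGamma hy]
  rw [h.symm y hy (gamma g y b b), h.fderiv_fderiv_comm hy b a,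
    h.fderiv_fderiv_symm hy b b a b]
  ring

end IsMetricOn

/-- `φ` is an isometry from `U` with the metric `g` to `V` with the metric `h`. -/
structure IsLocalIsometry (g h : E → E →L[ℝ] E →L[ℝ] ℝ) (U V : Set E) (φ : E → E) : Prop where
  source : IsMetricOn g U
  target : IsMetricOn h V
  mapsTo : MapsTo φ U V
  smooth : ContDiffOn ℝ ∞ φ U
  pullback : ∀ y ∈ U, ∀ a b, g y a b = h (φ y) (fderiv ℝ φ y a) (fderiv ℝ φ y b)

namespace IsLocalIsometry

variable {g h : E → E →L[ℝ] E →L[ℝ] ℝ} {U V : Set E} {φ : E → E} {y : E}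

theorem contDiffAt (H : IsLocalIsometry g h U V φ) (hy : y ∈ U) : ContDiffAt ℝ ∞ φ y :=
  H.smooth.contDiffAt (H.source.isOpen.mem_nhds hy)

theorem fderiv_surjective [FiniteDimensional ℝ E] (H : IsLocalIsometry g h U V φ) (hy : y ∈ U) :
    Function.Surjective (fderiv ℝ φ y) := by
  refine (LinearMap.injective_iff_surjective (f := (fderiv ℝ φ y : E →ₗ[ℝ] E))).1 ?_
  rw [injective_iff_map_eq_zero]
  intro a ha
  by_contra hne
  have := H.source.pos y hy a hne
  rw [H.pullback y hy, show fderiv ℝ φ y a = 0 from ha] at this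
  simp at this

theorem fderiv_metric (H : IsLocalIsometry g h U V φ) (hy : y ∈ U) (z a b : E) :
    fderiv ℝ g y z a b = fderiv ℝ h (φ y) (fderiv ℝ φ y z) (fderiv ℝ φ y a) (fderiv ℝ φ y b)
      + h (φ y) (fderiv ℝ (fderiv ℝ φ) y z a) (fderiv ℝ φ y b)
      + h (φ y) (fderiv ℝ φ y a) (fderiv ℝ (fderiv ℝ φ) y z b) := by
  have hg : DifferentiableAt ℝ g y := (H.source.contDiffAt hy).differentiableAt (by simp)
  have hh : DifferentiableAt ℝ h (φ y) :=
    (H.target.contDiffAt (H.mapsTo hy)).differentiableAt (by simp)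
  have hφ : DifferentiableAt ℝ φ y := (H.contDiffAt hy).differentiableAt (by simp)
  have hφ' : DifferentiableAt ℝ (fderiv ℝ φ) y :=
    ((H.contDiffAt hy).fderiv_right (m := ∞) (by simp)).differentiableAt (by simp)
  have h1 := (hg.hasFDerivAt.clm_apply (hasFDerivAt_const a y)).clm_apply (hasFDerivAt_const b y)
  have h2 := ((hh.hasFDerivAt.comp y hφ.hasFDerivAt).clm_apply
    (hφ'.hasFDerivAt.clm_apply (hasFDerivAt_const a y))).clm_apply
    (hφ'.hasFDerivAt.clm_apply (hasFDerivAt_const b y))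
  have h3 : (fun y ↦ g y a b) =ᶠ[𝓝 y] fun y ↦ h (φ y) (fderiv ℝ φ y a) (fderiv ℝ φ y b) := by
    filter_upwards [H.source.isOpen.mem_nhds hy] with x hx using H.pullback x hx a b
  have := congr($(h1.unique (h2.congr_of_eventuallyEq h3)) z)
  simp at this
  linarith

theorem fderiv_fderiv_comm (H : IsLocalIsometry g h U V φ) (hy : y ∈ U) (a b : E) :
    fderiv ℝ (fderiv ℝ φ) y a b = fderiv ℝ (fderiv ℝ φ) y b a :=
  ((H.contDiffAt hy).isSymmSndFDerivAt (by simpa using two_le_infty)).eq a b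

/-- Differentiating the pullback relation expresses `∂g` by `∂h` and `D²φ`; in the Koszul
combination the `D²φ` terms collapse to the single inhomogeneous one. -/
theorem fderiv_gamma [FiniteDimensional ℝ E] (H : IsLocalIsometry g h U V φ) (hy : y ∈ U)
    (a b : E) :
    fderiv ℝ φ y (gamma g y a b)
      = gamma h (φ y) (fderiv ℝ φ y a) (fderiv ℝ φ y b) + fderiv ℝ (fderiv ℝ φ) y a b := by
  refine H.target.eq_of_forall (H.mapsTo hy) fun z' ↦ ?_
  obtain ⟨z, rfl⟩ := H.fderiv_surjective hy z'
  rw [← H.pullback y hy, H.source.apply_gamma hy, map_add, add_apply,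
    H.target.apply_gamma (H.mapsTo hy), lowerGamma_apply, lowerGamma_apply, H.fderiv_metric hy,
    H.fderiv_metric hy, H.fderiv_metric hy, H.fderiv_fderiv_comm hy z a,
    H.fderiv_fderiv_comm hy z b, H.fderiv_fderiv_comm hy b a,
    H.target.symm _ (H.mapsTo hy) (fderiv ℝ φ y b), H.target.symm _ (H.mapsTo hy) (fderiv ℝ φ y a)]
  ring

/-- One differentiates `fderiv_gamma` and antisymmetrizes in `a` and `b`: the third derivatives of
`φ` drop out by symmetry, and the second ones cancel against those from the quadratic terms of
`curv`. -/
theorem fderiv_curv [FiniteDimensional ℝ E] (H : IsLocalIsometry g h U V φ) (hy : y ∈ U)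
    (a b z : E) :
    fderiv ℝ φ y (curv g y a b z)
      = curv h (φ y) (fderiv ℝ φ y a) (fderiv ℝ φ y b) (fderiv ℝ φ y z) := by
  have hΓg : DifferentiableAt ℝ (gamma g) y :=
    (H.source.contDiffAt_gamma hy).differentiableAt (by simp)
  have hΓh : DifferentiableAt ℝ (gamma h) (φ y) :=
    (H.target.contDiffAt_gamma (H.mapsTo hy)).differentiableAt (by simp)
  have hφ : DifferentiableAt ℝ φ y := (H.contDiffAt hy).differentiableAt (by simp)
  have hφ1 : ContDiffAt ℝ ∞ (fderiv ℝ φ) y := (H.contDiffAt hy).fderiv_right (by simp)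
  have hφ' : DifferentiableAt ℝ (fderiv ℝ φ) y := hφ1.differentiableAt (by simp)
  have hφ'' : DifferentiableAt ℝ (fderiv ℝ (fderiv ℝ φ)) y :=
    (hφ1.fderiv_right (m := ∞) (by simp)).differentiableAt (by simp)
  have key : ∀ a b, fderiv ℝ φ y (fderiv ℝ (gamma g) y a b z)
      = fderiv ℝ (gamma h) (φ y) (fderiv ℝ φ y a) (fderiv ℝ φ y b) (fderiv ℝ φ y z)
        + gamma h (φ y) (fderiv ℝ (fderiv ℝ φ) y a b) (fderiv ℝ φ y z)
        + gamma h (φ y) (fderiv ℝ φ y b) (fderiv ℝ (fderiv ℝ φ) y a z)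
        + fderiv ℝ (fderiv ℝ (fderiv ℝ φ)) y a b z
        - fderiv ℝ (fderiv ℝ φ) y a (gamma g y b z) := by
    intro a b
    have h1 := hφ'.hasFDerivAt.clm_apply ((hΓg.hasFDerivAt.clm_apply
      (hasFDerivAt_const b y)).clm_apply (hasFDerivAt_const z y))
    have h2 := (((hΓh.hasFDerivAt.comp y hφ.hasFDerivAt).clm_apply
      (hφ'.hasFDerivAt.clm_apply (hasFDerivAt_const b y))).clm_apply
      (hφ'.hasFDerivAt.clm_apply (hasFDerivAt_const z y))).add
      ((hφ''.hasFDerivAt.clm_apply (hasFDerivAt_const b y)).clm_apply (hasFDerivAt_const z y))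
    have h3 : (fun y ↦ fderiv ℝ φ y (gamma g y b z)) =ᶠ[𝓝 y] fun y ↦
        gamma h (φ y) (fderiv ℝ φ y b) (fderiv ℝ φ y z) + fderiv ℝ (fderiv ℝ φ) y b z := by
      filter_upwards [H.source.isOpen.mem_nhds hy] with x hx using H.fderiv_gamma hx b z
    have := congr($(h1.unique (h2.congr_of_eventuallyEq h3)) a)
    simp at this
    rw [eq_sub_iff_add_eq, this]
    abel
  have hsymm : fderiv ℝ (fderiv ℝ (fderiv ℝ φ)) y a b z
      = fderiv ℝ (fderiv ℝ (fderiv ℝ φ)) y b a z :=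
    congr($((hφ1.isSymmSndFDerivAt (by simpa using two_le_infty)).eq a b) z)
  rw [curv, curv]
  simp only [map_add, map_sub]
  rw [key a b, key b a, H.fderiv_gamma hy a (gamma g y b z), H.fderiv_gamma hy b (gamma g y a z),
    H.fderiv_gamma hy b z, H.fderiv_gamma hy a z, hsymm, H.fderiv_fderiv_comm hy a b]
  simp only [map_add]
  abel

/-- The covariant derivative along a curve does not depend on the coordinates. -/
theorem fderiv_covariant [FiniteDimensional ℝ E] (H : IsLocalIsometry g h U V φ) {J : Set ℝ}
    {t : ℝ} (hJ : UniqueDiffWithinAt ℝ J t) {x X : ℝ → E} (hx : x t ∈ U)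
    (hxd : DifferentiableWithinAt ℝ x J t) (hXd : DifferentiableWithinAt ℝ X J t) :
    derivWithin (fun s ↦ fderiv ℝ φ (x s) (X s)) J t + gamma h (φ (x t))
        (derivWithin (fun s ↦ φ (x s)) J t) (fderiv ℝ φ (x t) (X t))
      = fderiv ℝ φ (x t) (derivWithin X J t + gamma g (x t) (derivWithin x J t) (X t)) := by
  have hφ : DifferentiableAt ℝ φ (x t) := (H.contDiffAt hx).differentiableAt (by simp)
  have hφ' : DifferentiableAt ℝ (fderiv ℝ φ) (x t) :=
    ((H.contDiffAt hx).fderiv_right (m := ∞) (by simp)).differentiableAt (by simp)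
  have h1 := hφ.hasFDerivAt.comp_hasDerivWithinAt t hxd.hasDerivWithinAt
  have h2 := (hφ'.hasFDerivAt.comp_hasDerivWithinAt t hxd.hasDerivWithinAt).clm_apply
    hXd.hasDerivWithinAt
  rw [show derivWithin (fun s ↦ φ (x s)) J t = _ from h1.derivWithin hJ,
    show derivWithin (fun s ↦ fderiv ℝ φ (x s) (X s)) J t = _ from h2.derivWithin hJ, map_add,
    H.fderiv_gamma hx]
  simp only [Function.comp_apply]
  abel

end IsLocalIsometry

end LocalGeometry

/-! ### Coordinates on the manifold and independence of the chart -/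

section Charts

variable {E : Type*} [NormedAddCommGroup E] [NormedSpace ℝ E]
  {M : Type*} [TopologicalSpace M] [ChartedSpace E M] [IsManifold 𝓘(ℝ, E) ∞ M]

theorem toCoord_ofCoord {x₀ p : M} (hp : p ∈ (chartAt E x₀).source) (a : E) :
    toCoord x₀ p (ofCoord x₀ p a) = a :=
  Trivialization.continuousLinearMapAt_symmL _ hp a

theorem ofCoord_toCoord {x₀ p : M} (hp : p ∈ (chartAt E x₀).source) (v : TangentSpace 𝓘(ℝ, E) p) :
    ofCoord x₀ p (toCoord x₀ p v) = v :=
  Trivialization.symmL_continuousLinearMapAt _ hp v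

theorem toCoord_injective {x₀ p : M} (hp : p ∈ (chartAt E x₀).source) :
    Function.Injective (toCoord (E := E) x₀ p) :=
  Function.LeftInverse.injective (ofCoord_toCoord hp)

theorem toCoord_add (x₀ p : M) (v w : TangentSpace 𝓘(ℝ, E) p) :
    toCoord x₀ p (v + w) = toCoord x₀ p v + toCoord x₀ p w := map_add _ v w

theorem toCoord_sub (x₀ p : M) (v w : TangentSpace 𝓘(ℝ, E) p) :
    toCoord x₀ p (v - w) = toCoord x₀ p v - toCoord x₀ p w := map_sub _ v w

theorem toCoord_neg (x₀ p : M) (v : TangentSpace 𝓘(ℝ, E) p) :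
    toCoord x₀ p (-v) = -toCoord x₀ p v := map_neg _ v

theorem toCoord_smul (x₀ p : M) (r : ℝ) (v : TangentSpace 𝓘(ℝ, E) p) :
    toCoord x₀ p (r • v) = r • toCoord x₀ p v := map_smul _ r v

theorem toCoord_zero (x₀ p : M) : toCoord x₀ p (0 : TangentSpace 𝓘(ℝ, E) p) = 0 := map_zero _

/-- The change of coordinates from the chart at `p` to the chart at `x₀`. -/
def transition (p x₀ : M) : E → E := extChartAt 𝓘(ℝ, E) x₀ ∘ (extChartAt 𝓘(ℝ, E) p).symm

/-- The domain of the change of coordinates. -/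
def transitionSource (p x₀ : M) : Set E :=
  ((extChartAt 𝓘(ℝ, E) p).symm ≫ extChartAt 𝓘(ℝ, E) x₀).source

theorem mem_transitionSource {p x₀ q : M} (hp : q ∈ (chartAt E p).source)
    (hx : q ∈ (chartAt E x₀).source) :
    extChartAt 𝓘(ℝ, E) p q ∈ transitionSource (E := E) p x₀ := by
  rw [transitionSource, PartialEquiv.trans_source'', PartialEquiv.symm_symm,
    PartialEquiv.symm_target]
  exact mem_image_of_mem _ ⟨by simpa using hp, by simpa using hx⟩

theorem transition_apply {p x₀ q : M} (hp : q ∈ (chartAt E p).source) :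
    transition p x₀ (extChartAt 𝓘(ℝ, E) p q) = extChartAt 𝓘(ℝ, E) x₀ q := by
  rw [transition, Function.comp_apply, (extChartAt 𝓘(ℝ, E) p).left_inv (by simpa using hp)]

theorem isOpen_transitionSource (p x₀ : M) : IsOpen (transitionSource (E := E) p x₀) := by
  rw [transitionSource, PartialEquiv.trans_source]
  exact (continuousOn_extChartAt_symm p).isOpen_inter_preimage (isOpen_extChartAt_target p)
    (isOpen_extChartAt_source x₀)

theorem contDiffOn_transition (p x₀ : M) :
    ContDiffOn ℝ ∞ (transition (E := E) p x₀) (transitionSource p x₀) :=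
  contDiffOn_ext_coord_change x₀ p

theorem toCoord_eq_fderiv_transition {p x₀ q : M} (hp : q ∈ (chartAt E p).source)
    (hx : q ∈ (chartAt E x₀).source) (v : TangentSpace 𝓘(ℝ, E) q) :
    toCoord x₀ q v
      = fderiv ℝ (transition p x₀) (extChartAt 𝓘(ℝ, E) p q) (toCoord p q v) := by
  have h1 : fderiv ℝ (transition p x₀) (extChartAt 𝓘(ℝ, E) p q)
      = tangentCoordChange 𝓘(ℝ, E) p x₀ q := by
    rw [tangentCoordChange_def]
    simp [transition, fderivWithin_univ]
  rw [h1, toCoord, toCoord, TangentBundle.continuousLinearMapAt_trivializationAt_eq_core hp,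
    TangentBundle.continuousLinearMapAt_trivializationAt_eq_core hx]
  refine (tangentCoordChange_comp (I := 𝓘(ℝ, E)) ?_).symm
  simp [hp, hx]

theorem toCoord_velocity {c : ℝ → M} {J : Set ℝ} {t : ℝ} {x₀ : M} (hJ : UniqueDiffWithinAt ℝ J t)
    (hc : MDifferentiableWithinAt 𝓘(ℝ, ℝ) 𝓘(ℝ, E) c J t) (hx : c t ∈ (chartAt E x₀).source) :
    toCoord x₀ (c t) (velocity c J t)
      = derivWithin (fun s ↦ extChartAt 𝓘(ℝ, E) x₀ (c s)) J t := by
  rw [toCoord, TangentBundle.continuousLinearMapAt_trivializationAt hx, velocity]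
  have h1 : MDifferentiableAt 𝓘(ℝ, E) 𝓘(ℝ, E) (extChartAt 𝓘(ℝ, E) x₀) (c t) :=
    mdifferentiableAt_extChartAt hx
  have h2 := mfderiv_comp_mfderivWithin t h1 hc hJ.uniqueMDiffWithinAt
  rw [mfderivWithin_eq_fderivWithin] at h2
  rw [← fderivWithin_derivWithin]
  exact congr($h2.symm (1 : ℝ))

/-- The vector field `X` along `c` is smooth at `t`. -/
def SmoothAt (c : ℝ → M) (J : Set ℝ) (X : ∀ t, TangentSpace 𝓘(ℝ, E) (c t)) (t : ℝ) : Prop :=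
  ContMDiffWithinAt 𝓘(ℝ, ℝ) (𝓘(ℝ, E).tangent) ∞
    (fun s ↦ (⟨c s, X s⟩ : TangentBundle 𝓘(ℝ, E) M)) J t

theorem eventually_mem_chart {c : ℝ → M} {J : Set ℝ} {t : ℝ} {x₀ : M}
    (hc : ContinuousWithinAt c J t) (hx : c t ∈ (chartAt E x₀).source) :
    ∀ᶠ s in 𝓝[J] t, c s ∈ (chartAt E x₀).source :=
  hc ((chartAt E x₀).open_source.mem_nhds hx)

/-- The base component of the section is `c` itself, already smooth, so only the fibre coordinate
remains to be tested. -/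
theorem smoothAt_iff {c : ℝ → M} {J : Set ℝ} {X : ∀ t, TangentSpace 𝓘(ℝ, E) (c t)} {t : ℝ}
    {x₀ : M} (ht : t ∈ J)
    (hc : ContMDiffWithinAt 𝓘(ℝ, ℝ) 𝓘(ℝ, E) ∞ c J t) (hx : c t ∈ (chartAt E x₀).source) :
    SmoothAt c J X t ↔ ContDiffWithinAt ℝ ∞ (fun s ↦ toCoord x₀ (c s) (X s)) J t := by
  rw [SmoothAt, Trivialization.contMDiffWithinAt_iff
    (e := trivializationAt E (TangentSpace 𝓘(ℝ, E) : M → Type _) x₀) (by simpa using hx)]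
  have h : (fun s ↦ ((trivializationAt E (TangentSpace 𝓘(ℝ, E) : M → Type _) x₀)
      (⟨c s, X s⟩ : TangentBundle 𝓘(ℝ, E) M)).2) =ᶠ[𝓝[J] t] fun s ↦ toCoord x₀ (c s) (X s) := by
    filter_upwards [eventually_mem_chart hc.continuousWithinAt hx] with s hs
    rw [toCoord, Trivialization.continuousLinearMapAt_apply,
      Trivialization.coe_linearMapAt_of_mem _ hs]
  rw [← contMDiffWithinAt_iff_contDiffWithinAt]
  constructor
  · rintro ⟨-, h2⟩
    exact h2.congr_of_eventuallyEq h.symm (h.self_of_nhdsWithin ht).symm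
  · intro h2
    exact ⟨hc, h2.congr_of_eventuallyEq h (h.self_of_nhdsWithin ht)⟩

theorem contDiffWithinAt_extChartAt {c : ℝ → M} {J : Set ℝ} {t : ℝ} {x₀ : M}
    (hc : ContMDiffWithinAt 𝓘(ℝ, ℝ) 𝓘(ℝ, E) ∞ c J t) (hx : c t ∈ (chartAt E x₀).source) :
    ContDiffWithinAt ℝ ∞ (fun s ↦ extChartAt 𝓘(ℝ, E) x₀ (c s)) J t := by
  rw [← contMDiffWithinAt_iff_contDiffWithinAt]
  exact (contMDiffAt_extChartAt' hx).comp_contMDiffWithinAt t hc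

variable [RiemannianBundle (fun x : M ↦ TangentSpace 𝓘(ℝ, E) x)]

theorem chartMetric_apply {x₀ p : M} (hp : p ∈ (chartAt E x₀).source) (a b : E) :
    chartMetric x₀ (extChartAt 𝓘(ℝ, E) x₀ p) a b
      = inner ℝ (ofCoord x₀ p a) (ofCoord x₀ p b) := by
  have h : (extChartAt 𝓘(ℝ, E) x₀).symm (extChartAt 𝓘(ℝ, E) x₀ p) = p :=
    (extChartAt 𝓘(ℝ, E) x₀).left_inv (by simpa using hp)
  simp only [chartMetric, ofCoord]
  rw [h]
  rfl

theorem inner_eq_chartMetric {x₀ p : M} (hp : p ∈ (chartAt E x₀).source)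
    (v w : TangentSpace 𝓘(ℝ, E) p) :
    inner ℝ v w = chartMetric x₀ (extChartAt 𝓘(ℝ, E) x₀ p) (toCoord x₀ p v) (toCoord x₀ p w) := by
  rw [chartMetric_apply hp, ofCoord_toCoord hp, ofCoord_toCoord hp]

theorem christoffel_eq_gamma (x₀ : M) (y a b : E) :
    christoffel x₀ y a b = gamma (chartMetric x₀) y a b := by
  rw [christoffel, gamma_apply]
  congr 1

variable [FiniteDimensional ℝ E]
  [IsContMDiffRiemannianBundle 𝓘(ℝ, E) ∞ E (fun x : M ↦ TangentSpace 𝓘(ℝ, E) x)]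

theorem isMetricOn_chartMetric (x₀ : M) :
    IsMetricOn (chartMetric (E := E) x₀) (extChartAt 𝓘(ℝ, E) x₀).target where
  isOpen := isOpen_extChartAt_target x₀
  smooth := by
    -- The entries of the chart metric are inner products of fields with constant coordinates, and
    -- these fields are smooth; in finite dimension the entries determine the smoothness of the
    -- form.
    have hsec : ∀ a : E, ContMDiffOn 𝓘(ℝ, E) (𝓘(ℝ, E).tangent) ∞
        (fun y : E ↦ (⟨(extChartAt 𝓘(ℝ, E) x₀).symm y,
          ofCoord x₀ ((extChartAt 𝓘(ℝ, E) x₀).symm y) a⟩ : TangentBundle 𝓘(ℝ, E) M))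
        (extChartAt 𝓘(ℝ, E) x₀).target := by
      intro a
      have hmaps : MapsTo (extChartAt 𝓘(ℝ, E) x₀).symm (extChartAt 𝓘(ℝ, E) x₀).target
          (chartAt E x₀).source := fun y hy ↦ by
        simpa using (extChartAt 𝓘(ℝ, E) x₀).map_target hy
      refine (Trivialization.contMDiffOn_iff
        (e := trivializationAt E (TangentSpace 𝓘(ℝ, E) : M → Type _) x₀) ?_).2 ⟨?_, ?_⟩
      · intro y hy
        simpa using hmaps hy
      · exact contMDiffOn_extChartAt_symm x₀
      · refine (contMDiffOn_const (c := a)).congr fun y hy ↦ ?_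
        have := toCoord_ofCoord (hmaps hy) a
        rwa [toCoord, Trivialization.continuousLinearMapAt_apply,
          Trivialization.coe_linearMapAt_of_mem _ (hmaps hy)] at this
    rw [contDiffOn_clm_apply]
    intro a
    rw [contDiffOn_clm_apply]
    intro b
    rw [← contMDiffOn_iff_contDiffOn]
    exact ContMDiffOn.inner_bundle (F := E) (E := fun x : M ↦ TangentSpace 𝓘(ℝ, E) x)
      (hsec a) (hsec b)
  symm y hy a b := by
    simp only [chartMetric, ContinuousLinearMap.bilinearComp_apply, innerSL_apply_apply]
    exact real_inner_comm _ _
  pos y hy a ha := by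
    have hp : (extChartAt 𝓘(ℝ, E) x₀).symm y ∈ (chartAt E x₀).source := by
      simpa using (extChartAt 𝓘(ℝ, E) x₀).map_target hy
    have h := chartMetric_apply (E := E) hp a a
    rw [(extChartAt 𝓘(ℝ, E) x₀).right_inv hy] at h
    rw [h, real_inner_self_eq_norm_sq]
    have : ofCoord x₀ ((extChartAt 𝓘(ℝ, E) x₀).symm y) a ≠ 0 := fun h0 ↦ ha (by
      rw [← toCoord_ofCoord hp a, h0, toCoord_zero])
    positivity

theorem mem_target {x₀ p : M} (hp : p ∈ (chartAt E x₀).source) :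
    extChartAt 𝓘(ℝ, E) x₀ p ∈ (extChartAt 𝓘(ℝ, E) x₀).target :=
  (extChartAt 𝓘(ℝ, E) x₀).map_source (by simpa using hp)

theorem chartCurvature_eq_curv {x₀ : M} {y : E} (hy : y ∈ (extChartAt 𝓘(ℝ, E) x₀).target)
    (a b z : E) :
    chartCurvature x₀ y a b z = curv (chartMetric x₀) y a b z := by
  have hΓ : DifferentiableAt ℝ (gamma (chartMetric (E := E) x₀)) y :=
    ((isMetricOn_chartMetric x₀).contDiffAt_gamma hy).differentiableAt (by simp)
  have key : ∀ a b : E, fderiv ℝ (fun y ↦ gamma (chartMetric (E := E) x₀) y b z) y a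
      = fderiv ℝ (gamma (chartMetric (E := E) x₀)) y a b z := by
    intro a b
    have := (hΓ.hasFDerivAt.clm_apply (hasFDerivAt_const b y)).clm_apply (hasFDerivAt_const z y)
    rw [this.fderiv]
    simp
  simp only [chartCurvature, christoffel_eq_gamma, key, curv]

/-- Both coordinate metrics describe the same inner product on the tangent spaces. All chart
independence below comes from this. -/
theorem isLocalIsometry_transition (p x₀ : M) :
    IsLocalIsometry (chartMetric (E := E) p) (chartMetric x₀) (transitionSource p x₀)
      (extChartAt 𝓘(ℝ, E) x₀).target (transition p x₀) := by
  have hsub : transitionSource (E := E) p x₀ ⊆ (extChartAt 𝓘(ℝ, E) p).target :=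
    inter_subset_left
  have hq : ∀ y ∈ transitionSource (E := E) p x₀,
      (extChartAt 𝓘(ℝ, E) p).symm y ∈ (chartAt E x₀).source := fun y hy ↦ by
    simpa using hy.2
  refine ⟨⟨isOpen_transitionSource p x₀, (isMetricOn_chartMetric p).smooth.mono hsub,
    fun y hy ↦ (isMetricOn_chartMetric p).symm y (hsub hy),
    fun y hy ↦ (isMetricOn_chartMetric p).pos y (hsub hy)⟩, isMetricOn_chartMetric x₀,
    fun y hy ↦ mem_target (hq y hy), contDiffOn_transition p x₀, fun y hy a b ↦ ?_⟩
  have hp : (extChartAt 𝓘(ℝ, E) p).symm y ∈ (chartAt E p).source := by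
    simpa using (extChartAt 𝓘(ℝ, E) p).map_target (hsub hy)
  have hy' := (extChartAt 𝓘(ℝ, E) p).right_inv (hsub hy)
  have h := chartMetric_apply (E := E) hp a b
  have h1 := toCoord_eq_fderiv_transition hp (hq y hy) (ofCoord p _ a)
  have h2 := toCoord_eq_fderiv_transition hp (hq y hy) (ofCoord p _ b)
  rw [toCoord_ofCoord hp, hy'] at h1 h2
  rw [hy'] at h
  rw [h, inner_eq_chartMetric (hq y hy), h1, h2]
  rfl

/-- The curvature tensor, in the coordinates of any chart. -/
theorem toCoord_curvature {x₀ p : M} (hp : p ∈ (chartAt E x₀).source)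
    (u v w : TangentSpace 𝓘(ℝ, E) p) :
    toCoord x₀ p (curvature p u v w) = curv (chartMetric x₀) (extChartAt 𝓘(ℝ, E) x₀ p)
      (toCoord x₀ p u) (toCoord x₀ p v) (toCoord x₀ p w) := by
  have hpp := mem_chart_source E p
  rw [toCoord_eq_fderiv_transition hpp hp, curvature, toCoord_ofCoord hpp,
    chartCurvature_eq_curv (mem_target hpp),
    (isLocalIsometry_transition p x₀).fderiv_curv (mem_transitionSource hpp hp),
    transition_apply hpp]
  simp only [← toCoord_eq_fderiv_transition hpp hp]

theorem differentiableWithinAt_toCoord_of_chart {c : ℝ → M} {J : Set ℝ}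
    {X : ∀ t, TangentSpace 𝓘(ℝ, E) (c t)} {t : ℝ} {x₀ x₁ : M} (ht : t ∈ J)
    (hc : ContMDiffWithinAt 𝓘(ℝ, ℝ) 𝓘(ℝ, E) ∞ c J t) (hx₀ : c t ∈ (chartAt E x₀).source)
    (hx₁ : c t ∈ (chartAt E x₁).source)
    (hX : DifferentiableWithinAt ℝ (fun s ↦ toCoord x₀ (c s) (X s)) J t) :
    DifferentiableWithinAt ℝ (fun s ↦ toCoord x₁ (c s) (X s)) J t := by
  have hφ : DifferentiableAt ℝ (fderiv ℝ (transition (E := E) x₀ x₁))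
      (extChartAt 𝓘(ℝ, E) x₀ (c t)) :=
    (((isLocalIsometry_transition x₀ x₁).contDiffAt
      (mem_transitionSource hx₀ hx₁)).fderiv_right (m := ∞) (by simp)).differentiableAt (by simp)
  have h := (hφ.comp_differentiableWithinAt t
    ((contDiffWithinAt_extChartAt hc hx₀).differentiableWithinAt (by simp))).clm_apply hX
  have heq : ∀ᶠ s in 𝓝[J] t, toCoord x₁ (c s) (X s) = fderiv ℝ (transition x₀ x₁)
      (extChartAt 𝓘(ℝ, E) x₀ (c s)) (toCoord x₀ (c s) (X s)) := by
    filter_upwards [eventually_mem_chart hc.continuousWithinAt hx₀,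
      eventually_mem_chart hc.continuousWithinAt hx₁] with s h0 h1
    exact toCoord_eq_fderiv_transition h0 h1 _
  exact h.congr_of_eventuallyEq heq (heq.self_of_nhdsWithin ht)

/-- The covariant derivative along a curve, in the coordinates of any chart. -/
theorem toCoord_covDeriv {c : ℝ → M} {J : Set ℝ} {X : ∀ t, TangentSpace 𝓘(ℝ, E) (c t)} {t : ℝ}
    {x₀ : M} (ht : t ∈ J) (hJ : UniqueDiffWithinAt ℝ J t)
    (hc : ContMDiffWithinAt 𝓘(ℝ, ℝ) 𝓘(ℝ, E) ∞ c J t) (hx : c t ∈ (chartAt E x₀).source)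
    (hX : DifferentiableWithinAt ℝ (fun s ↦ toCoord x₀ (c s) (X s)) J t) :
    toCoord x₀ (c t) (covDeriv c J X t)
      = derivWithin (fun s ↦ toCoord x₀ (c s) (X s)) J t
        + gamma (chartMetric x₀) (extChartAt 𝓘(ℝ, E) x₀ (c t))
          (derivWithin (fun s ↦ extChartAt 𝓘(ℝ, E) x₀ (c s)) J t) (toCoord x₀ (c t) (X t)) := by
  have hpp := mem_chart_source E (c t)
  have hXd := differentiableWithinAt_toCoord_of_chart ht hc hx hpp hX
  have hxd := (contDiffWithinAt_extChartAt hc hpp).differentiableWithinAt (n := ∞) (by simp)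
  have heq1 : (fun s ↦ toCoord x₀ (c s) (X s)) =ᶠ[𝓝[J] t] fun s ↦ fderiv ℝ (transition (c t) x₀)
      (extChartAt 𝓘(ℝ, E) (c t) (c s)) (toCoord (c t) (c s) (X s)) := by
    filter_upwards [eventually_mem_chart hc.continuousWithinAt hx,
      eventually_mem_chart hc.continuousWithinAt hpp] with s h0 h1
    exact toCoord_eq_fderiv_transition h1 h0 _
  have heq2 : (fun s ↦ extChartAt 𝓘(ℝ, E) x₀ (c s)) =ᶠ[𝓝[J] t] fun s ↦ transition (c t) x₀
      (extChartAt 𝓘(ℝ, E) (c t) (c s)) := by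
    filter_upwards [eventually_mem_chart hc.continuousWithinAt hpp] with s h1
    exact (transition_apply h1).symm
  have := (isLocalIsometry_transition (E := E) (c t) x₀).fderiv_covariant hJ
    (mem_transitionSource hpp hx) hxd hXd
  rw [heq1.derivWithin_eq (heq1.self_of_nhdsWithin ht),
    heq2.derivWithin_eq (heq2.self_of_nhdsWithin ht), toCoord_eq_fderiv_transition hpp hx,
    toCoord_eq_fderiv_transition hpp hx, covDeriv, toCoord_ofCoord hpp, christoffel_eq_gamma,
    ← this, transition_apply hpp]

end Charts

/-! ### Vector fields along the curve, curvature operator and uniqueness for Jacobi fields -/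

section Fields

variable {E : Type*} [NormedAddCommGroup E] [NormedSpace ℝ E]
  {M : Type*} [TopologicalSpace M] [ChartedSpace E M] [IsManifold 𝓘(ℝ, E) ∞ M]
  {c : ℝ → M} {J : Set ℝ} {t : ℝ} {X Y : ∀ t, TangentSpace 𝓘(ℝ, E) (c t)}

theorem smoothAt_velocity (hJ : UniqueDiffOn ℝ J) (hc : ContMDiffOn 𝓘(ℝ, ℝ) 𝓘(ℝ, E) ∞ c J)
    (ht : t ∈ J) : SmoothAt c J (velocity (E := E) c J) t := by
  have hpp := mem_chart_source E (c t)
  rw [smoothAt_iff ht (hc t ht) hpp]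
  have h1 := (contDiffWithinAt_extChartAt (hc t ht) hpp).derivWithin hJ (m := ∞) (by simp) ht
  have heq : ∀ᶠ s in 𝓝[J] t, toCoord (c t) (c s) (velocity (E := E) c J s)
      = derivWithin (fun s ↦ extChartAt 𝓘(ℝ, E) (c t) (c s)) J s := by
    filter_upwards [eventually_mem_chart (hc t ht).continuousWithinAt hpp, self_mem_nhdsWithin]
      with s hs hsJ
    exact toCoord_velocity (hJ s hsJ) ((hc s hsJ).mdifferentiableWithinAt (by simp)) hs
  exact h1.congr_of_eventuallyEq heq (heq.self_of_nhdsWithin ht)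

theorem SmoothAt.add (hc : ContMDiffOn 𝓘(ℝ, ℝ) 𝓘(ℝ, E) ∞ c J) (ht : t ∈ J)
    (hX : SmoothAt c J X t) (hY : SmoothAt c J Y t) : SmoothAt c J (fun s ↦ X s + Y s) t := by
  have hpp := mem_chart_source E (c t)
  rw [smoothAt_iff ht (hc t ht) hpp] at hX hY ⊢
  simpa only [toCoord_add] using hX.add hY

theorem SmoothAt.sub (hc : ContMDiffOn 𝓘(ℝ, ℝ) 𝓘(ℝ, E) ∞ c J) (ht : t ∈ J)
    (hX : SmoothAt c J X t) (hY : SmoothAt c J Y t) : SmoothAt c J (fun s ↦ X s - Y s) t := by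
  have hpp := mem_chart_source E (c t)
  rw [smoothAt_iff ht (hc t ht) hpp] at hX hY ⊢
  simpa only [toCoord_sub] using hX.sub hY

theorem SmoothAt.smul (hc : ContMDiffOn 𝓘(ℝ, ℝ) 𝓘(ℝ, E) ∞ c J) (ht : t ∈ J) {f : ℝ → ℝ}
    (hf : ContDiffWithinAt ℝ ∞ f J t) (hX : SmoothAt c J X t) :
    SmoothAt c J (fun s ↦ f s • X s) t := by
  have hpp := mem_chart_source E (c t)
  rw [smoothAt_iff ht (hc t ht) hpp] at hX ⊢
  simp only [toCoord_smul]
  exact hf.smul hX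

theorem SmoothAt.congr (hX : SmoothAt c J X t) (ht : t ∈ J) (h : ∀ᶠ s in 𝓝[J] t, Y s = X s) :
    SmoothAt c J Y t := by
  have h' : ∀ᶠ s in 𝓝[J] t, (⟨c s, Y s⟩ : TangentBundle 𝓘(ℝ, E) M) = ⟨c s, X s⟩ := by
    filter_upwards [h] with s hs
    rw [hs]
  exact ContMDiffWithinAt.congr_of_eventuallyEq hX h' (h'.self_of_nhdsWithin ht)

variable [RiemannianBundle (fun x : M ↦ TangentSpace 𝓘(ℝ, E) x)]

theorem covDeriv_congr (ht : t ∈ J) (h : ∀ᶠ s in 𝓝[J] t, Y s = X s) :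
    covDeriv c J Y t = covDeriv c J X t := by
  have h' : (fun s ↦ toCoord (c t) (c s) (Y s)) =ᶠ[𝓝[J] t] fun s ↦ toCoord (c t) (c s) (X s) := by
    filter_upwards [h] with s hs
    rw [hs]
  rw [covDeriv, covDeriv, h'.derivWithin_eq (h'.self_of_nhdsWithin ht), h.self_of_nhdsWithin ht]

variable [FiniteDimensional ℝ E]
  [IsContMDiffRiemannianBundle 𝓘(ℝ, E) ∞ E (fun x : M ↦ TangentSpace 𝓘(ℝ, E) x)]

/-- The definition of `covDeriv` uses a chart that moves with the point; `toCoord_covDeriv` rewrites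
it in one fixed chart, where every ingredient is visibly smooth. -/
theorem SmoothAt.covDeriv (hJ : UniqueDiffOn ℝ J) (hc : ContMDiffOn 𝓘(ℝ, ℝ) 𝓘(ℝ, E) ∞ c J)
    (ht : t ∈ J) (hX : SmoothAt c J X t) : SmoothAt c J (covDeriv c J X) t := by
  have hpp := mem_chart_source E (c t)
  rw [smoothAt_iff ht (hc t ht) hpp] at hX ⊢
  have hx := contDiffWithinAt_extChartAt (hc t ht) hpp
  have hΓ : ContDiffWithinAt ℝ ∞
      (fun s ↦ gamma (chartMetric (c t)) (extChartAt 𝓘(ℝ, E) (c t) (c s))) J t :=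
    ContDiffAt.comp_contDiffWithinAt (g := gamma (chartMetric (E := E) (c t))) t
      ((isMetricOn_chartMetric (c t)).contDiffAt_gamma (mem_target hpp)) hx
  have h := (hX.derivWithin hJ (m := ∞) (by simp) ht).add
    ((hΓ.clm_apply (hx.derivWithin hJ (m := ∞) (by simp) ht)).clm_apply hX)
  have hev := (hX.of_le (m := 1) (by simp)).eventually (by simp)
  rw [insert_eq_of_mem ht] at hev
  have heq : ∀ᶠ s in 𝓝[J] t, toCoord (c t) (c s) (VirtualJacobi.covDeriv c J X s)
      = derivWithin (fun s ↦ toCoord (c t) (c s) (X s)) J s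
        + gamma (chartMetric (c t)) (extChartAt 𝓘(ℝ, E) (c t) (c s))
          (derivWithin (fun s ↦ extChartAt 𝓘(ℝ, E) (c t) (c s)) J s)
            (toCoord (c t) (c s) (X s)) := by
    filter_upwards [eventually_mem_chart (hc t ht).continuousWithinAt hpp, self_mem_nhdsWithin, hev]
      with s hs hsJ hd
    exact toCoord_covDeriv hsJ (hJ s hsJ) (hc s hsJ) hs (hd.differentiableWithinAt (by simp))
  exact h.congr_of_eventuallyEq heq (heq.self_of_nhdsWithin ht)

theorem SmoothAt.contDiffWithinAt_inner (hX : SmoothAt c J X t) (hY : SmoothAt c J Y t) :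
    ContDiffWithinAt ℝ ∞ (fun s ↦ inner ℝ (X s) (Y s)) J t := by
  rw [← contMDiffWithinAt_iff_contDiffWithinAt]
  exact ContMDiffWithinAt.inner_bundle (F := E) (E := fun x : M ↦ TangentSpace 𝓘(ℝ, E) x) hX hY

/-- The Levi-Civita connection is compatible with the metric. -/
theorem hasDerivWithinAt_inner_of_differentiableWithinAt (hc : ContMDiffOn 𝓘(ℝ, ℝ) 𝓘(ℝ, E) ∞ c J)
    (ht : t ∈ J) (hX : DifferentiableWithinAt ℝ (fun s ↦ toCoord (c t) (c s) (X s)) J t)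
    (hY : DifferentiableWithinAt ℝ (fun s ↦ toCoord (c t) (c s) (Y s)) J t) :
    HasDerivWithinAt (fun s ↦ inner ℝ (X s) (Y s))
      (inner ℝ (covDeriv c J X t) (Y t) + inner ℝ (X t) (covDeriv c J Y t)) J t := by
  have hpp := mem_chart_source E (c t)
  have h := (isMetricOn_chartMetric (E := E) (c t)).hasDerivWithinAt_apply (mem_target hpp)
    ((contDiffWithinAt_extChartAt (hc t ht) hpp).differentiableWithinAt (n := ∞) (by simp)) hX hY
  have heq : ∀ᶠ s in 𝓝[J] t, inner ℝ (X s) (Y s) = chartMetric (c t)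
      (extChartAt 𝓘(ℝ, E) (c t) (c s)) (toCoord (c t) (c s) (X s)) (toCoord (c t) (c s) (Y s)) := by
    filter_upwards [eventually_mem_chart (hc t ht).continuousWithinAt hpp] with s hs
    exact inner_eq_chartMetric hs _ _
  have hX' : toCoord (c t) (c t) (covDeriv c J X t) = _ := toCoord_ofCoord hpp _
  have hY' : toCoord (c t) (c t) (covDeriv c J Y t) = _ := toCoord_ofCoord hpp _
  rw [christoffel_eq_gamma] at hX' hY'
  rw [inner_eq_chartMetric hpp, inner_eq_chartMetric hpp, hX', hY']
  exact h.congr_of_eventuallyEq heq (heq.self_of_nhdsWithin ht)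

theorem SmoothAt.eventually_differentiableWithinAt (hc : ContMDiffOn 𝓘(ℝ, ℝ) 𝓘(ℝ, E) ∞ c J)
    (ht : t ∈ J) (hX : SmoothAt c J X t) :
    ∀ᶠ s in 𝓝[J] t, DifferentiableWithinAt ℝ (fun r ↦ toCoord (c s) (c r) (X r)) J s := by
  have hpp := mem_chart_source E (c t)
  rw [smoothAt_iff ht (hc t ht) hpp] at hX
  have hev := (hX.of_le (m := 1) (by simp)).eventually (by simp)
  rw [insert_eq_of_mem ht] at hev
  filter_upwards [eventually_mem_chart (hc t ht).continuousWithinAt hpp, self_mem_nhdsWithin, hev]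
    with s hs hsJ hd
  exact differentiableWithinAt_toCoord_of_chart hsJ (hc s hsJ) hs (mem_chart_source E (c s))
    (hd.differentiableWithinAt (by simp))

theorem SmoothAt.eventually_hasDerivWithinAt_inner (hc : ContMDiffOn 𝓘(ℝ, ℝ) 𝓘(ℝ, E) ∞ c J)
    (ht : t ∈ J) (hX : SmoothAt c J X t) (hY : SmoothAt c J Y t) :
    ∀ᶠ s in 𝓝[J] t, HasDerivWithinAt (fun r ↦ inner ℝ (X r) (Y r))
      (inner ℝ (VirtualJacobi.covDeriv c J X s) (Y s)
        + inner ℝ (X s) (VirtualJacobi.covDeriv c J Y s)) J s := by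
  filter_upwards [hX.eventually_differentiableWithinAt hc ht,
    hY.eventually_differentiableWithinAt hc ht, self_mem_nhdsWithin] with s h1 h2 hs
  exact hasDerivWithinAt_inner_of_differentiableWithinAt hc hs h1 h2

theorem SmoothAt.hasDerivWithinAt_inner (hc : ContMDiffOn 𝓘(ℝ, ℝ) 𝓘(ℝ, E) ∞ c J)
    (ht : t ∈ J) (hX : SmoothAt c J X t) (hY : SmoothAt c J Y t) :
    HasDerivWithinAt (fun r ↦ inner ℝ (X r) (Y r))
      (inner ℝ (VirtualJacobi.covDeriv c J X t) (Y t)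
        + inner ℝ (X t) (VirtualJacobi.covDeriv c J Y t)) J t :=
  (hX.eventually_hasDerivWithinAt_inner hc ht hY).self_of_nhdsWithin ht

theorem covDeriv_add (hc : ContMDiffOn 𝓘(ℝ, ℝ) 𝓘(ℝ, E) ∞ c J)
    (ht : t ∈ J) (hX : SmoothAt c J X t) (hY : SmoothAt c J Y t) :
    covDeriv c J (fun s ↦ X s + Y s) t = covDeriv c J X t + covDeriv c J Y t := by
  have hpp := mem_chart_source E (c t)
  rw [smoothAt_iff ht (hc t ht) hpp] at hX hY
  apply toCoord_injective hpp
  simp only [covDeriv, toCoord_ofCoord hpp, toCoord_add, christoffel_eq_gamma]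
  rw [derivWithin_fun_add (hX.differentiableWithinAt (by simp))
    (hY.differentiableWithinAt (by simp)), map_add]
  abel

theorem covDeriv_sub (hc : ContMDiffOn 𝓘(ℝ, ℝ) 𝓘(ℝ, E) ∞ c J)
    (ht : t ∈ J) (hX : SmoothAt c J X t) (hY : SmoothAt c J Y t) :
    covDeriv c J (fun s ↦ X s - Y s) t = covDeriv c J X t - covDeriv c J Y t := by
  have hpp := mem_chart_source E (c t)
  rw [smoothAt_iff ht (hc t ht) hpp] at hX hY
  apply toCoord_injective hpp
  simp only [covDeriv, toCoord_ofCoord hpp, toCoord_sub, christoffel_eq_gamma]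
  rw [derivWithin_fun_sub (hX.differentiableWithinAt (by simp))
    (hY.differentiableWithinAt (by simp)), map_sub]
  abel

theorem covDeriv_const_smul (hc : ContMDiffOn 𝓘(ℝ, ℝ) 𝓘(ℝ, E) ∞ c J)
    (ht : t ∈ J) (r : ℝ) (hX : SmoothAt c J X t) :
    covDeriv c J (fun s ↦ r • X s) t = r • covDeriv c J X t := by
  have hpp := mem_chart_source E (c t)
  rw [smoothAt_iff ht (hc t ht) hpp] at hX
  apply toCoord_injective hpp
  simp only [covDeriv, toCoord_ofCoord hpp, toCoord_smul, christoffel_eq_gamma]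
  rw [derivWithin_fun_const_smul _ (hX.differentiableWithinAt (by simp)), map_smul, smul_add]

/-- The curvature operator `x ↦ R(x, ċ) ċ` along `c`. -/
def tidal (c : ℝ → M) (J : Set ℝ) (t : ℝ) (x : TangentSpace 𝓘(ℝ, E) (c t)) :
    TangentSpace 𝓘(ℝ, E) (c t) :=
  curvature (c t) x (velocity c J t) (velocity c J t)

theorem curv_add_left (g : E → E →L[ℝ] E →L[ℝ] ℝ) (y a a' b z : E) :
    curv g y (a + a') b z = curv g y a b z + curv g y a' b z := by
  simp only [curv, map_add, add_apply]
  abel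

theorem curv_smul_left (g : E → E →L[ℝ] E →L[ℝ] ℝ) (y : E) (r : ℝ) (a b z : E) :
    curv g y (r • a) b z = r • curv g y a b z := by
  simp only [curv, map_smul, smul_apply, smul_sub, smul_add]

theorem tidal_add (x y : TangentSpace 𝓘(ℝ, E) (c t)) :
    tidal c J t (x + y) = tidal c J t x + tidal c J t y := by
  have hpp := mem_chart_source E (c t)
  apply toCoord_injective hpp
  simp only [tidal, toCoord_add, toCoord_curvature hpp, curv_add_left]

theorem tidal_smul (r : ℝ) (x : TangentSpace 𝓘(ℝ, E) (c t)) :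
    tidal c J t (r • x) = r • tidal c J t x := by
  have hpp := mem_chart_source E (c t)
  apply toCoord_injective hpp
  simp only [tidal, toCoord_smul, toCoord_curvature hpp, curv_smul_left]

theorem inner_tidal_comm (x y : TangentSpace 𝓘(ℝ, E) (c t)) :
    inner ℝ (tidal c J t x) y = inner ℝ (tidal c J t y) x := by
  have hpp := mem_chart_source E (c t)
  simp only [inner_eq_chartMetric hpp, tidal, toCoord_curvature hpp]
  exact (isMetricOn_chartMetric (c t)).apply_curv_symm (mem_target hpp) _ _ _

theorem inner_tidal_velocity (x : TangentSpace 𝓘(ℝ, E) (c t)) :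
    inner ℝ (tidal c J t x) (velocity c J t) = 0 := by
  have hpp := mem_chart_source E (c t)
  simp only [inner_eq_chartMetric hpp, tidal, toCoord_curvature hpp]
  exact (isMetricOn_chartMetric (c t)).apply_curv_self (mem_target hpp) _ _

/-- Local bounds on the coefficients of the Jacobi equation, for use in a Grönwall estimate. -/
theorem exists_norm_curv_le (hJ : UniqueDiffOn ℝ J) (hc : ContMDiffOn 𝓘(ℝ, ℝ) 𝓘(ℝ, E) ∞ c J)
    (ht : t ∈ J) :
    ∃ C, ∀ᶠ s in 𝓝[J] t, ∀ a : E,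
      ‖curv (chartMetric (c t)) (extChartAt 𝓘(ℝ, E) (c t) (c s)) a
        (derivWithin (fun s ↦ extChartAt 𝓘(ℝ, E) (c t) (c s)) J s)
        (derivWithin (fun s ↦ extChartAt 𝓘(ℝ, E) (c t) (c s)) J s)‖ ≤ C * ‖a‖ ∧
      ‖gamma (chartMetric (c t)) (extChartAt 𝓘(ℝ, E) (c t) (c s))
        (derivWithin (fun s ↦ extChartAt 𝓘(ℝ, E) (c t) (c s)) J s) a‖ ≤ C * ‖a‖ := by
  have hpp := mem_chart_source E (c t)
  set g := chartMetric (E := E) (c t)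
  set x := fun s ↦ extChartAt 𝓘(ℝ, E) (c t) (c s)
  have hx : ContDiffWithinAt ℝ ∞ x J t := contDiffWithinAt_extChartAt (hc t ht) hpp
  have hxc := hx.continuousWithinAt
  have hb : ContinuousWithinAt (derivWithin x J) J t :=
    (hx.derivWithin hJ (m := ∞) (by simp) ht).continuousWithinAt
  have hΓ' : ContDiffAt ℝ ∞ (gamma g) (x t) :=
    (isMetricOn_chartMetric (c t)).contDiffAt_gamma (mem_target hpp)
  have hΓ : ContinuousWithinAt (fun s ↦ gamma g (x s)) J t :=
    hΓ'.continuousAt.comp_continuousWithinAt hxc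
  have hdΓ : ContinuousWithinAt (fun s ↦ fderiv ℝ (gamma g) (x s)) J t :=
    (hΓ'.fderiv_right (m := ∞) (by simp)).continuousAt.comp_continuousWithinAt hxc
  let N : ℝ → E →L[ℝ] E := fun s ↦ gamma g (x s) (derivWithin x J s)
  have hN : ContinuousWithinAt N J t := hΓ.clm_apply hb
  -- The flips move the argument `a` to the last place, which exhibits `a ↦ R(a, ċ) ċ` as a
  -- continuous linear map depending continuously on `s`.
  let flip2 := (ContinuousLinearMap.flipₗᵢ ℝ E E E).toLinearIsometry.toContinuousLinearMap
  let flip3 := (ContinuousLinearMap.flipₗᵢ ℝ E E (E →L[ℝ] E)).toLinearIsometry.toContinuousLinearMap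
  let R : ℝ → E →L[ℝ] E := fun s ↦
    flip2 (flip3 (fderiv ℝ (gamma g) (x s)) (derivWithin x J s)) (derivWithin x J s)
      - flip2 (fderiv ℝ (gamma g) (x s) (derivWithin x J s)) (derivWithin x J s)
      + flip2 (gamma g (x s)) (gamma g (x s) (derivWithin x J s) (derivWithin x J s))
      - (gamma g (x s) (derivWithin x J s)) ∘L (flip2 (gamma g (x s)) (derivWithin x J s))
  have hf2 : ∀ {f : ℝ → E →L[ℝ] E →L[ℝ] E}, ContinuousWithinAt f J t →
      ContinuousWithinAt (fun s ↦ flip2 (f s)) J t := fun hf ↦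
    flip2.continuous.continuousAt.comp_continuousWithinAt hf
  have hf3 : ContinuousWithinAt (fun s ↦ flip3 (fderiv ℝ (gamma g) (x s))) J t :=
    flip3.continuous.continuousAt.comp_continuousWithinAt hdΓ
  have hR : ContinuousWithinAt R J t :=
    ((((hf2 (hf3.clm_apply hb)).clm_apply hb).sub ((hf2 (hdΓ.clm_apply hb)).clm_apply hb)).add
      ((hf2 hΓ).clm_apply ((hΓ.clm_apply hb).clm_apply hb))).sub
      ((hΓ.clm_apply hb).clm_comp ((hf2 hΓ).clm_apply hb))
  have hR1 : ∀ᶠ s in 𝓝[J] t, ‖R s‖ < ‖R t‖ + 1 := hR.norm.eventually_lt_const (by linarith)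
  have hN1 : ∀ᶠ s in 𝓝[J] t, ‖N s‖ < ‖N t‖ + 1 := hN.norm.eventually_lt_const (by linarith)
  refine ⟨max (‖R t‖ + 1) (‖N t‖ + 1), ?_⟩
  filter_upwards [hR1, hN1] with s hs hs' a
  constructor
  · have : curv g (x s) a (derivWithin x J s) (derivWithin x J s) = R s a := by
      simp [curv, R, flip2, flip3]
    rw [this]
    exact (R s).le_of_opNorm_le (hs.le.trans (le_max_left _ _)) a
  · exact (N s).le_of_opNorm_le (hs'.le.trans (le_max_right _ _)) a

/-- In a fixed chart the pair `(X, X')` solves the first-order linear system `a' = b - Γ a`, `b' =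
-R a - Γ b`. -/
theorem IsJacobiField.eventually_eq_zero (hJ : J.OrdConnected) (hJ' : J.Nontrivial)
    (hc : ContMDiffOn 𝓘(ℝ, ℝ) 𝓘(ℝ, E) ∞ c J) (hX : IsJacobiField c J X) (ht : t ∈ J)
    (h0 : X t = 0) (h1 : covDeriv c J X t = 0) :
    ∀ᶠ s in 𝓝[J] t, X s = 0 ∧ covDeriv c J X s = 0 := by
  have hu := uniqueDiffOn_of_ordConnected hJ hJ'
  have hpp := mem_chart_source E (c t)
  obtain ⟨C, hC⟩ := exists_norm_curv_le (E := E) hu hc ht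
  let a : ℝ → E := fun s ↦ toCoord (c t) (c s) (X s)
  let b : ℝ → E := fun s ↦ toCoord (c t) (c s) (covDeriv c J X s)
  let x := fun s ↦ extChartAt 𝓘(ℝ, E) (c t) (c s)
  let Γ : ℝ → E →L[ℝ] E := fun s ↦ gamma (chartMetric (c t)) (x s) (derivWithin x J s)
  let R : ℝ → E → E := fun s z ↦ curv (chartMetric (c t)) (x s) z (derivWithin x J s)
    (derivWithin x J s)
  -- The first component of the right side is bounded by `1 + |C|` and the second by `2 |C|` times
  -- the norm of the pair; `1 + 2 |C|` covers both.
  have key := eventually_eq_zero_of_norm_deriv_le hJ hJ' ht (y := fun s ↦ (a s, b s))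
    (y' := fun s ↦ (b s - Γ s (a s), - R s (a s) - Γ s (b s))) (C := 1 + 2 * |C|) ?_ ?_
  · filter_upwards [key, eventually_mem_chart (hc t ht).continuousWithinAt hpp] with s hs hs'
    rw [Prod.mk_eq_zero] at hs
    exact ⟨toCoord_injective hs' (by rw [toCoord_zero]; exact hs.1),
      toCoord_injective hs' (by rw [toCoord_zero]; exact hs.2)⟩
  · filter_upwards [hC, eventually_mem_chart (hc t ht).continuousWithinAt hpp,
      self_mem_nhdsWithin] with s hs hs' hsJ
    have hXs : SmoothAt c J X s := hX.smooth s hsJ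
    have ha := ((smoothAt_iff hsJ (hc s hsJ) hs').1 hXs).differentiableWithinAt (n := ∞) (by simp)
    have hb := ((smoothAt_iff hsJ (hc s hsJ) hs').1 (hXs.covDeriv hu hc hsJ)).differentiableWithinAt
      (n := ∞) (by simp)
    have ha' := toCoord_covDeriv hsJ (hu s hsJ) (hc s hsJ) hs' ha
    have hb' := toCoord_covDeriv hsJ (hu s hsJ) (hc s hsJ) hs' hb
    rw [eq_neg_of_add_eq_zero_left (hX.jacobi s hsJ), toCoord_neg, toCoord_curvature hs',
      toCoord_velocity (hu s hsJ) ((hc s hsJ).mdifferentiableWithinAt (by simp)) hs'] at hb'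
    have e1 : derivWithin a J s = b s - Γ s (a s) := eq_sub_of_add_eq ha'.symm
    have e2 : derivWithin b J s = - R s (a s) - Γ s (b s) := eq_sub_of_add_eq hb'.symm
    have d1 : HasDerivWithinAt a (b s - Γ s (a s)) J s := e1 ▸ ha.hasDerivWithinAt
    have d2 : HasDerivWithinAt b (- R s (a s) - Γ s (b s)) J s := e2 ▸ hb.hasDerivWithinAt
    refine ⟨d1.prodMk d2, ?_⟩
    have hCa : ∀ z : E, C * ‖z‖ ≤ |C| * ‖z‖ := fun z ↦
      mul_le_mul_of_nonneg_right (le_abs_self C) (norm_nonneg z)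
    have n1 : ‖a s‖ ≤ ‖(a s, b s)‖ := norm_fst_le (a s, b s)
    have n2 : ‖b s‖ ≤ ‖(a s, b s)‖ := norm_snd_le (a s, b s)
    have m1 := mul_le_mul_of_nonneg_left n1 (abs_nonneg C)
    have m2 := mul_le_mul_of_nonneg_left n2 (abs_nonneg C)
    have r1 : ‖R s (a s)‖ ≤ |C| * ‖(a s, b s)‖ := ((hs (a s)).1.trans (hCa _)).trans m1
    have r2 : ‖Γ s (a s)‖ ≤ |C| * ‖(a s, b s)‖ := ((hs (a s)).2.trans (hCa _)).trans m1
    have r3 : ‖Γ s (b s)‖ ≤ |C| * ‖(a s, b s)‖ := ((hs (b s)).2.trans (hCa _)).trans m2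
    have hnn := norm_nonneg (a s, b s)
    have hCn := mul_nonneg (abs_nonneg C) hnn
    refine (Prod.norm_def _).le.trans (max_le ?_ ?_)
    · refine (norm_sub_le _ _).trans ?_
      linarith
    · refine (norm_sub_le _ _).trans ?_
      rw [norm_neg]
      linarith
  · simp only [a, b, h0, h1, toCoord_zero]
    rfl

/-- A Jacobi field that vanishes together with its derivative at one point vanishes. -/
theorem IsJacobiField.eq_zero (hJ : J.OrdConnected) (hJ' : J.Nontrivial)
    (hc : ContMDiffOn 𝓘(ℝ, ℝ) 𝓘(ℝ, E) ∞ c J) (hX : IsJacobiField c J X) (ht : t ∈ J)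
    (h0 : X t = 0) (h1 : covDeriv c J X t = 0) {s : ℝ} (hs : s ∈ J) : X s = 0 := by
  have hu := uniqueDiffOn_of_ordConnected hJ hJ'
  -- The points with vanishing initial data form a clopen set: closed as the zero set of the
  -- continuous function `|X|² + |X'|²`, open by local uniqueness.
  let S : Set J := {s | X s = 0 ∧ covDeriv c J X s = 0}
  have hclosed : IsClosed S := by
    have hcont : ContinuousOn (fun s ↦ inner ℝ (X s) (X s)
        + inner ℝ (covDeriv c J X s) (covDeriv c J X s)) J := fun s hs ↦ by
      have hXs : SmoothAt c J X s := hX.smooth s hs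
      exact (hXs.contDiffWithinAt_inner hXs).continuousWithinAt.add
        (((hXs.covDeriv hu hc hs).contDiffWithinAt_inner
          (hXs.covDeriv hu hc hs)).continuousWithinAt)
    have : S = J.domRestrict (fun s ↦ inner ℝ (X s) (X s)
        + inner ℝ (covDeriv c J X s) (covDeriv c J X s)) ⁻¹' {0} := by
      ext s
      simp only [S, mem_ofPred_eq, mem_preimage, mem_singleton_iff, domRestrict_apply,
        real_inner_self_eq_norm_sq]
      constructor
      · rintro ⟨h, h'⟩
        simp [h, h']
      · intro h
        have h2 := (add_eq_zero_iff_of_nonneg (sq_nonneg _) (sq_nonneg _)).1 h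
        simpa using h2
    rw [this]
    exact isClosed_singleton.preimage (continuousOn_iff_continuous_domRestrict.1 hcont)
  have hopen : IsOpen S := by
    rw [isOpen_iff_mem_nhds]
    rintro ⟨s, hs⟩ ⟨h, h'⟩
    rw [mem_nhds_subtype_iff_nhdsWithin]
    filter_upwards [hX.eventually_eq_zero hJ hJ' hc hs h h', self_mem_nhdsWithin] with r hr hrJ
    exact ⟨⟨r, hrJ⟩, hr, rfl⟩
  have hpc : PreconnectedSpace J := Subtype.preconnectedSpace hJ.isPreconnected
  have huniv : S = univ := IsClopen.eq_univ ⟨hclosed, hopen⟩ ⟨⟨t, ht⟩, h0, h1⟩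
  have : (⟨s, hs⟩ : J) ∈ S := huniv ▸ mem_univ _
  exact this.1

end Fields

/-! ### Linear algebra of families of linear maps -/

section LinearFamilies

variable {W E : Type*} [NormedAddCommGroup W] [InnerProductSpace ℝ W] [FiniteDimensional ℝ W]
  [NormedAddCommGroup E] [NormedSpace ℝ E]

theorem contDiffWithinAt_of_forall_clm_apply {f : ℝ → W →L[ℝ] E} {s : Set ℝ} {t : ℝ}
    (h : ∀ w, ContDiffWithinAt ℝ ∞ (fun x ↦ f x w) s t) : ContDiffWithinAt ℝ ∞ f s t := by
  let d := Module.finrank ℝ W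
  have hd : d = Module.finrank ℝ (Fin d → ℝ) := (Module.finrank_fin_fun ℝ).symm
  let e₁ := ContinuousLinearEquiv.ofFinrankEq hd
  let e₂ := (e₁.arrowCongr (1 : E ≃L[ℝ] E)).trans (ContinuousLinearEquiv.piRing (Fin d))
  rw [← Function.id_comp f, ← e₂.symm_comp_self]
  exact e₂.symm.contDiff.contDiffAt.comp_contDiffWithinAt t
    (contDiffWithinAt_pi.2 fun i ↦ h _)

/-- With `P` the projection onto `ker A`, the map `A + D P` is injective: since `⟪D P w, A w⟫ = ⟪A P
w, D w⟫ = 0`, pairing `A w + D P w = 0` with `A w` gives `A w = 0`, hence `P w = w` and `D w = 0`.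
Equality of dimensions does the rest. -/
theorem exists_eq_add_starProjection {V : Type*} [NormedAddCommGroup V] [InnerProductSpace ℝ V]
    [FiniteDimensional ℝ V] (A D : W →ₗ[ℝ] V) (hrank : Module.finrank ℝ W = Module.finrank ℝ V)
    (hsymm : ∀ x y, inner ℝ (D x) (A y) = inner ℝ (A x) (D y))
    (hinj : ∀ w, A w = 0 → D w = 0 → w = 0) (z : V) :
    ∃ w, z = A w + D ((LinearMap.ker A).starProjection w) := by
  have hP : ∀ w, A ((LinearMap.ker A).starProjection w) = 0 := fun w ↦
    Submodule.starProjection_apply_mem (LinearMap.ker A) w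
  let β : W →ₗ[ℝ] V := A + D ∘ₗ ((LinearMap.ker A).starProjection : W →ₗ[ℝ] W)
  have hβ : ∀ w, β w = A w + D ((LinearMap.ker A).starProjection w) := fun w ↦ rfl
  have hβinj : Function.Injective β := by
    rw [injective_iff_map_eq_zero]
    intro w hw
    rw [hβ] at hw
    have h2 : inner ℝ (A w + D ((LinearMap.ker A).starProjection w)) (A w) = 0 := by
      rw [hw, inner_zero_left]
    rw [inner_add_left, hsymm, hP, inner_zero_left, add_zero, inner_self_eq_zero] at h2
    have h4 : (LinearMap.ker A).starProjection w = w := Submodule.starProjection_eq_self_iff.2 h2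
    rw [h2, zero_add, h4] at hw
    exact hinj w h2 hw
  obtain ⟨w, hw⟩ := (LinearMap.injective_iff_surjective_of_finrank_eq_finrank hrank).1 hβinj z
  exact ⟨w, by rw [← hβ, hw]⟩

/-- The equations for `y u s` form a square linear system, the extra equation against `n` making up
the difference of dimensions. It is invertible at `t`, hence nearby, and inversion is smooth. -/
theorem exists_smooth_dual [FiniteDimensional ℝ E] {J : Set ℝ} {t : ℝ}
    {G : ℝ → E →L[ℝ] E →L[ℝ] ℝ} {B : ℝ → W →L[ℝ] E} {n : ℝ → E}
    (hG : ContDiffWithinAt ℝ ∞ G J t) (hB : ContDiffWithinAt ℝ ∞ B J t)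
    (hn : ContDiffWithinAt ℝ ∞ n J t) (hrank : Module.finrank ℝ E = Module.finrank ℝ W + 1)
    (hinj : ∀ z, (∀ w, G t z (B t w) = 0) → G t z (n t) = 0 → z = 0) :
    ∃ y : W → ℝ → E, (∀ u, ContDiffWithinAt ℝ ∞ (y u) J t) ∧ ∀ᶠ s in 𝓝[J] t, ∀ u,
      (∀ w, G s (y u s) (B s w) = inner ℝ u w) ∧ G s (y u s) (n s) = 0 := by
  let Φ : ℝ → E →L[ℝ] (W →L[ℝ] ℝ) × ℝ := fun s ↦
    ContinuousLinearMap.inl ℝ (W →L[ℝ] ℝ) ℝ ∘L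
        (((ContinuousLinearMap.compL ℝ W E ℝ).flip (B s)) ∘L (G s))
      + ContinuousLinearMap.inr ℝ (W →L[ℝ] ℝ) ℝ ∘L ((G s).flip (n s))
  have hΦ1 : ∀ s z w, (Φ s z).1 w = G s z (B s w) := fun s z w ↦ by simp [Φ]
  have hΦ2 : ∀ s z, (Φ s z).2 = G s z (n s) := fun s z ↦ by simp [Φ]
  have hflip : ContDiffWithinAt ℝ ∞ (fun s ↦ (G s).flip) J t :=
    ((ContinuousLinearMap.flipₗᵢ ℝ E E ℝ).toLinearIsometry.toContinuousLinearMap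
      ).contDiff.contDiffAt.comp_contDiffWithinAt t hG
  have hΦ : ContDiffWithinAt ℝ ∞ Φ J t :=
    (contDiffWithinAt_const.clm_comp
      (((ContinuousLinearMap.compL ℝ W E ℝ).flip.contDiff.contDiffAt.comp_contDiffWithinAt t
        hB).clm_comp hG)).add (contDiffWithinAt_const.clm_comp (hflip.clm_apply hn))
  have hinj' : Function.Injective (Φ t : E →ₗ[ℝ] (W →L[ℝ] ℝ) × ℝ) := by
    rw [injective_iff_map_eq_zero]
    intro z hz
    have hz' : Φ t z = 0 := hz
    refine hinj z (fun w ↦ ?_) ?_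
    · rw [← hΦ1, hz']
      simp
    · rw [← hΦ2, hz']
      simp
  have hrank' : Module.finrank ℝ E = Module.finrank ℝ ((W →L[ℝ] ℝ) × ℝ) := by
    rw [Module.finrank_prod, Module.finrank_self, hrank,
      ← (LinearMap.toContinuousLinearMap (𝕜 := ℝ) (E := W) (F' := ℝ)).finrank_eq]
    congr 1
    exact (Subspace.dual_finrank_eq (K := ℝ) (V := W)).symm
  obtain ⟨e, he⟩ : ∃ e : E ≃L[ℝ] (W →L[ℝ] ℝ) × ℝ, (e : E →L[ℝ] (W →L[ℝ] ℝ) × ℝ) = Φ t := by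
    refine ⟨(LinearEquiv.ofBijective _ ⟨hinj',
      (LinearMap.injective_iff_surjective_of_finrank_eq_finrank hrank').1 hinj'⟩
      ).toContinuousLinearEquiv, ?_⟩
    ext z <;> rfl
  have hinv : ContDiffWithinAt ℝ ∞ (fun s ↦ (Φ s).inverse) J t := by
    have h := contDiffAt_map_inverse (n := ∞) e
    rw [he] at h
    exact h.comp_contDiffWithinAt t hΦ
  have hev : ∀ᶠ s in 𝓝[J] t,
      Φ s ∈ range ((↑) : (E ≃L[ℝ] (W →L[ℝ] ℝ) × ℝ) → (E →L[ℝ] (W →L[ℝ] ℝ) × ℝ)) := by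
    refine hΦ.continuousWithinAt.eventually ?_
    rw [← he]
    exact e.nhds
  refine ⟨fun u s ↦ (Φ s).inverse (innerSL ℝ u, 0), fun u ↦ hinv.clm_apply contDiffWithinAt_const,
    ?_⟩
  filter_upwards [hev] with s hs u
  obtain ⟨e', he'⟩ := hs
  have hsol : Φ s ((Φ s).inverse (innerSL ℝ u, 0)) = (innerSL ℝ u, 0) := by
    rw [← he', ContinuousLinearMap.inverse_equiv]
    simp
  refine ⟨fun w ↦ ?_, ?_⟩
  · rw [← hΦ1, hsol]
    simp
  · rw [← hΦ2, hsol]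

end LinearFamilies

/-! ### The Wronskian and the splitting of the normal space -/

section Lagrange

variable {E : Type*} [NormedAddCommGroup E] [NormedSpace ℝ E] [FiniteDimensional ℝ E]
  {M : Type*} [TopologicalSpace M] [ChartedSpace E M] [IsManifold 𝓘(ℝ, E) ∞ M]
  [RiemannianBundle (fun x : M ↦ TangentSpace 𝓘(ℝ, E) x)]
  [IsContMDiffRiemannianBundle 𝓘(ℝ, E) ∞ E (fun x : M ↦ TangentSpace 𝓘(ℝ, E) x)]
  {c : ℝ → M} {J : Set ℝ} {t₀ t : ℝ}
  {A : ∀ t, normalSpace E c J t₀ →ₗ[ℝ] normalSpace E c J t}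

theorem inner_velocity_of_mem (x : normalSpace E c J t) :
    inner ℝ (x : TangentSpace 𝓘(ℝ, E) (c t)) (velocity c J t) = 0 := by
  rw [real_inner_comm]
  exact (Submodule.mem_orthogonal_singleton_iff_inner_right).1 x.2

theorem mem_normalSpace_iff {x : TangentSpace 𝓘(ℝ, E) (c t)} :
    x ∈ normalSpace E c J t ↔ inner ℝ x (velocity c J t) = 0 := by
  rw [real_inner_comm]
  exact Submodule.mem_orthogonal_singleton_iff_inner_right

theorem finrank_normalSpace (hc : IsUnitGeodesicOn (E := E) c J) (ht : t ∈ J) :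
    Module.finrank ℝ E = Module.finrank ℝ (normalSpace E c J t) + 1 := by
  have hne : velocity (E := E) c J t ≠ 0 := by
    intro h
    have := hc.unit_speed t ht
    rw [h, norm_zero] at this
    exact zero_ne_one this
  have h := Submodule.finrank_add_finrank_orthogonal (ℝ ∙ velocity (E := E) c J t)
  rw [finrank_span_singleton hne, add_comm] at h
  exact h.symm

theorem IsLagrangeTensor.smoothAt (hA : IsLagrangeTensor A) (w : normalSpace E c J t₀)
    (ht : t ∈ J) : SmoothAt c J (fun s ↦ (A s w : TangentSpace 𝓘(ℝ, E) (c s))) t :=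
  (hA.jacobi w).smooth t ht

theorem IsLagrangeTensor.covDeriv_tensorDeriv (hA : IsLagrangeTensor A) (w : normalSpace E c J t₀)
    (ht : t ∈ J) :
    covDeriv c J (fun s ↦ tensorDeriv A s w) t
      = - tidal c J t (A t w : TangentSpace 𝓘(ℝ, E) (c t)) :=
  eq_neg_of_add_eq_zero_left ((hA.jacobi w).jacobi t ht)

theorem IsLagrangeTensor.smoothAt_tensorDeriv (hJ : UniqueDiffOn ℝ J)
    (hc : IsUnitGeodesicOn (E := E) c J) (hA : IsLagrangeTensor A) (w : normalSpace E c J t₀)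
    (ht : t ∈ J) : SmoothAt c J (fun s ↦ tensorDeriv A s w) t :=
  (hA.smoothAt w ht).covDeriv hJ hc.smooth ht

/-- The covariant derivative `A'_t` of a Lagrange tensor, as a linear map. -/
def tensorDerivLinear (hc : IsUnitGeodesicOn (E := E) c J) (hA : IsLagrangeTensor A) (ht : t ∈ J) :
    normalSpace E c J t₀ →ₗ[ℝ] TangentSpace 𝓘(ℝ, E) (c t) where
  toFun := tensorDeriv A t
  map_add' x y := by
    have := covDeriv_add hc.smooth ht (hA.smoothAt x ht) (hA.smoothAt y ht)
    simp only [tensorDeriv, map_add, Submodule.coe_add]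
    exact this
  map_smul' r x := by
    have := covDeriv_const_smul hc.smooth ht r (hA.smoothAt x ht)
    simp only [tensorDeriv, map_smul, Submodule.coe_smul]
    exact this

/-- Differentiate `⟪A w, ċ⟫ = 0`; the term with `ċ'` vanishes along a geodesic. -/
theorem IsLagrangeTensor.inner_tensorDeriv_velocity (hJ : UniqueDiffOn ℝ J)
    (hc : IsUnitGeodesicOn (E := E) c J) (hA : IsLagrangeTensor A) (w : normalSpace E c J t₀)
    (ht : t ∈ J) : inner ℝ (tensorDeriv A t w) (velocity c J t) = 0 := by
  have h := (hA.smoothAt w ht).hasDerivWithinAt_inner hc.smooth ht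
    (smoothAt_velocity hJ hc.smooth ht)
  have h0 : HasDerivWithinAt (fun s ↦ inner ℝ (A s w : TangentSpace 𝓘(ℝ, E) (c s))
      (velocity c J s)) 0 J t := by
    simp only [inner_velocity_of_mem]
    exact hasDerivWithinAt_const t J 0
  have := (hJ t ht).eq_deriv _ h h0
  rwa [hc.geodesic t ht, inner_zero_right, add_zero] at this

/-- `A'^* A` is symmetric: the Wronskian of two columns of a Lagrange tensor vanishes. -/
theorem IsLagrangeTensor.wronskian (hJ : J.OrdConnected) (hJ' : J.Nontrivial)
    (hc : IsUnitGeodesicOn (E := E) c J) (hA : IsLagrangeTensor A) (x y : normalSpace E c J t₀)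
    (ht : t ∈ J) :
    inner ℝ (tensorDeriv A t x) (A t y : TangentSpace 𝓘(ℝ, E) (c t))
      = inner ℝ (A t x : TangentSpace 𝓘(ℝ, E) (c t)) (tensorDeriv A t y) := by
  have hu := uniqueDiffOn_of_ordConnected hJ hJ'
  have hd : ∀ s ∈ J, HasDerivWithinAt (fun s ↦
      inner ℝ (tensorDeriv A s x) (A s y : TangentSpace 𝓘(ℝ, E) (c s))
      - inner ℝ (A s x : TangentSpace 𝓘(ℝ, E) (c s)) (tensorDeriv A s y)) 0 J s := by
    intro s hs
    have h1 := (hA.smoothAt_tensorDeriv hu hc x hs).hasDerivWithinAt_inner hc.smooth hs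
      (hA.smoothAt y hs)
    have h2 := (hA.smoothAt x hs).hasDerivWithinAt_inner hc.smooth hs
      (hA.smoothAt_tensorDeriv hu hc y hs)
    refine (h1.sub h2).congr_deriv ?_
    rw [hA.covDeriv_tensorDeriv x hs, hA.covDeriv_tensorDeriv y hs, inner_neg_left, inner_neg_right,
      inner_tidal_comm, real_inner_comm _ (tidal c J s _)]
    simp only [tensorDeriv]
    ring
  -- The Wronskian is constant on `J`, and at a regular point its vanishing is the symmetry of `S`.
  -- This is where existence of a regular point is needed.
  obtain ⟨r, hr, hreg⟩ := hA.exists_regular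
  have hconst := hJ.convex.is_const_of_fderivWithin_eq_zero (𝕜 := ℝ)
    (fun s hs ↦ (hd s hs).differentiableWithinAt) (fun s hs ↦ by
      have h := (hd s hs).derivWithin (hu s hs)
      rw [← fderivWithin_derivWithin] at h
      ext
      simpa using h) ht hr
  have hsymm := hA.symmetric r hr hreg (A r x) (A r y)
  simp only [riccati, Function.leftInverse_invFun hreg.1 x,
    Function.leftInverse_invFun hreg.1 y] at hsymm
  rw [hsymm, sub_self] at hconst
  exact sub_eq_zero.1 hconst

theorem IsLagrangeTensor.eq_zero (hJ : J.OrdConnected) (hJ' : J.Nontrivial)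
    (hc : IsUnitGeodesicOn (E := E) c J) (hA : IsLagrangeTensor A) {w : normalSpace E c J t₀}
    (ht : t ∈ J) (h0 : A t w = 0) (h1 : tensorDeriv A t w = 0) : w = 0 := by
  by_contra hne
  obtain ⟨s, hs, hsw⟩ := hA.nondegenerate w hne
  refine hsw (Subtype.ext ?_)
  exact (hA.jacobi w).eq_zero hJ hJ' hc.smooth ht (by rw [h0]; rfl) h1 hs

/-- The images of `A_t` and of `A'_t` restricted to the kernel of `A_t` span the normal space. -/
theorem IsLagrangeTensor.exists_eq_add (hJ : J.OrdConnected) (hJ' : J.Nontrivial)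
    (hc : IsUnitGeodesicOn (E := E) c J) (hA : IsLagrangeTensor A) (ht₀ : t₀ ∈ J) (ht : t ∈ J)
    {z : TangentSpace 𝓘(ℝ, E) (c t)} (hz : inner ℝ z (velocity c J t) = 0) :
    ∃ w, z = (A t w : TangentSpace 𝓘(ℝ, E) (c t))
      + tensorDeriv A t ((LinearMap.ker (A t)).starProjection w) := by
  have hu := uniqueDiffOn_of_ordConnected hJ hJ'
  let D : normalSpace E c J t₀ →ₗ[ℝ] normalSpace E c J t :=
    (tensorDerivLinear hc hA ht).codRestrict _ fun w ↦
      mem_normalSpace_iff.2 (hA.inner_tensorDeriv_velocity hu hc w ht)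
  have hrank : Module.finrank ℝ (normalSpace E c J t₀) = Module.finrank ℝ (normalSpace E c J t) := by
    have h1 := finrank_normalSpace hc ht₀
    have h2 := finrank_normalSpace hc ht
    omega
  obtain ⟨w, hw⟩ := exists_eq_add_starProjection (A t) D hrank
    (fun x y ↦ hA.wronskian hJ hJ' hc x y ht)
    (fun w h0 h1 ↦ hA.eq_zero hJ hJ' hc ht h0 (congrArg Subtype.val h1))
    ⟨z, mem_normalSpace_iff.2 hz⟩
  exact ⟨w, congrArg Subtype.val hw⟩

end Lagrange

/-! ### Division by `s - t` at a singular point and the dual fields -/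

section DualFields

variable {E : Type*} [NormedAddCommGroup E] [NormedSpace ℝ E] [FiniteDimensional ℝ E]
  {M : Type*} [TopologicalSpace M] [ChartedSpace E M] [IsManifold 𝓘(ℝ, E) ∞ M]
  [RiemannianBundle (fun x : M ↦ TangentSpace 𝓘(ℝ, E) x)]
  [IsContMDiffRiemannianBundle 𝓘(ℝ, E) ∞ E (fun x : M ↦ TangentSpace 𝓘(ℝ, E) x)]
  {c : ℝ → M} {J : Set ℝ} {t₀ t : ℝ}
  {A : ∀ t, normalSpace E c J t₀ →ₗ[ℝ] normalSpace E c J t}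

/-- The family `A` in the coordinates of the chart at `x₀`. -/
def coordFamily (A : ∀ t, normalSpace E c J t₀ →ₗ[ℝ] normalSpace E c J t) (x₀ : M) (s : ℝ) :
    normalSpace E c J t₀ →L[ℝ] E :=
  LinearMap.toContinuousLinearMap
    { toFun := fun w ↦ toCoord x₀ (c s) (A s w)
      map_add' := fun x y ↦ by
        rw [map_add, Submodule.coe_add, toCoord_add]
      map_smul' := fun r x ↦ by
        rw [map_smul, Submodule.coe_smul, toCoord_smul]
        rfl }

theorem coordFamily_apply (x₀ : M) (s : ℝ) (w : normalSpace E c J t₀) :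
    coordFamily A x₀ s w = toCoord x₀ (c s) (A s w : TangentSpace 𝓘(ℝ, E) (c s)) := rfl

theorem IsLagrangeTensor.contDiffWithinAt_coordFamily (hc : IsUnitGeodesicOn (E := E) c J)
    (hA : IsLagrangeTensor A) (ht : t ∈ J) :
    ContDiffWithinAt ℝ ∞ (coordFamily A (c t)) J t :=
  contDiffWithinAt_of_forall_clm_apply fun w ↦
    (smoothAt_iff ht (hc.smooth t ht) (mem_chart_source E (c t))).1 (hA.smoothAt w ht)

/-- Division of a Lagrange tensor by `s - t` on a subspace of the kernel of `A_t`. -/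
theorem IsLagrangeTensor.exists_smooth_quotient (hJ : J.OrdConnected) (hJ' : J.Nontrivial)
    (hc : IsUnitGeodesicOn (E := E) c J) (hA : IsLagrangeTensor A) (ht : t ∈ J)
    (P : normalSpace E c J t₀ →L[ℝ] normalSpace E c J t₀) (hP : ∀ w, A t (P w) = 0) :
    ∃ H : ℝ → normalSpace E c J t₀ →L[ℝ] E, ContDiffWithinAt ℝ ∞ H J t ∧
      (∀ s w, (s - t) • H s w = coordFamily A (c t) s (P w)) ∧
      ∀ w, H t w = toCoord (c t) (c t) (tensorDeriv A t (P w)) := by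
  have hu := uniqueDiffOn_of_ordConnected hJ hJ'
  have hpp := mem_chart_source E (c t)
  let f : ℝ → normalSpace E c J t₀ →L[ℝ] E := fun s ↦ coordFamily A (c t) s ∘L P
  have hf : ContDiffWithinAt ℝ ∞ f J t :=
    (hA.contDiffWithinAt_coordFamily hc ht).clm_comp contDiffWithinAt_const
  have hft : f t = 0 := by
    ext w
    simp only [f, ContinuousLinearMap.comp_apply, coordFamily_apply, hP, Submodule.coe_zero,
      toCoord_zero]
    rfl
  refine ⟨Function.update (slope f t) t (derivWithin f J t),
    contDiffWithinAt_update_slope hJ hJ' ht hf, fun s w ↦ ?_, fun w ↦ ?_⟩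
  · rcases eq_or_ne s t with rfl | hst
    · rw [sub_self, zero_smul]
      exact congr($hft w).symm
    · rw [Function.update_of_ne hst, slope_def_module, hft, sub_zero, ← smul_apply, smul_smul,
        mul_inv_cancel₀ (sub_ne_zero.2 hst), one_smul]
      rfl
  · rw [Function.update_self]
    have h1 := ((hf.differentiableWithinAt (by simp)).hasDerivWithinAt).clm_apply
      (hasDerivWithinAt_const t J w)
    have h2 := toCoord_covDeriv ht (hu t ht) (hc.smooth t ht) hpp
      (((smoothAt_iff ht (hc.smooth t ht) hpp).1 (hA.smoothAt (P w) ht)).differentiableWithinAt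
        (n := ∞) (by simp))
    -- The field `A (P w)` vanishes at `t`, so the Christoffel term does too and the coordinate
    -- derivative is the covariant one.
    rw [hP w, Submodule.coe_zero, toCoord_zero, map_zero, add_zero] at h2
    rw [tensorDeriv, h2]
    have h3 := h1.derivWithin (hu t ht)
    rw [map_zero, add_zero] at h3
    exact h3.symm

/-- The field `Y u` is `(B_s^*)⁻¹ u`, where `A_s = B_s (1 - P + (s - t) P)`, `P` projects onto `ker
A_t`, and `B` is smooth at `t` with `B_t = A_t + A'_t P` invertible. Thus the singular behaviour of
`(A_s^*)⁻¹` is confined to the explicit factor, and the last clause records the equation of `B_t^*`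
on the kernel. -/
theorem IsLagrangeTensor.exists_dual_fields (hJ : J.OrdConnected) (hJ' : J.Nontrivial)
    (hc : IsUnitGeodesicOn (E := E) c J) (hA : IsLagrangeTensor A) (ht₀ : t₀ ∈ J) (ht : t ∈ J) :
    ∃ Y : normalSpace E c J t₀ → ∀ s, TangentSpace 𝓘(ℝ, E) (c s),
      (∀ u, SmoothAt c J (Y u) t) ∧
      (∀ᶠ s in 𝓝[J] t, ∀ u, inner ℝ (Y u s) (velocity c J s) = 0 ∧
        ∀ w, inner ℝ (Y u s) (A s w : TangentSpace 𝓘(ℝ, E) (c s))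
          = inner ℝ u (w - (LinearMap.ker (A t)).starProjection w
            + (s - t) • (LinearMap.ker (A t)).starProjection w)) ∧
      ∀ u, ∀ k ∈ LinearMap.ker (A t), inner ℝ (Y u t) (tensorDeriv A t k) = inner ℝ u k := by
  have hu := uniqueDiffOn_of_ordConnected hJ hJ'
  have hpp := mem_chart_source E (c t)
  obtain ⟨P, hPdef⟩ : ∃ P, P = (LinearMap.ker (A t)).starProjection := ⟨_, rfl⟩
  have hspan : ∀ z : TangentSpace 𝓘(ℝ, E) (c t), inner ℝ z (velocity c J t) = 0 →
      ∃ w, z = (A t w : TangentSpace 𝓘(ℝ, E) (c t)) + tensorDeriv A t (P w) := by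
    rw [hPdef]
    exact fun z hz ↦ hA.exists_eq_add hJ hJ' hc ht₀ ht hz
  have hP : ∀ w, A t (P w) = 0 := fun w ↦ by
    rw [hPdef]
    exact Submodule.starProjection_apply_mem (LinearMap.ker (A t)) w
  have hPk : ∀ k, A t k = 0 → P k = k := fun k hk ↦ by
    rw [hPdef]
    exact Submodule.starProjection_eq_self_iff.2 hk
  have hPP : ∀ w, P (P w) = P w := fun w ↦ hPk _ (hP w)
  rw [← hPdef]
  clear hPdef
  obtain ⟨H, hH, hH1, hH2⟩ := hA.exists_smooth_quotient hJ hJ' hc ht P hP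
  let B : ℝ → normalSpace E c J t₀ →L[ℝ] E := fun s ↦
    coordFamily A (c t) s ∘L (ContinuousLinearMap.id ℝ _ - P) + H s ∘L P
  have hBapp : ∀ s w, B s w = coordFamily A (c t) s (w - P w) + H s (P w) := fun s w ↦ rfl
  have hB : ContDiffWithinAt ℝ ∞ B J t :=
    ((hA.contDiffWithinAt_coordFamily hc ht).clm_comp contDiffWithinAt_const).add
      (hH.clm_comp contDiffWithinAt_const)
  -- The factorization of `A_s`; on the kernel the factor `s - t` cancels the division.
  have hB1 : ∀ s w, B s (w - P w + (s - t) • P w)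
      = toCoord (c t) (c s) (A s w : TangentSpace 𝓘(ℝ, E) (c s)) := by
    intro s w
    have e1 : P (w - P w + (s - t) • P w) = (s - t) • P w := by
      rw [map_add, map_sub, map_smul, hPP, sub_self, zero_add]
    rw [hBapp, e1, add_sub_cancel_right, map_smul, hH1, hPP, ← map_add, sub_add_cancel,
      coordFamily_apply]
  have hB2 : ∀ w, B t w = toCoord (c t) (c t)
      ((A t w : TangentSpace 𝓘(ℝ, E) (c t)) + tensorDeriv A t (P w)) := by
    intro w
    rw [hBapp, hH2, hPP, coordFamily_apply, map_sub, hP, sub_zero, toCoord_add]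
  let x : ℝ → E := fun s ↦ extChartAt 𝓘(ℝ, E) (c t) (c s)
  have hx : ContDiffWithinAt ℝ ∞ x J t := contDiffWithinAt_extChartAt (hc.smooth t ht) hpp
  have hG : ContDiffWithinAt ℝ ∞ (fun s ↦ chartMetric (c t) (x s)) J t :=
    ContDiffAt.comp_contDiffWithinAt (g := chartMetric (E := E) (c t)) t
      ((isMetricOn_chartMetric (c t)).contDiffAt (mem_target hpp)) hx
  have hvel : ContDiffWithinAt ℝ ∞ (fun s ↦ toCoord (c t) (c s) (velocity (E := E) c J s)) J t :=
    (smoothAt_iff ht (hc.smooth t ht) hpp).1 (smoothAt_velocity hu hc.smooth ht)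
  -- For injectivity at `t`: a vector orthogonal to `ċ` equals some `B_t w`, so if it is also
  -- orthogonal to `im B_t` it is orthogonal to itself.
  obtain ⟨y, hy, hy'⟩ := exists_smooth_dual hG hB hvel (finrank_normalSpace hc ht₀) (by
    intro z hz hz'
    rw [← toCoord_ofCoord hpp z] at hz hz' ⊢
    rw [← inner_eq_chartMetric hpp] at hz'
    obtain ⟨w, hw⟩ := hspan _ hz'
    have h := hz w
    rw [hB2, ← inner_eq_chartMetric hpp, ← hw, inner_self_eq_zero] at h
    rw [h, toCoord_zero])
  have hmem := eventually_mem_chart (E := E) (hc.smooth t ht).continuousWithinAt hpp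
  refine ⟨fun u s ↦ ofCoord (c t) (c s) (y u s), fun u ↦ ?_, ?_, fun u k hk ↦ ?_⟩
  · rw [smoothAt_iff ht (hc.smooth t ht) hpp]
    have heq : ∀ᶠ s in 𝓝[J] t, toCoord (c t) (c s) (ofCoord (c t) (c s) (y u s)) = y u s := by
      filter_upwards [hmem] with s hs using toCoord_ofCoord hs _
    exact (hy u).congr_of_eventuallyEq heq (heq.self_of_nhdsWithin ht)
  · filter_upwards [hy', hmem] with s hs hs' u
    refine ⟨?_, fun w ↦ ?_⟩
    · rw [inner_eq_chartMetric hs', toCoord_ofCoord hs']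
      exact (hs u).2
    · rw [inner_eq_chartMetric hs', toCoord_ofCoord hs', ← hB1]
      exact (hs u).1 _
  · have h := ((hy'.self_of_nhdsWithin ht) u).1 k
    rw [hB2, hPk k hk, show A t k = 0 from hk, Submodule.coe_zero, zero_add] at h
    rw [inner_eq_chartMetric hpp, toCoord_ofCoord hpp]
    exact h

end DualFields

/-! ### Behaviour of regular points, `Z` and `g_v` near a given point -/

section LocalStructure

variable {E : Type*} [NormedAddCommGroup E] [NormedSpace ℝ E] [FiniteDimensional ℝ E]
  {M : Type*} [TopologicalSpace M] [ChartedSpace E M] [IsManifold 𝓘(ℝ, E) ∞ M]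
  [RiemannianBundle (fun x : M ↦ TangentSpace 𝓘(ℝ, E) x)]
  [IsContMDiffRiemannianBundle 𝓘(ℝ, E) ∞ E (fun x : M ↦ TangentSpace 𝓘(ℝ, E) x)]
  {c : ℝ → M} {J : Set ℝ} {t₀ t : ℝ}
  {A : ∀ t, normalSpace E c J t₀ →ₗ[ℝ] normalSpace E c J t} {v : normalSpace E c J t₀}

theorem isRegularPt_of_injective (hc : IsUnitGeodesicOn (E := E) c J) (ht₀ : t₀ ∈ J) (ht : t ∈ J)
    (h : ∀ w, A t w = 0 → w = 0) : IsRegularPt A t := by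
  have hinj : Function.Injective (A t) := (injective_iff_map_eq_zero (A t)).2 h
  have hrank : Module.finrank ℝ (normalSpace E c J t₀) = Module.finrank ℝ (normalSpace E c J t) := by
    have h1 := finrank_normalSpace hc ht₀
    have h2 := finrank_normalSpace hc ht
    omega
  exact ⟨hinj, (LinearMap.injective_iff_surjective_of_finrank_eq_finrank hrank).1 hinj⟩

theorem IsRegularPt.ker_eq_bot (h : IsRegularPt A t) : LinearMap.ker (A t) = ⊥ :=
  LinearMap.ker_eq_bot.2 h.1

theorem IsLagrangeTensor.eventually_isRegularPt (hJ : J.OrdConnected) (hJ' : J.Nontrivial)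
    (hc : IsUnitGeodesicOn (E := E) c J) (hA : IsLagrangeTensor A) (ht₀ : t₀ ∈ J) (ht : t ∈ J) :
    ∀ᶠ s in 𝓝[J \ {t}] t, IsRegularPt A s := by
  obtain ⟨Y, -, hY, -⟩ := hA.exists_dual_fields hJ hJ' hc ht₀ ht
  filter_upwards [nhdsWithin_mono t sdiff_subset hY, self_mem_nhdsWithin] with s hs hsJ
  refine isRegularPt_of_injective hc ht₀ hsJ.1 fun w hw ↦ ?_
  have hne : s - t ≠ 0 := sub_ne_zero.2 hsJ.2
  generalize hP : (LinearMap.ker (A t)).starProjection = P at hs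
  have hPP : P (P w) = P w := by
    rw [← hP]
    exact Submodule.starProjection_eq_self_iff.2 (Submodule.starProjection_apply_mem _ w)
  -- If `A_s w = 0`, the vector `(1 - P + (s - t) P) w` is orthogonal to every `u`; testing with
  -- itself shows that it vanishes, and the factor is injective for `s ≠ t`.
  have h1 : w - P w + (s - t) • P w = 0 := by
    have := (hs (w - P w + (s - t) • P w)).2 w
    rw [hw, Submodule.coe_zero, inner_zero_right] at this
    exact inner_self_eq_zero.1 this.symm
  have h2 : (s - t) • P w = 0 := by
    have := congrArg P h1
    rwa [map_add, map_sub, map_smul, hPP, sub_self, zero_add, map_zero] at this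
  have h3 : P w = 0 := (smul_eq_zero.1 h2).resolve_left hne
  rwa [h3, sub_zero, smul_zero, add_zero] at h1

theorem IsLagrangeTensor.eventually_isRegularPt_of_ne (hJ : J.OrdConnected) (hJ' : J.Nontrivial)
    (hc : IsUnitGeodesicOn (E := E) c J) (hA : IsLagrangeTensor A) (ht₀ : t₀ ∈ J) (ht : t ∈ J) :
    ∀ᶠ s in 𝓝[J] t, s ≠ t → IsRegularPt A s := by
  have h := hA.eventually_isRegularPt hJ hJ' hc ht₀ ht
  rwa [sdiff_eq, nhdsWithin_inter', eventually_inf_principal] at h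

/-- Regular points accumulate at every `t ∈ J`, so that the `limUnder` in `virtualLength` is
determined as soon as a limit exists. -/
theorem IsLagrangeTensor.neBot_regular (hJ : J.OrdConnected) (hJ' : J.Nontrivial)
    (hc : IsUnitGeodesicOn (E := E) c J) (hA : IsLagrangeTensor A) (ht₀ : t₀ ∈ J) (ht : t ∈ J) :
    NeBot (𝓝[{s | s ∈ J ∧ IsRegularPt A s}] t) := by
  have h := hA.eventually_isRegularPt hJ hJ' hc ht₀ ht
  have hacc : AccPt t (𝓟 J) :=
    uniqueDiffWithinAt_iff_accPt.1 (uniqueDiffOn_of_ordConnected hJ hJ' t ht)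
  have hne : NeBot (𝓝[J \ {t}] t) := by
    rw [sdiff_eq, inter_comm, nhdsWithin_inter']
    exact hacc
  refine hne.mono (le_inf inf_le_left ?_)
  rw [le_principal_iff]
  filter_upwards [h, self_mem_nhdsWithin] with s hs hsJ using ⟨hsJ.1, hs⟩

/-- At a regular point `A` is onto, hence its adjoint is injective and the `invFun` in
`virtualField` returns the only solution. -/
theorem IsRegularPt.virtualField_eq (h : IsRegularPt A t) {z : TangentSpace 𝓘(ℝ, E) (c t)}
    (hz : inner ℝ z (velocity c J t) = 0)
    (hzv : ∀ w, inner ℝ z (A t w : TangentSpace 𝓘(ℝ, E) (c t)) = inner ℝ v w) :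
    (virtualField A v t : TangentSpace 𝓘(ℝ, E) (c t)) = z := by
  have h1 : LinearMap.adjoint (A t) ⟨z, mem_normalSpace_iff.2 hz⟩ = v := by
    refine ext_inner_right ℝ fun w ↦ ?_
    rw [LinearMap.adjoint_inner_left]
    exact hzv w
  have hinj : Function.Injective (LinearMap.adjoint (A t)) := by
    rw [injective_iff_map_eq_zero]
    intro y hy
    obtain ⟨w, hw⟩ := h.2 y
    have : inner ℝ (LinearMap.adjoint (A t) y) w = 0 := by rw [hy, inner_zero_left]
    rw [LinearMap.adjoint_inner_left, hw] at this
    exact inner_self_eq_zero.1 this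
  rw [virtualField, ← h1, Function.leftInverse_invFun hinj]

/-- Near `t` only `t` itself can be singular, and there `g_v` is the limit of `h` along regular
points, which is `h t` by continuity. -/
theorem IsLagrangeTensor.virtualLength_eventuallyEq (hJ : J.OrdConnected) (hJ' : J.Nontrivial)
    (hc : IsUnitGeodesicOn (E := E) c J) (hA : IsLagrangeTensor A) (ht₀ : t₀ ∈ J) (ht : t ∈ J)
    {h : ℝ → ℝ} (hcont : ContinuousWithinAt h J t)
    (heq : ∀ᶠ s in 𝓝[J] t, IsRegularPt A s → ‖v‖ ^ 2 / ‖virtualField A v s‖ = h s) :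
    ∀ᶠ s in 𝓝[J] t, virtualLength A v s = h s := by
  filter_upwards [heq, hA.eventually_isRegularPt_of_ne hJ hJ' hc ht₀ ht] with s hs hs'
  by_cases hreg : IsRegularPt A s
  · rw [virtualLength, if_pos hreg, hs hreg]
  · obtain rfl : s = t := by
      by_contra hne
      exact hreg (hs' hne)
    rw [virtualLength, if_neg hreg]
    have := hA.neBot_regular hJ hJ' hc ht₀ ht
    refine Tendsto.limUnder_eq ?_
    have hle : 𝓝[{r | r ∈ J ∧ IsRegularPt A r}] s ≤ 𝓝[J] s := nhdsWithin_mono s fun r hr ↦ hr.1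
    refine Tendsto.congr' ?_ (hcont.mono_left hle)
    filter_upwards [hle heq, self_mem_nhdsWithin] with r hr hr'
    exact (hr hr'.2).symm

/-- For `v ⟂ ker A_t` the factor `1 - P + (s - t) P` is invisible after pairing with `v`, so `Y v`
itself continues `Z` through `t`. -/
theorem IsLagrangeTensor.exists_field_of_mem (hJ : J.OrdConnected) (hJ' : J.Nontrivial)
    (hc : IsUnitGeodesicOn (E := E) c J) (hA : IsLagrangeTensor A) (ht₀ : t₀ ∈ J) (ht : t ∈ J)
    (hv : v ∈ (LinearMap.ker (A t))ᗮ) :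
    ∃ Y : ∀ s, TangentSpace 𝓘(ℝ, E) (c s), SmoothAt c J Y t ∧
      (∀ᶠ s in 𝓝[J] t, inner ℝ (Y s) (velocity c J s) = 0 ∧
        ∀ w, inner ℝ (Y s) (A s w : TangentSpace 𝓘(ℝ, E) (c s)) = inner ℝ v w) ∧
      ∀ k ∈ LinearMap.ker (A t), inner ℝ (Y t) (tensorDeriv A t k) = 0 := by
  obtain ⟨Y, hY1, hY2, hY3⟩ := hA.exists_dual_fields hJ hJ' hc ht₀ ht
  have hker : ∀ k ∈ LinearMap.ker (A t), inner ℝ v k = 0 := fun k hk ↦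
    Submodule.inner_left_of_mem_orthogonal hk hv
  refine ⟨Y v, hY1 v, ?_, fun k hk ↦ (hY3 v k hk).trans (hker k hk)⟩
  filter_upwards [hY2] with s hs
  refine ⟨(hs v).1, fun w ↦ ?_⟩
  rw [(hs v).2 w, inner_add_right, inner_sub_right, inner_smul_right,
    hker _ (Submodule.starProjection_apply_mem _ w)]
  ring

/-- The field is the continuation of `(s - t) Z`, because `(1 - P + (s - t) P)⁻¹ (s - t) v = (s - t)
(v - P v) + P v`. At `t` it reduces to `Y (P v)`, whose product with `A'_t (P v)` is `|P v|² ≠ 0`.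
-/
theorem IsLagrangeTensor.exists_field_of_notMem (hJ : J.OrdConnected) (hJ' : J.Nontrivial)
    (hc : IsUnitGeodesicOn (E := E) c J) (hA : IsLagrangeTensor A) (ht₀ : t₀ ∈ J) (ht : t ∈ J)
    (hv : v ∉ (LinearMap.ker (A t))ᗮ) :
    ∃ Y : ∀ s, TangentSpace 𝓘(ℝ, E) (c s), SmoothAt c J Y t ∧ Y t ≠ 0 ∧
      ∀ᶠ s in 𝓝[J] t, inner ℝ (Y s) (velocity c J s) = 0 ∧
        ∀ w, inner ℝ (Y s) (A s w : TangentSpace 𝓘(ℝ, E) (c s)) = (s - t) * inner ℝ v w := by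
  obtain ⟨Y, hY1, hY2, hY3⟩ := hA.exists_dual_fields hJ hJ' hc ht₀ ht
  generalize hP : (LinearMap.ker (A t)).starProjection = P at hY2
  have hmem : ∀ w, P w ∈ LinearMap.ker (A t) := fun w ↦
    hP ▸ Submodule.starProjection_apply_mem (LinearMap.ker (A t)) w
  have horth : ∀ w, w - P w ∈ (LinearMap.ker (A t))ᗮ := fun w ↦
    hP ▸ Submodule.sub_starProjection_mem_orthogonal w
  have h1 : ∀ w, inner ℝ (v - P v) (P w) = 0 := fun w ↦
    Submodule.inner_left_of_mem_orthogonal (hmem w) (horth v)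
  have h2 : ∀ w, inner ℝ (P v) (w - P w) = 0 := fun w ↦
    Submodule.inner_right_of_mem_orthogonal (hmem v) (horth w)
  refine ⟨fun s ↦ (s - t) • Y (v - P v) s + Y (P v) s, ?_, ?_, ?_⟩
  · refine SmoothAt.add hc.smooth ht (SmoothAt.smul hc.smooth ht ?_ (hY1 _)) (hY1 _)
    exact (contDiff_id.sub contDiff_const).contDiffWithinAt
  · intro h0
    beta_reduce at h0
    rw [sub_self, zero_smul, zero_add] at h0
    have := hY3 (P v) (P v) (hmem v)
    rw [h0, inner_zero_left] at this
    have hz := inner_self_eq_zero.1 this.symm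
    have := horth v
    rw [hz, sub_zero] at this
    exact hv this
  · filter_upwards [hY2] with s hs
    refine ⟨?_, fun w ↦ ?_⟩
    · rw [inner_add_left, real_inner_smul_left, (hs _).1, (hs _).1]
      ring
    · have h3 := h2 w
      have h4 := h1 w
      rw [inner_sub_right] at h3
      rw [inner_sub_left] at h4
      rw [inner_add_left, real_inner_smul_left, (hs _).2 w, (hs _).2 w]
      simp only [inner_add_right, inner_sub_right, inner_sub_left, real_inner_smul_right]
      linear_combination (s - t) * (s - t - 1) * h4 + (1 - (s - t)) * h3

theorem IsLagrangeTensor.virtualLength_of_mem (hJ : J.OrdConnected) (hJ' : J.Nontrivial)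
    (hc : IsUnitGeodesicOn (E := E) c J) (hA : IsLagrangeTensor A) (ht₀ : t₀ ∈ J) (ht : t ∈ J)
    (hv0 : v ≠ 0) {Y : ∀ s, TangentSpace 𝓘(ℝ, E) (c s)} (hY : SmoothAt c J Y t)
    (hYv : ∀ᶠ s in 𝓝[J] t, inner ℝ (Y s) (velocity c J s) = 0 ∧
      ∀ w, inner ℝ (Y s) (A s w : TangentSpace 𝓘(ℝ, E) (c s)) = inner ℝ v w) :
    Y t ≠ 0 ∧ ∀ᶠ s in 𝓝[J] t, virtualLength A v s = ‖v‖ ^ 2 / √(inner ℝ (Y s) (Y s)) := by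
  have hne : Y t ≠ 0 := by
    intro h0
    have := (hYv.self_of_nhdsWithin ht).2 v
    rw [h0, inner_zero_left] at this
    exact hv0 (inner_self_eq_zero.1 this.symm)
  have hpos : √(inner ℝ (Y t) (Y t)) ≠ 0 := by
    rw [← norm_eq_sqrt_real_inner]
    exact norm_ne_zero_iff.2 hne
  refine ⟨hne, hA.virtualLength_eventuallyEq hJ hJ' hc ht₀ ht ?_ ?_⟩
  · exact continuousWithinAt_const.div
      (Real.continuous_sqrt.continuousAt.comp_continuousWithinAt
        (hY.contDiffWithinAt_inner hY).continuousWithinAt) hpos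
  · filter_upwards [hYv] with s hs hreg
    rw [← norm_eq_sqrt_real_inner, ← hreg.virtualField_eq hs.1 hs.2]
    rfl

theorem IsLagrangeTensor.virtualLength_of_notMem (hJ : J.OrdConnected) (hJ' : J.Nontrivial)
    (hc : IsUnitGeodesicOn (E := E) c J) (hA : IsLagrangeTensor A) (ht₀ : t₀ ∈ J) (ht : t ∈ J)
    (hv : v ∉ (LinearMap.ker (A t))ᗮ) :
    ∃ h : ℝ → ℝ, ContinuousWithinAt h J t ∧ 0 < h t ∧
      ∀ᶠ s in 𝓝[J] t, virtualLength A v s = |s - t| * h s := by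
  obtain ⟨Y, hY, hne, hYv⟩ := hA.exists_field_of_notMem hJ hJ' hc ht₀ ht hv
  have hpos : 0 < √(inner ℝ (Y t) (Y t)) := by
    rw [← norm_eq_sqrt_real_inner]
    exact norm_pos_iff.2 hne
  have hv0 : v ≠ 0 := fun h ↦ hv (h ▸ zero_mem _)
  have hcont : ContinuousWithinAt (fun s ↦ ‖v‖ ^ 2 / √(inner ℝ (Y s) (Y s))) J t :=
    continuousWithinAt_const.div (Real.continuous_sqrt.continuousAt.comp_continuousWithinAt
        (hY.contDiffWithinAt_inner hY).continuousWithinAt) hpos.ne'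
  refine ⟨fun s ↦ ‖v‖ ^ 2 / √(inner ℝ (Y s) (Y s)), hcont, ?_, ?_⟩
  · exact div_pos (pow_pos (norm_pos_iff.2 hv0) 2) hpos
  · refine hA.virtualLength_eventuallyEq hJ hJ' hc ht₀ ht ?_ ?_
    · exact ((continuous_id.sub continuous_const).abs.continuousWithinAt).mul hcont
    · filter_upwards [hYv] with s hs hreg
      -- The hypothesis on `v` makes `t` singular, whereas `s` is regular.
      have hst : s ≠ t := by
        rintro rfl
        rw [hreg.ker_eq_bot, Submodule.bot_orthogonal_eq_top] at hv
        exact hv trivial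
      have hst' : s - t ≠ 0 := sub_ne_zero.2 hst
      have hz : (virtualField A v s : TangentSpace 𝓘(ℝ, E) (c s)) = (s - t)⁻¹ • Y s := by
        refine hreg.virtualField_eq ?_ fun w ↦ ?_
        · rw [real_inner_smul_left, hs.1, mul_zero]
        · rw [real_inner_smul_left, hs.2 w, inv_mul_cancel_left₀ hst']
      have hnorm : ‖virtualField A v s‖ = |s - t|⁻¹ * ‖Y s‖ := by
        change ‖(virtualField A v s : TangentSpace 𝓘(ℝ, E) (c s))‖ = _
        rw [hz, norm_smul, norm_inv, Real.norm_eq_abs]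
      rw [hnorm, ← norm_eq_sqrt_real_inner, div_mul_eq_div_div, div_inv_eq_mul]
      ring

end LocalStructure

/-! ### Derivatives of `a / √f` and the corner of `|s - t| h` -/

section RealFunctions

theorem hasDerivWithinAt_div_sqrt {f : ℝ → ℝ} {f₁ a t : ℝ} {J : Set ℝ}
    (hf : HasDerivWithinAt f f₁ J t) (hpos : 0 < f t) :
    HasDerivWithinAt (fun s ↦ a / √(f s)) (-(a * f₁) / (2 * √(f t) ^ 3)) J t := by
  have hr : 0 < √(f t) := Real.sqrt_pos.2 hpos
  refine ((hasDerivWithinAt_const t J a).fun_div (hf.sqrt hpos.ne') hr.ne').congr_deriv ?_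
  field_simp
  ring

/-- Applied with `f₁ = f'`, this is the second derivative of `a f^(-1/2)`, written with that
function as a factor. -/
theorem hasDerivWithinAt_div_sqrt_pow_three {f f₁ : ℝ → ℝ} {f₂ a t : ℝ} {J : Set ℝ}
    (hf : HasDerivWithinAt f (f₁ t) J t) (hf₁ : HasDerivWithinAt f₁ f₂ J t) (hpos : 0 < f t) :
    HasDerivWithinAt (fun s ↦ -(a * f₁ s) / (2 * √(f s) ^ 3))
      (a / √(f t) * (-(f₂ / (2 * f t)) + 3 * f₁ t ^ 2 / (4 * f t ^ 2))) J t := by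
  have hr : 0 < √(f t) := Real.sqrt_pos.2 hpos
  have h := ((hf₁.const_mul a).fun_neg).fun_div (((hf.sqrt hpos.ne').fun_pow 3).const_mul 2)
    (by positivity)
  refine h.congr_deriv ?_
  have hsq : f t = √(f t) ^ 2 := (Real.sq_sqrt hpos.le).symm
  generalize √(f t) = r at *
  rw [hsq]
  field_simp
  ring

/-- The point `t` is a local minimum, so a derivative would be zero; but the absolute values of the
slopes tend to `h t > 0`. -/
theorem not_differentiableAt_of_eventuallyEq_abs_mul {g h : ℝ → ℝ} {t : ℝ}
    (hh : ContinuousAt h t) (hpos : 0 < h t) (hg : ∀ᶠ s in 𝓝 t, g s = |s - t| * h s) :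
    ¬ DifferentiableAt ℝ g t := by
  intro hd
  have hgt : g t = 0 := by simpa using hg.self_of_nhds
  have hmin : IsLocalMin g t := by
    filter_upwards [hg, hh.eventually (lt_mem_nhds hpos)] with s hs hs'
    rw [hgt, hs]
    exact mul_nonneg (abs_nonneg _) hs'.le
  have h0 : HasDerivAt g 0 t := hmin.deriv_eq_zero ▸ hd.hasDerivAt
  have h1 : Tendsto (fun s ↦ |slope g t s|) (𝓝[≠] t) (𝓝 0) := by
    simpa using (hasDerivAt_iff_tendsto_slope.1 h0).abs
  have h2 : Tendsto (fun s ↦ |slope g t s|) (𝓝[≠] t) (𝓝 (h t)) := by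
    refine (hh.mono_left nhdsWithin_le_nhds).congr' ?_
    filter_upwards [nhdsWithin_le_nhds hg, self_mem_nhdsWithin,
      nhdsWithin_le_nhds (hh.eventually (lt_mem_nhds hpos))] with s hs hst hs'
    have hne : |s - t| ≠ 0 := abs_ne_zero.2 (sub_ne_zero.2 hst)
    rw [slope_def_field, hgt, sub_zero, hs, abs_div, abs_mul, abs_abs, abs_of_pos hs']
    field_simp
  exact hpos.ne (tendsto_nhds_unique h1 h2)

end RealFunctions

/-! ### Differential identities for the dual field, parts (a) and (b) -/

section VirtualLength

variable {E : Type*} [NormedAddCommGroup E] [NormedSpace ℝ E] [FiniteDimensional ℝ E]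
  {M : Type*} [TopologicalSpace M] [ChartedSpace E M] [IsManifold 𝓘(ℝ, E) ∞ M]
  [RiemannianBundle (fun x : M ↦ TangentSpace 𝓘(ℝ, E) x)]
  [IsContMDiffRiemannianBundle 𝓘(ℝ, E) ∞ E (fun x : M ↦ TangentSpace 𝓘(ℝ, E) x)]
  {c : ℝ → M} {J : Set ℝ} {t₀ t : ℝ}
  {A : ∀ t, normalSpace E c J t₀ →ₗ[ℝ] normalSpace E c J t} {v : normalSpace E c J t₀}
  {Y : ∀ s, TangentSpace 𝓘(ℝ, E) (c s)}

/-- `Y` is smooth at `t` and coincides near `t` with `(A^*)⁻¹ v`, also at a singular point `t`, in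
which case `Y t` is normalized to lie in the image of `A_t`. -/
structure IsDualFieldAt (A : ∀ t, normalSpace E c J t₀ →ₗ[ℝ] normalSpace E c J t)
    (v : normalSpace E c J t₀) (t : ℝ) (Y : ∀ s, TangentSpace 𝓘(ℝ, E) (c s)) : Prop where
  smooth : SmoothAt c J Y t
  dual : ∀ᶠ s in 𝓝[J] t, inner ℝ (Y s) (velocity c J s) = 0 ∧
    ∀ w, inner ℝ (Y s) (A s w : TangentSpace 𝓘(ℝ, E) (c s)) = inner ℝ v w
  inner_ker : ∀ k ∈ LinearMap.ker (A t), inner ℝ (Y t) (tensorDeriv A t k) = 0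

theorem IsLagrangeTensor.exists_isDualFieldAt (hJ : J.OrdConnected) (hJ' : J.Nontrivial)
    (hc : IsUnitGeodesicOn (E := E) c J) (hA : IsLagrangeTensor A) (ht₀ : t₀ ∈ J) (ht : t ∈ J)
    (hv : v ∈ (LinearMap.ker (A t))ᗮ) : ∃ Y, IsDualFieldAt A v t Y := by
  obtain ⟨Y, h1, h2, h3⟩ := hA.exists_field_of_mem hJ hJ' hc ht₀ ht hv
  exact ⟨Y, h1, h2, h3⟩

theorem IsDualFieldAt.congr (hY : IsDualFieldAt A v t Y) (ht : t ∈ J)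
    {X : ∀ s, TangentSpace 𝓘(ℝ, E) (c s)} (h : ∀ᶠ s in 𝓝[J] t, X s = Y s) :
    IsDualFieldAt A v t X where
  smooth := hY.smooth.congr ht h
  dual := by
    filter_upwards [hY.dual, h] with s hs hXs
    rwa [hXs]
  inner_ker := by
    rw [h.self_of_nhdsWithin ht]
    exact hY.inner_ker

theorem IsDualFieldAt.inner_velocity (hY : IsDualFieldAt A v t Y) (ht : t ∈ J) :
    inner ℝ (Y t) (velocity c J t) = 0 :=
  (hY.dual.self_of_nhdsWithin ht).1

theorem IsDualFieldAt.inner_apply (hY : IsDualFieldAt A v t Y) (ht : t ∈ J)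
    (w : normalSpace E c J t₀) :
    inner ℝ (Y t) (A t w : TangentSpace 𝓘(ℝ, E) (c t)) = inner ℝ v w :=
  (hY.dual.self_of_nhdsWithin ht).2 w

theorem IsDualFieldAt.virtualField_eq (hY : IsDualFieldAt A v t Y) (ht : t ∈ J)
    (hreg : IsRegularPt A t) : (virtualField A v t : TangentSpace 𝓘(ℝ, E) (c t)) = Y t :=
  hreg.virtualField_eq (hY.inner_velocity ht) (hY.inner_apply ht)

theorem IsDualFieldAt.ne_zero (hY : IsDualFieldAt A v t Y) (ht : t ∈ J) (hv : v ≠ 0) : Y t ≠ 0 := by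
  intro h0
  have := hY.inner_apply ht v
  rw [h0, inner_zero_left] at this
  exact hv (inner_self_eq_zero.1 this.symm)

theorem IsLagrangeTensor.exists_forall_isDualFieldAt (hJ : J.OrdConnected) (hJ' : J.Nontrivial)
    (hc : IsUnitGeodesicOn (E := E) c J) (hA : IsLagrangeTensor A) (ht₀ : t₀ ∈ J)
    (hv : ∀ t ∈ J, v ∈ (LinearMap.ker (A t))ᗮ) : ∃ Y, ∀ t ∈ J, IsDualFieldAt A v t Y := by
  choose! Y hY using fun t ht ↦ hA.exists_isDualFieldAt hJ hJ' hc ht₀ ht (hv t ht)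
  -- The local fields are glued along the diagonal: near `t` every other point is regular, and there
  -- the dual field is unique.
  refine ⟨fun t ↦ Y t t, fun t ht ↦ (hY t ht).congr ht ?_⟩
  filter_upwards [hA.eventually_isRegularPt_of_ne hJ hJ' hc ht₀ ht, (hY t ht).dual,
    self_mem_nhdsWithin] with s hs hd hsJ
  by_cases hst : s = t
  · subst hst
    rfl
  · rw [← (hY s hsJ).virtualField_eq hsJ (hs hst)]
    exact (hs hst).virtualField_eq hd.1 hd.2

theorem IsDualFieldAt.inner_covDeriv_velocity (hJ : UniqueDiffOn ℝ J)
    (hc : IsUnitGeodesicOn (E := E) c J) (hY : IsDualFieldAt A v t Y) (ht : t ∈ J) :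
    inner ℝ (covDeriv c J Y t) (velocity c J t) = 0 := by
  have h := hY.smooth.hasDerivWithinAt_inner hc.smooth ht (smoothAt_velocity hJ hc.smooth ht)
  have heq : (fun s ↦ inner ℝ (Y s) (velocity c J s)) =ᶠ[𝓝[J] t] fun _ ↦ 0 :=
    hY.dual.mono fun s hs ↦ hs.1
  have h0 := (hasDerivWithinAt_const t J (0 : ℝ)).congr_of_eventuallyEq heq
    (heq.self_of_nhdsWithin ht)
  have := (hJ t ht).eq_deriv _ h h0
  rwa [hc.geodesic t ht, inner_zero_right, add_zero] at this

theorem IsDualFieldAt.eventually_inner_covDeriv (hJ : UniqueDiffOn ℝ J)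
    (hc : IsUnitGeodesicOn (E := E) c J) (hA : IsLagrangeTensor A) (hY : IsDualFieldAt A v t Y)
    (ht : t ∈ J) (w : normalSpace E c J t₀) :
    ∀ᶠ s in 𝓝[J] t, inner ℝ (covDeriv c J Y s) (A s w : TangentSpace 𝓘(ℝ, E) (c s))
      + inner ℝ (Y s) (tensorDeriv A s w) = 0 := by
  filter_upwards [hY.smooth.eventually_hasDerivWithinAt_inner hc.smooth ht (hA.smoothAt w ht),
    eventually_eventually_nhdsWithin.2 hY.dual, self_mem_nhdsWithin] with s hs hd hsJ
  have heq : (fun s ↦ inner ℝ (Y s) (A s w : TangentSpace 𝓘(ℝ, E) (c s))) =ᶠ[𝓝[J] s]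
      fun _ ↦ inner ℝ v w := hd.mono fun r hr ↦ hr.2 w
  exact (hJ s hsJ).eq_deriv _ hs ((hasDerivWithinAt_const s J _).congr_of_eventuallyEq heq
    (heq.self_of_nhdsWithin hsJ))

/-- The relation `Z' = -S Z`, in a form that makes sense at singular points too. -/
theorem IsDualFieldAt.exists_apply_eq (hJ : J.OrdConnected) (hJ' : J.Nontrivial)
    (hc : IsUnitGeodesicOn (E := E) c J) (hA : IsLagrangeTensor A) (hY : IsDualFieldAt A v t Y)
    (ht₀ : t₀ ∈ J) (ht : t ∈ J) :
    ∃ u, (A t u : TangentSpace 𝓘(ℝ, E) (c t)) = Y t ∧ tensorDeriv A t u = - covDeriv c J Y t := by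
  have hu := uniqueDiffOn_of_ordConnected hJ hJ'
  have hker : ∀ w, A t ((LinearMap.ker (A t)).starProjection w) = 0 := fun w ↦
    Submodule.starProjection_apply_mem (LinearMap.ker (A t)) w
  have horth : ∀ w x, inner ℝ (A t w : TangentSpace 𝓘(ℝ, E) (c t))
      (tensorDeriv A t ((LinearMap.ker (A t)).starProjection x)) = 0 := fun w x ↦ by
    rw [← hA.wronskian hJ hJ' hc _ _ ht, hker, Submodule.coe_zero, inner_zero_right]
  -- The component of `Y t` in `A'_t (ker A_t)` vanishes by the normalization `inner_ker`, so `Y t`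
  -- lies in the image of `A_t`.
  obtain ⟨w, hw⟩ := hA.exists_eq_add hJ hJ' hc ht₀ ht (hY.inner_velocity ht)
  have h1 : tensorDeriv A t ((LinearMap.ker (A t)).starProjection w) = 0 := by
    have := hY.inner_ker _ (hker w)
    rw [hw, inner_add_left, horth, zero_add] at this
    exact inner_self_eq_zero.1 this
  rw [h1, add_zero] at hw
  -- For this `w` the defect `Y' + A' w` is orthogonal to `im A_t`, hence equals `A'_t` of a kernel
  -- element. Subtracting that element from `w` removes the defect without changing `A_t w`.
  have hperp : ∀ x, inner ℝ (covDeriv c J Y t + tensorDeriv A t w)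
      (A t x : TangentSpace 𝓘(ℝ, E) (c t)) = 0 := fun x ↦ by
    have := (hY.eventually_inner_covDeriv hu hc hA ht x).self_of_nhdsWithin ht
    rw [inner_add_left, hA.wronskian hJ hJ' hc _ _ ht, ← hw, this]
  obtain ⟨x, hx⟩ := hA.exists_eq_add hJ hJ' hc ht₀ ht
    (z := covDeriv c J Y t + tensorDeriv A t w) (by
      rw [inner_add_left, hY.inner_covDeriv_velocity hu hc ht,
        hA.inner_tensorDeriv_velocity hu hc w ht, add_zero])
  have h2 : (A t x : TangentSpace 𝓘(ℝ, E) (c t)) = 0 := by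
    have := hperp x
    rw [hx, inner_add_left, real_inner_comm _ (tensorDeriv A t _), horth, add_zero] at this
    exact inner_self_eq_zero.1 this
  rw [h2, zero_add] at hx
  refine ⟨w - (LinearMap.ker (A t)).starProjection x, ?_, ?_⟩
  · rw [map_sub, hker, sub_zero, hw]
  · have := (tensorDerivLinear hc hA ht).map_sub w ((LinearMap.ker (A t)).starProjection x)
    change tensorDeriv A t _ = tensorDeriv A t _ - tensorDeriv A t _ at this
    rw [this, ← hx]
    abel

/-- Differentiate `⟪Y', A u⟫ + ⟪Y, A' u⟫ = 0` for the fixed `u` with `A u = Y` and `A' u = -Y'` at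
`t`, and insert `A'' = -R A`. No inverse of `A` enters, so singular points are included. -/
theorem IsDualFieldAt.inner_covDeriv_covDeriv (hJ : J.OrdConnected) (hJ' : J.Nontrivial)
    (hc : IsUnitGeodesicOn (E := E) c J) (hA : IsLagrangeTensor A) (hY : IsDualFieldAt A v t Y)
    (ht₀ : t₀ ∈ J) (ht : t ∈ J) :
    inner ℝ (covDeriv c J (covDeriv c J Y) t) (Y t)
      = 2 * inner ℝ (covDeriv c J Y t) (covDeriv c J Y t) + inner ℝ (tidal c J t (Y t)) (Y t) := by
  have hu := uniqueDiffOn_of_ordConnected hJ hJ'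
  obtain ⟨u, hu1, hu2⟩ := hY.exists_apply_eq hJ hJ' hc hA ht₀ ht
  have h1 := (hY.smooth.covDeriv hu hc.smooth ht).hasDerivWithinAt_inner hc.smooth ht
    (hA.smoothAt u ht)
  have h2 := hY.smooth.hasDerivWithinAt_inner hc.smooth ht (hA.smoothAt_tensorDeriv hu hc u ht)
  have heq : (fun s ↦ inner ℝ (covDeriv c J Y s) (A s u : TangentSpace 𝓘(ℝ, E) (c s))
      + inner ℝ (Y s) (tensorDeriv A s u)) =ᶠ[𝓝[J] t] fun _ ↦ 0 :=
    hY.eventually_inner_covDeriv hu hc hA ht u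
  have h0 := (hu t ht).eq_deriv _ (h1.fun_add h2)
    ((hasDerivWithinAt_const t J (0 : ℝ)).congr_of_eventuallyEq heq (heq.self_of_nhdsWithin ht))
  change inner ℝ _ _ + inner ℝ _ (tensorDeriv A t u) + _ = _ at h0
  rw [hA.covDeriv_tensorDeriv u ht, hu2, hu1, inner_neg_right, inner_neg_right,
    real_inner_comm (tidal c J t (Y t))] at h0
  linarith

theorem IsDualFieldAt.virtualLength_eventuallyEq (hJ : J.OrdConnected) (hJ' : J.Nontrivial)
    (hc : IsUnitGeodesicOn (E := E) c J) (hA : IsLagrangeTensor A) (hY : IsDualFieldAt A v t Y)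
    (ht₀ : t₀ ∈ J) (ht : t ∈ J) (hv : v ≠ 0) :
    virtualLength A v =ᶠ[𝓝[J] t] fun s ↦ ‖v‖ ^ 2 / √(inner ℝ (Y s) (Y s)) :=
  (hA.virtualLength_of_mem hJ hJ' hc ht₀ ht hv hY.smooth hY.dual).2

theorem IsDualFieldAt.virtualLength_eq (hJ : J.OrdConnected) (hJ' : J.Nontrivial)
    (hc : IsUnitGeodesicOn (E := E) c J) (hA : IsLagrangeTensor A) (hY : IsDualFieldAt A v t Y)
    (ht₀ : t₀ ∈ J) (ht : t ∈ J) (hv : v ≠ 0) : virtualLength A v t = ‖v‖ ^ 2 / ‖Y t‖ := by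
  rw [norm_eq_sqrt_real_inner (Y t)]
  exact (hY.virtualLength_eventuallyEq hJ hJ' hc hA ht₀ ht hv).self_of_nhdsWithin ht

theorem IsDualFieldAt.virtualLength_pos (hJ : J.OrdConnected) (hJ' : J.Nontrivial)
    (hc : IsUnitGeodesicOn (E := E) c J) (hA : IsLagrangeTensor A) (hY : IsDualFieldAt A v t Y)
    (ht₀ : t₀ ∈ J) (ht : t ∈ J) (hv : v ≠ 0) : 0 < virtualLength A v t := by
  rw [hY.virtualLength_eq hJ hJ' hc hA ht₀ ht hv]
  exact div_pos (pow_pos (norm_pos_iff.2 hv) 2) (norm_pos_iff.2 (hY.ne_zero ht hv))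

theorem IsDualFieldAt.contDiffWithinAt_virtualLength (hJ : J.OrdConnected) (hJ' : J.Nontrivial)
    (hc : IsUnitGeodesicOn (E := E) c J) (hA : IsLagrangeTensor A) (hY : IsDualFieldAt A v t Y)
    (ht₀ : t₀ ∈ J) (ht : t ∈ J) (hv : v ≠ 0) : ContDiffWithinAt ℝ ∞ (virtualLength A v) J t := by
  have hpos : 0 < inner ℝ (Y t) (Y t) := real_inner_self_pos.2 (hY.ne_zero ht hv)
  have h : ContDiffWithinAt ℝ ∞ (fun s ↦ ‖v‖ ^ 2 / √(inner ℝ (Y s) (Y s))) J t :=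
    contDiffWithinAt_const.div ((hY.smooth.contDiffWithinAt_inner hY.smooth).sqrt hpos.ne')
      (Real.sqrt_pos.2 hpos).ne'
  have heq := hY.virtualLength_eventuallyEq hJ hJ' hc hA ht₀ ht hv
  exact h.congr_of_eventuallyEq heq (heq.self_of_nhdsWithin ht)

theorem IsDualFieldAt.hasDerivWithinAt_virtualLength (hJ : J.OrdConnected) (hJ' : J.Nontrivial)
    (hc : IsUnitGeodesicOn (E := E) c J) (hA : IsLagrangeTensor A) (hY : IsDualFieldAt A v t Y)
    (ht₀ : t₀ ∈ J) (ht : t ∈ J) (hv : v ≠ 0) :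
    HasDerivWithinAt (virtualLength A v)
      (-(virtualLength A v t * (inner ℝ (covDeriv c J Y t) (Y t) / ‖Y t‖ ^ 2))) J t ∧
    HasDerivWithinAt (derivWithin (virtualLength A v) J)
      (virtualLength A v t * (-(inner ℝ (tidal c J t (Y t)) (Y t) / ‖Y t‖ ^ 2)
        - 3 * ((‖covDeriv c J Y t‖ ^ 2 * ‖Y t‖ ^ 2 - inner ℝ (covDeriv c J Y t) (Y t) ^ 2)
          / ‖Y t‖ ^ 4))) J t := by
  have hu := uniqueDiffOn_of_ordConnected hJ hJ'
  have hne := hY.ne_zero ht hv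
  have hn : 0 < ‖Y t‖ := norm_pos_iff.2 hne
  have hpos : 0 < inner ℝ (Y t) (Y t) := real_inner_self_pos.2 hne
  have heq := hY.virtualLength_eventuallyEq hJ hJ' hc hA ht₀ ht hv
  have hf : ∀ᶠ s in 𝓝[J] t, HasDerivWithinAt (fun r ↦ inner ℝ (Y r) (Y r))
      (2 * inner ℝ (covDeriv c J Y s) (Y s)) J s := by
    filter_upwards [hY.smooth.eventually_hasDerivWithinAt_inner hc.smooth ht hY.smooth] with s hs
    refine hs.congr_deriv ?_
    rw [real_inner_comm (covDeriv c J Y s) (Y s)]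
    ring
  -- The second derivative of `|Y|²` is `2 (⟪Y'', Y⟫ + |Y'|²)`; the formula for `⟪Y'', Y⟫`
  -- contributes `2 |Y'|²` and makes the coefficient `6`.
  have hf₁ : HasDerivWithinAt (fun s ↦ 2 * inner ℝ (covDeriv c J Y s) (Y s))
      (6 * ‖covDeriv c J Y t‖ ^ 2 + 2 * inner ℝ (tidal c J t (Y t)) (Y t)) J t := by
    refine (((hY.smooth.covDeriv hu hc.smooth ht).hasDerivWithinAt_inner hc.smooth ht
      hY.smooth).const_mul 2).congr_deriv ?_
    rw [hY.inner_covDeriv_covDeriv hJ hJ' hc hA ht₀ ht, real_inner_self_eq_norm_sq]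
    ring
  have hposev : ∀ᶠ s in 𝓝[J] t, 0 < inner ℝ (Y s) (Y s) :=
    (hY.smooth.contDiffWithinAt_inner hY.smooth).continuousWithinAt.eventually (lt_mem_nhds hpos)
  have hg : ∀ᶠ s in 𝓝[J] t, HasDerivWithinAt (virtualLength A v)
      (-(‖v‖ ^ 2 * (2 * inner ℝ (covDeriv c J Y s) (Y s))) / (2 * √(inner ℝ (Y s) (Y s)) ^ 3))
      J s := by
    filter_upwards [hf, hposev, eventually_eventually_nhdsWithin.2 heq, self_mem_nhdsWithin]
      with s h1 h2 h3 hs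
    exact (hasDerivWithinAt_div_sqrt h1 h2).congr_of_eventuallyEq h3 (h3.self_of_nhdsWithin hs)
  have hgeq : derivWithin (virtualLength A v) J =ᶠ[𝓝[J] t] fun s ↦
      -(‖v‖ ^ 2 * (2 * inner ℝ (covDeriv c J Y s) (Y s))) / (2 * √(inner ℝ (Y s) (Y s)) ^ 3) := by
    filter_upwards [hg, self_mem_nhdsWithin] with s hs hsJ using hs.derivWithin (hu s hsJ)
  have hg₂ := (hasDerivWithinAt_div_sqrt_pow_three (a := ‖v‖ ^ 2) (hf.self_of_nhdsWithin ht) hf₁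
    hpos).congr_of_eventuallyEq hgeq (hgeq.self_of_nhdsWithin ht)
  have hg₁ := hg.self_of_nhdsWithin ht
  rw [hY.virtualLength_eq hJ hJ' hc hA ht₀ ht hv]
  constructor
  · refine hg₁.congr_deriv ?_
    rw [← norm_eq_sqrt_real_inner]
    field_simp
  · refine hg₂.congr_deriv ?_
    rw [← norm_eq_sqrt_real_inner, real_inner_self_eq_norm_sq]
    field_simp
    ring

theorem virtualLength_eq_zero (hJ : J.OrdConnected) (hJ' : J.Nontrivial)
    (hc : IsUnitGeodesicOn (E := E) c J) (hA : IsLagrangeTensor A) (ht₀ : t₀ ∈ J) (ht : t ∈ J)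
    (hv : v ∉ (LinearMap.ker (A t))ᗮ) : virtualLength A v t = 0 := by
  obtain ⟨h, -, -, heq⟩ := hA.virtualLength_of_notMem hJ hJ' hc ht₀ ht hv
  simpa using heq.self_of_nhdsWithin ht

theorem virtualLength_pos_iff (hJ : J.OrdConnected) (hJ' : J.Nontrivial)
    (hc : IsUnitGeodesicOn (E := E) c J) (hA : IsLagrangeTensor A) (ht₀ : t₀ ∈ J) (ht : t ∈ J)
    (hv : v ≠ 0) : 0 < virtualLength A v t ↔ v ∈ (LinearMap.ker (A t))ᗮ := by
  refine ⟨fun h ↦ ?_, fun h ↦ ?_⟩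
  · by_contra hmem
    exact h.ne' (virtualLength_eq_zero hJ hJ' hc hA ht₀ ht hmem)
  · obtain ⟨Y, hY⟩ := hA.exists_isDualFieldAt hJ hJ' hc ht₀ ht h
    exact hY.virtualLength_pos hJ hJ' hc hA ht₀ ht hv

theorem contDiffWithinAt_virtualLength (hJ : J.OrdConnected) (hJ' : J.Nontrivial)
    (hc : IsUnitGeodesicOn (E := E) c J) (hA : IsLagrangeTensor A) (ht₀ : t₀ ∈ J) (ht : t ∈ J)
    (hv : v ≠ 0) (h : v ∈ (LinearMap.ker (A t))ᗮ) :
    ContDiffWithinAt ℝ ∞ (virtualLength A v) J t := by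
  obtain ⟨Y, hY⟩ := hA.exists_isDualFieldAt hJ hJ' hc ht₀ ht h
  exact hY.contDiffWithinAt_virtualLength hJ hJ' hc hA ht₀ ht hv

theorem continuousOn_virtualLength (hJ : J.OrdConnected) (hJ' : J.Nontrivial)
    (hc : IsUnitGeodesicOn (E := E) c J) (hA : IsLagrangeTensor A) (ht₀ : t₀ ∈ J)
    (hv : v ≠ 0) : ContinuousOn (virtualLength A v) J := by
  intro t ht
  by_cases hmem : v ∈ (LinearMap.ker (A t))ᗮ
  · exact (contDiffWithinAt_virtualLength hJ hJ' hc hA ht₀ ht hv hmem).continuousWithinAt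
  · obtain ⟨h, hcont, -, heq⟩ := hA.virtualLength_of_notMem hJ hJ' hc ht₀ ht hmem
    exact (((continuous_id.sub continuous_const).abs.continuousWithinAt).mul
      hcont).congr_of_eventuallyEq heq (heq.self_of_nhdsWithin ht)

/-- Cauchy-Schwarz for `|v|² = ⟪Y, A v⟫`; where there is no dual field, `g_v` is zero. -/
theorem virtualLength_le (hJ : J.OrdConnected) (hJ' : J.Nontrivial)
    (hc : IsUnitGeodesicOn (E := E) c J) (hA : IsLagrangeTensor A) (ht₀ : t₀ ∈ J) (ht : t ∈ J)
    (hv : v ≠ 0) : virtualLength A v t ≤ ‖A t v‖ := by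
  by_cases hmem : v ∈ (LinearMap.ker (A t))ᗮ
  · obtain ⟨Y, hY⟩ := hA.exists_isDualFieldAt hJ hJ' hc ht₀ ht hmem
    rw [hY.virtualLength_eq hJ hJ' hc hA ht₀ ht hv,
      div_le_iff₀ (norm_pos_iff.2 (hY.ne_zero ht hv)), ← real_inner_self_eq_norm_sq,
      ← hY.inner_apply ht v, mul_comm]
    exact real_inner_le_norm _ _
  · rw [virtualLength_eq_zero hJ hJ' hc hA ht₀ ht hmem]
    exact norm_nonneg _

theorem contDiffAt_virtualLength_iff (hJ : J.OrdConnected) (hJ' : J.Nontrivial)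
    (hc : IsUnitGeodesicOn (E := E) c J) (hA : IsLagrangeTensor A) (ht₀ : t₀ ∈ J)
    (ht : t ∈ interior J) (hv : v ≠ 0) :
    ContDiffAt ℝ ∞ (virtualLength A v) t ↔ v ∈ (LinearMap.ker (A t))ᗮ := by
  have hnhds : J ∈ 𝓝 t := mem_interior_iff_mem_nhds.1 ht
  have htJ := interior_subset ht
  refine ⟨fun h ↦ ?_, fun h ↦
    (contDiffWithinAt_virtualLength hJ hJ' hc hA ht₀ htJ hv h).contDiffAt hnhds⟩
  by_contra hmem
  obtain ⟨f, hcont, hpos, heq⟩ := hA.virtualLength_of_notMem hJ hJ' hc ht₀ htJ hmem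
  rw [nhdsWithin_eq_nhds.2 hnhds] at heq
  exact not_differentiableAt_of_eventuallyEq_abs_mul (hcont.continuousAt hnhds) hpos heq
    (h.differentiableAt (by simp))

theorem sec_velocity (hc : IsUnitGeodesicOn (E := E) c J) (ht : t ∈ J)
    {x : TangentSpace 𝓘(ℝ, E) (c t)} (hx : inner ℝ x (velocity c J t) = 0) :
    sec (E := E) (c t) (velocity c J t) x = inner ℝ (tidal c J t x) x / ‖x‖ ^ 2 := by
  rw [sec, hc.unit_speed t ht, real_inner_comm x (velocity c J t), hx, tidal]
  simp

/-- This is `Z' = -S Z`, so `|S Z|² sin²` in (a) is the Gram determinant of `Z'` and `Z` divided by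
`|Z|²`. -/
theorem IsDualFieldAt.riccati_eq (hJ : J.OrdConnected) (hJ' : J.Nontrivial)
    (hc : IsUnitGeodesicOn (E := E) c J) (hA : IsLagrangeTensor A) (hY : IsDualFieldAt A v t Y)
    (ht₀ : t₀ ∈ J) (ht : t ∈ J) (hreg : IsRegularPt A t) :
    riccati A t (virtualField A v t) = - covDeriv c J Y t := by
  obtain ⟨u, hu1, hu2⟩ := hY.exists_apply_eq hJ hJ' hc hA ht₀ ht
  have h : virtualField A v t = A t u :=
    Subtype.ext ((hY.virtualField_eq ht hreg).trans hu1.symm)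
  rw [riccati, h, Function.leftInverse_invFun hreg.1, hu2]

theorem norm_sq_mul_sin_angle_sq {V : Type*} [NormedAddCommGroup V] [InnerProductSpace ℝ V]
    (x y : V) : ‖x‖ ^ 2 * ‖y‖ ^ 2 * Real.sin (InnerProductGeometry.angle x y) ^ 2
      = ‖x‖ ^ 2 * ‖y‖ ^ 2 - inner ℝ x y ^ 2 := by
  rw [Real.sin_sq, ← InnerProductGeometry.cos_angle_mul_norm_mul_norm x y]
  ring

theorem iteratedDerivWithin_two_virtualLength (hJ : J.OrdConnected) (hJ' : J.Nontrivial)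
    (hc : IsUnitGeodesicOn (E := E) c J) (hA : IsLagrangeTensor A) (ht₀ : t₀ ∈ J) (ht : t ∈ J)
    (hv : v ≠ 0) (hreg : IsRegularPt A t) :
    iteratedDerivWithin 2 (virtualLength A v) J t / virtualLength A v t
      = - sec (E := E) (c t) (velocity c J t) (virtualField A v t)
        - 3 * (‖riccati A t (virtualField A v t)‖ ^ 2 / ‖virtualField A v t‖ ^ 2)
          * Real.sin (InnerProductGeometry.angle (riccati A t (virtualField A v t))
              (virtualField A v t : TangentSpace 𝓘(ℝ, E) (c t))) ^ 2 := by
  have hu := uniqueDiffOn_of_ordConnected hJ hJ'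
  have hmem : v ∈ (LinearMap.ker (A t))ᗮ := by
    rw [hreg.ker_eq_bot, Submodule.bot_orthogonal_eq_top]
    trivial
  obtain ⟨Y, hY⟩ := hA.exists_isDualFieldAt hJ hJ' hc ht₀ ht hmem
  have hn : 0 < ‖Y t‖ := norm_pos_iff.2 (hY.ne_zero ht hv)
  have hpos := hY.virtualLength_pos hJ hJ' hc hA ht₀ ht hv
  have hiter : iteratedDerivWithin 2 (virtualLength A v) J t
      = derivWithin (derivWithin (virtualLength A v) J) J t := iteratedDerivWithin_eq_iterate
  have h2 := hiter.trans <|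
    (hY.hasDerivWithinAt_virtualLength hJ hJ' hc hA ht₀ ht hv).2.derivWithin (hu t ht)
  have hsin := norm_sq_mul_sin_angle_sq (-covDeriv c J Y t) (Y t)
  have hfield : ‖virtualField A v t‖ = ‖Y t‖ := congrArg norm (hY.virtualField_eq ht hreg)
  rw [h2, hfield, hY.riccati_eq hJ hJ' hc hA ht₀ ht hreg, hY.virtualField_eq ht hreg,
    sec_velocity hc ht (hY.inner_velocity ht)]
  rw [norm_neg, inner_neg_left, neg_sq] at hsin
  rw [norm_neg, ← hsin]
  field_simp

end VirtualLength

/-! ### Concavity and the rigid case, part (c) -/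

section Concavity

variable {E : Type*} [NormedAddCommGroup E] [NormedSpace ℝ E] [FiniteDimensional ℝ E]
  {M : Type*} [TopologicalSpace M] [ChartedSpace E M] [IsManifold 𝓘(ℝ, E) ∞ M]
  [RiemannianBundle (fun x : M ↦ TangentSpace 𝓘(ℝ, E) x)]
  [IsContMDiffRiemannianBundle 𝓘(ℝ, E) ∞ E (fun x : M ↦ TangentSpace 𝓘(ℝ, E) x)]
  {c : ℝ → M} {J : Set ℝ} {t₀ t : ℝ}
  {A : ∀ t, normalSpace E c J t₀ →ₗ[ℝ] normalSpace E c J t} {v : normalSpace E c J t₀}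
  {Y : ∀ s, TangentSpace 𝓘(ℝ, E) (c s)}

theorem inner_sq_le_norm_sq_mul_norm_sq {V : Type*} [NormedAddCommGroup V] [InnerProductSpace ℝ V]
    (x y : V) : inner ℝ x y ^ 2 ≤ ‖x‖ ^ 2 * ‖y‖ ^ 2 := by
  rw [← mul_pow]
  exact sq_le_sq' (neg_le_of_abs_le (abs_real_inner_le_norm x y)) (real_inner_le_norm x y)

/-- At an interior point of `J` at which it is positive, `g_v` has a second derivative that is
bounded above by `- g_v sec(ċ, x)` for some normal vector `x`. -/
theorem exists_hasDerivAt_deriv_virtualLength (hJ : J.OrdConnected) (hJ' : J.Nontrivial)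
    (hc : IsUnitGeodesicOn (E := E) c J) (hA : IsLagrangeTensor A) (ht₀ : t₀ ∈ J) (hv : v ≠ 0)
    (ht : t ∈ interior J) (hpos : 0 < virtualLength A v t) :
    DifferentiableAt ℝ (virtualLength A v) t ∧
    ∃ (x : normalSpace E c J t) (d : ℝ), x ≠ 0 ∧ HasDerivAt (deriv (virtualLength A v)) d t ∧
      d ≤ -(virtualLength A v t * sec (E := E) (c t) (velocity c J t) x) := by
  have hnhds : J ∈ 𝓝 t := mem_interior_iff_mem_nhds.1 ht
  have htJ := interior_subset ht
  obtain ⟨Y, hY⟩ := hA.exists_isDualFieldAt hJ hJ' hc ht₀ htJ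
    ((virtualLength_pos_iff hJ hJ' hc hA ht₀ htJ hv).1 hpos)
  obtain ⟨h1, h2⟩ := hY.hasDerivWithinAt_virtualLength hJ hJ' hc hA ht₀ htJ hv
  have heq : deriv (virtualLength A v) =ᶠ[𝓝 t] derivWithin (virtualLength A v) J := by
    filter_upwards [isOpen_interior.mem_nhds ht] with s hs
    exact (derivWithin_of_mem_nhds (mem_interior_iff_mem_nhds.1 hs)).symm
  refine ⟨(h1.hasDerivAt hnhds).differentiableAt,
    ⟨Y t, mem_normalSpace_iff.2 (hY.inner_velocity htJ)⟩, _, ?_,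
    (h2.hasDerivAt hnhds).congr_of_eventuallyEq heq, ?_⟩
  · exact fun h ↦ hY.ne_zero htJ hv (congrArg Subtype.val h)
  · rw [sec_velocity hc htJ (hY.inner_velocity htJ), ← mul_neg]
    refine mul_le_mul_of_nonneg_left ?_ hpos.le
    have := div_nonneg (sub_nonneg.2 (inner_sq_le_norm_sq_mul_norm_sq (covDeriv c J Y t) (Y t)))
      (pow_nonneg (norm_nonneg (Y t)) 4)
    linarith

/-- Singular points inside `K` cause no interruption, since positivity of `g_v` there provides a
smooth dual field and the same bound on the second derivative. -/
theorem concaveOn_virtualLength (hJ : J.OrdConnected) (hJ' : J.Nontrivial)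
    (hc : IsUnitGeodesicOn (E := E) c J) (hA : IsLagrangeTensor A) (ht₀ : t₀ ∈ J) (hv : v ≠ 0)
    (hsec : ∀ t ∈ J, ∀ x : normalSpace E c J t, x ≠ 0 →
      0 ≤ sec (E := E) (c t) (velocity c J t) x)
    {K : Set ℝ} (hKJ : K ⊆ J) (hK : K.OrdConnected) (hpos : ∀ t ∈ K, 0 < virtualLength A v t) :
    ConcaveOn ℝ K (virtualLength A v) := by
  have h := fun t (ht : t ∈ interior K) ↦ exists_hasDerivAt_deriv_virtualLength hJ hJ' hc hA ht₀ hv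
    (interior_mono hKJ ht) (hpos t (interior_subset ht))
  refine concaveOn_of_deriv2_nonpos hK.convex
    ((continuousOn_virtualLength hJ hJ' hc hA ht₀ hv).mono hKJ)
    (fun t ht ↦ (h t ht).1.differentiableWithinAt) (fun t ht ↦ ?_) fun t ht ↦ ?_
  · obtain ⟨-, x, d, -, hd, -⟩ := h t ht
    exact hd.differentiableAt.differentiableWithinAt
  · obtain ⟨-, x, d, hx, hd, hle⟩ := h t ht
    change deriv (deriv (virtualLength A v)) t ≤ 0
    rw [hd.deriv]
    exact hle.trans (neg_nonpos.2 (mul_nonneg (hpos t (interior_subset ht)).le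
      (hsec t (hKJ (interior_subset ht)) x hx)))

theorem strictConcaveOn_virtualLength (hJ : J.OrdConnected) (hJ' : J.Nontrivial)
    (hc : IsUnitGeodesicOn (E := E) c J) (hA : IsLagrangeTensor A) (ht₀ : t₀ ∈ J) (hv : v ≠ 0)
    (hsec : ∀ t ∈ J, ∀ x : normalSpace E c J t, x ≠ 0 →
      0 < sec (E := E) (c t) (velocity c J t) x)
    {K : Set ℝ} (hKJ : K ⊆ J) (hK : K.OrdConnected) (hpos : ∀ t ∈ K, 0 < virtualLength A v t) :
    StrictConcaveOn ℝ K (virtualLength A v) := by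
  refine strictConcaveOn_of_deriv2_neg hK.convex
    ((continuousOn_virtualLength hJ hJ' hc hA ht₀ hv).mono hKJ) fun t ht ↦ ?_
  obtain ⟨-, x, d, hx, hd, hle⟩ := exists_hasDerivAt_deriv_virtualLength hJ hJ' hc hA ht₀ hv
    (interior_mono hKJ ht) (hpos t (interior_subset ht))
  change deriv (deriv (virtualLength A v)) t < 0
  rw [hd.deriv]
  exact hle.trans_lt (neg_neg_of_pos (mul_pos (hpos t (interior_subset ht))
    (hsec t (hKJ (interior_subset ht)) x hx)))

/-- An isotropic vector of a semidefinite symmetric form lies in its kernel. -/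
theorem tidal_eq_zero (hc : IsUnitGeodesicOn (E := E) c J) (ht : t ∈ J)
    (hsec : ∀ x : normalSpace E c J t, x ≠ 0 → 0 ≤ sec (E := E) (c t) (velocity c J t) x)
    {y : TangentSpace 𝓘(ℝ, E) (c t)} (hy : inner ℝ y (velocity c J t) = 0)
    (h0 : inner ℝ (tidal c J t y) y = 0) : tidal c J t y = 0 := by
  have hnonneg : ∀ x : TangentSpace 𝓘(ℝ, E) (c t), inner ℝ x (velocity c J t) = 0 →
      0 ≤ inner ℝ (tidal c J t x) x := by
    intro x hx
    by_cases hx0 : x = 0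
    · rw [hx0, inner_zero_right]
    · have := hsec ⟨x, mem_normalSpace_iff.2 hx⟩ fun h ↦ hx0 (congrArg Subtype.val h)
      rw [sec_velocity hc ht hx] at this
      have h2 := mul_nonneg this (sq_nonneg ‖x‖)
      rwa [div_mul_cancel₀ _ (pow_ne_zero 2 (norm_ne_zero_iff.2 hx0))] at h2
  have hv := inner_tidal_velocity (J := J) y
  generalize hz : tidal c J t y = z at *
  -- The form is tested on `y + r z` with `z = R y`, which is again normal to `ċ`. The constant term
  -- vanishes, so the discriminant condition leaves only `(2 |z|²)² ≤ 0`.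
  have hquad : ∀ r : ℝ, 0 ≤ inner ℝ (tidal c J t z) z * (r * r) + 2 * inner ℝ z z * r + 0 := by
    intro r
    have h := hnonneg (y + r • z) (by rw [inner_add_left, real_inner_smul_left, hy, hv]; ring)
    have hcomm := inner_tidal_comm (J := J) z y
    rw [tidal_add, tidal_smul, hz] at h
    rw [hz] at hcomm
    simp only [inner_add_left, inner_add_right, real_inner_smul_left, real_inner_smul_right, h0,
      hcomm] at h
    linarith
  have hd := discrim_le_zero hquad
  rw [discrim, mul_zero, sub_zero] at hd
  have : 2 * inner ℝ z z = 0 := pow_eq_zero_iff two_ne_zero |>.1 (le_antisymm hd (sq_nonneg _))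
  exact inner_self_eq_zero.1 ((mul_eq_zero.1 this).resolve_left two_ne_zero)

/-- If `g_v` is constant and the curvature along `c` is non-negative, then the dual field is
parallel and is annihilated by the curvature operator. -/
theorem IsDualFieldAt.covDeriv_eq_zero (hJ : J.OrdConnected) (hJ' : J.Nontrivial)
    (hc : IsUnitGeodesicOn (E := E) c J) (hA : IsLagrangeTensor A) (hY : IsDualFieldAt A v t Y)
    (ht₀ : t₀ ∈ J) (ht : t ∈ J) (hv : v ≠ 0)
    (hsec : ∀ x : normalSpace E c J t, x ≠ 0 → 0 ≤ sec (E := E) (c t) (velocity c J t) x)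
    {k : ℝ} (hk : ∀ s ∈ J, virtualLength A v s = k) :
    covDeriv c J Y t = 0 ∧ tidal c J t (Y t) = 0 := by
  have hu := uniqueDiffOn_of_ordConnected hJ hJ'
  have hne := hY.ne_zero ht hv
  have hn : 0 < ‖Y t‖ := norm_pos_iff.2 hne
  have hpos := hY.virtualLength_pos hJ hJ' hc hA ht₀ ht hv
  obtain ⟨h1, h2⟩ := hY.hasDerivWithinAt_virtualLength hJ hJ' hc hA ht₀ ht hv
  have hconst : ∀ s ∈ J, HasDerivWithinAt (virtualLength A v) 0 J s := fun s hs ↦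
    (hasDerivWithinAt_const s J k).congr hk (hk s hs)
  have hderiv : ∀ s ∈ J, derivWithin (virtualLength A v) J s = 0 := fun s hs ↦
    (hconst s hs).derivWithin (hu s hs)
  have e1 := (hu t ht).eq_deriv _ h1 (hconst t ht)
  have e2 := (hu t ht).eq_deriv _ h2
    ((hasDerivWithinAt_const t J (0 : ℝ)).congr hderiv (hderiv t ht))
  have e3 := (mul_eq_zero.1 (neg_eq_zero.1 e1)).resolve_left hpos.ne'
  have e4 : inner ℝ (covDeriv c J Y t) (Y t) = 0 :=
    (div_eq_zero_iff.1 e3).resolve_right (pow_pos hn 2).ne'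
  have e5 := (mul_eq_zero.1 e2).resolve_left hpos.ne'
  have hs := hsec ⟨Y t, mem_normalSpace_iff.2 (hY.inner_velocity ht)⟩
    fun h ↦ hne (congrArg Subtype.val h)
  rw [sec_velocity hc ht (hY.inner_velocity ht)] at hs
  have hcs := div_nonneg (sub_nonneg.2 (inner_sq_le_norm_sq_mul_norm_sq (covDeriv c J Y t) (Y t)))
    (pow_nonneg (norm_nonneg (Y t)) 4)
  have e6 : inner ℝ (tidal c J t (Y t)) (Y t) / ‖Y t‖ ^ 2 = 0 := by linarith
  have e7 : (‖covDeriv c J Y t‖ ^ 2 * ‖Y t‖ ^ 2 - inner ℝ (covDeriv c J Y t) (Y t) ^ 2)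
      / ‖Y t‖ ^ 4 = 0 := by linarith
  constructor
  · have e8 := (div_eq_zero_iff.1 e7).resolve_right (pow_pos hn 4).ne'
    rw [e4, zero_pow two_ne_zero, sub_zero] at e8
    have e9 := (mul_eq_zero.1 e8).resolve_right (pow_pos hn 2).ne'
    exact norm_eq_zero.1 (pow_eq_zero_iff two_ne_zero |>.1 e9)
  · exact tidal_eq_zero hc ht hsec (hY.inner_velocity ht)
      ((div_eq_zero_iff.1 e6).resolve_right (pow_pos hn 2).ne')

theorem exists_parallel_of_virtualLength_const (hJ : J.OrdConnected) (hJ' : J.Nontrivial)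
    (hc : IsUnitGeodesicOn (E := E) c J) (hA : IsLagrangeTensor A) (ht₀ : t₀ ∈ J) (hv : v ≠ 0)
    (hsec : ∀ t ∈ J, ∀ x : normalSpace E c J t, x ≠ 0 →
      0 ≤ sec (E := E) (c t) (velocity c J t) x)
    {k : ℝ} (hk : ∀ s ∈ J, virtualLength A v s = k) :
    ∃ Y : ∀ t, TangentSpace 𝓘(ℝ, E) (c t),
      (∀ t ∈ J, IsRegularPt A t → Y t = virtualField A v t) ∧ IsJacobiField c J Y ∧
      (∀ t ∈ J, covDeriv c J Y t = 0) ∧ (A t₀ = LinearMap.id → ∀ t ∈ J, Y t = A t v) := by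
  have hu := uniqueDiffOn_of_ordConnected hJ hJ'
  -- The constant is positive because `g_v` is positive at a regular point; hence `v ⟂ ker A_t`
  -- throughout `J` and the dual field is global.
  have hkpos : 0 < k := by
    obtain ⟨s, hs, hreg⟩ := hA.exists_regular
    rw [← hk s hs, virtualLength_pos_iff hJ hJ' hc hA ht₀ hs hv, hreg.ker_eq_bot,
      Submodule.bot_orthogonal_eq_top]
    trivial
  have hmem : ∀ t ∈ J, v ∈ (LinearMap.ker (A t))ᗮ := fun t ht ↦
    (virtualLength_pos_iff hJ hJ' hc hA ht₀ ht hv).1 (by rwa [hk t ht])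
  obtain ⟨Y, hY⟩ := hA.exists_forall_isDualFieldAt hJ hJ' hc ht₀ hmem
  have hpar : ∀ t ∈ J, covDeriv c J Y t = 0 ∧ tidal c J t (Y t) = 0 := fun t ht ↦
    (hY t ht).covDeriv_eq_zero hJ hJ' hc hA ht₀ ht hv (hsec t ht) hk
  have hpar₂ : ∀ t ∈ J, covDeriv c J (covDeriv c J Y) t = 0 := fun t ht ↦ by
    -- The zero field is written as `0 • Y` so that linearity yields its derivative.
    rw [covDeriv_congr ht (X := fun s ↦ (0 : ℝ) • Y s) ?_,
      covDeriv_const_smul hc.smooth ht 0 (hY t ht).smooth, zero_smul]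
    filter_upwards [self_mem_nhdsWithin] with s hs
    rw [(hpar s hs).1, zero_smul]
  refine ⟨Y, fun t ht hreg ↦ ((hY t ht).virtualField_eq ht hreg).symm,
    ⟨fun t ht ↦ (hY t ht).smooth, fun t ht ↦ ?_⟩, fun t ht ↦ (hpar t ht).1, fun hid t ht ↦ ?_⟩
  · rw [hpar₂ t ht, zero_add]
    exact (hpar t ht).2
  -- At `t₀` the relations `A u = Y` and `A' u = -Y' = 0` hold, and `A_{t₀} = Id` forces `u = v`.
  -- Thus `Y` and `A v` are Jacobi fields with the same initial data at `t₀`.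
  · obtain ⟨u, hu1, hu2⟩ := (hY t₀ ht₀).exists_apply_eq hJ hJ' hc hA ht₀ ht₀
    have huv : u = v := by
      refine ext_inner_right ℝ fun w ↦ ?_
      have := (hY t₀ ht₀).inner_apply ht₀ w
      rw [← hu1, hid] at this
      exact this
    subst huv
    rw [(hpar t₀ ht₀).1, neg_zero] at hu2
    have hsub : ∀ s ∈ J, covDeriv c J
        (fun s ↦ Y s - (A s u : TangentSpace 𝓘(ℝ, E) (c s))) s
        = covDeriv c J Y s - tensorDeriv A s u := fun s hs ↦
      covDeriv_sub hc.smooth hs (hY s hs).smooth (hA.smoothAt u hs)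
    have hjac : IsJacobiField c J fun s ↦ Y s - (A s u : TangentSpace 𝓘(ℝ, E) (c s)) := by
      refine ⟨fun s hs ↦ (hY s hs).smooth.sub hc.smooth hs (hA.smoothAt u hs), fun s hs ↦ ?_⟩
      have htid : tidal c J s (Y s - (A s u : TangentSpace 𝓘(ℝ, E) (c s)))
          = - tidal c J s (A s u : TangentSpace 𝓘(ℝ, E) (c s)) := by
        rw [sub_eq_add_neg, ← neg_one_smul ℝ, tidal_add, tidal_smul, (hpar s hs).2, zero_add,
          neg_one_smul]
      rw [covDeriv_congr hs (X := fun s ↦ covDeriv c J Y s - tensorDeriv A s u)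
          (by filter_upwards [self_mem_nhdsWithin] with r hr using hsub r hr),
        covDeriv_sub hc.smooth hs ((hY s hs).smooth.covDeriv hu hc.smooth hs)
          (hA.smoothAt_tensorDeriv hu hc u hs), hpar₂ s hs, hA.covDeriv_tensorDeriv u hs]
      change 0 - _ + tidal c J s _ = 0
      rw [htid]
      abel
    refine sub_eq_zero.1 (hjac.eq_zero hJ hJ' hc.smooth ht₀ ?_ ?_ ht)
    · rw [hu1, sub_self]
    · rw [hsub t₀ ht₀, (hpar t₀ ht₀).1, hu2, sub_zero]

end Concavity

end VirtualJacobi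

end

end

theorem theoremA
    {E : Type*} [NormedAddCommGroup E] [NormedSpace ℝ E] [FiniteDimensional ℝ E]
    {M : Type*} [TopologicalSpace M] [ChartedSpace E M] [IsManifold 𝓘(ℝ, E) ∞ M]
    [RiemannianBundle (fun x : M ↦ TangentSpace 𝓘(ℝ, E) x)]
    [IsContMDiffRiemannianBundle 𝓘(ℝ, E) ∞ E (fun x : M ↦ TangentSpace 𝓘(ℝ, E) x)]
    (c : ℝ → M) (J : Set ℝ) (hJ : J.OrdConnected) (hJ' : J.Nontrivial)
    (hc : IsUnitGeodesicOn (E := E) c J)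
    (t₀ : ℝ) (ht₀ : t₀ ∈ J)
    (A : ∀ t, normalSpace E c J t₀ →ₗ[ℝ] normalSpace E c J t) (hA : IsLagrangeTensor A)
    (v : normalSpace E c J t₀) (hv : v ≠ 0) :
    -- the singular points are isolated, so that `g_v` is determined by its values at regular points
    (∀ t ∈ J, ∀ᶠ s in 𝓝[J \ {t}] t, IsRegularPt A s) ∧
    -- (a)
    (∀ t ∈ J, virtualLength A v t ≤ ‖A t v‖) ∧
    (∀ t ∈ J, IsRegularPt A t →
      iteratedDerivWithin 2 (virtualLength A v) J t / virtualLength A v t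
        = - sec (E := E) (c t) (velocity c J t) (virtualField A v t)
          - 3 * (‖riccati A t (virtualField A v t)‖ ^ 2 / ‖virtualField A v t‖ ^ 2)
            * Real.sin (InnerProductGeometry.angle (riccati A t (virtualField A v t))
                (virtualField A v t : TangentSpace 𝓘(ℝ, E) (c t))) ^ 2) ∧
    -- (b)
    ContinuousOn (virtualLength A v) J ∧
    (∀ t ∈ J, 0 < virtualLength A v t ↔ v ∈ (LinearMap.ker (A t))ᗮ) ∧
    (∀ t ∈ J, (ContDiffWithinAt ℝ ∞ (virtualLength A v) J t ∧ 0 < virtualLength A v t) ↔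
      v ∈ (LinearMap.ker (A t))ᗮ) ∧
    (∀ t ∈ interior J, ContDiffAt ℝ ∞ (virtualLength A v) t ↔ v ∈ (LinearMap.ker (A t))ᗮ) ∧
    -- (c)
    ((∀ t ∈ J, ∀ x : normalSpace E c J t, x ≠ 0 → 0 ≤ sec (E := E) (c t) (velocity c J t) x) →
      ∀ K ⊆ J, K.OrdConnected → (∀ t ∈ K, 0 < virtualLength A v t) →
        ConcaveOn ℝ K (virtualLength A v)) ∧
    ((∀ t ∈ J, ∀ x : normalSpace E c J t, x ≠ 0 → 0 < sec (E := E) (c t) (velocity c J t) x) →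
      ∀ K ⊆ J, K.OrdConnected → (∀ t ∈ K, 0 < virtualLength A v t) →
        StrictConcaveOn ℝ K (virtualLength A v)) ∧
    ((∀ t ∈ J, ∀ x : normalSpace E c J t, x ≠ 0 → 0 ≤ sec (E := E) (c t) (velocity c J t) x) →
      (∃ k : ℝ, ∀ t ∈ J, virtualLength A v t = k) →
        ∃ Y : ∀ t, TangentSpace 𝓘(ℝ, E) (c t),
          (∀ t ∈ J, IsRegularPt A t → Y t = virtualField A v t) ∧
          IsJacobiField c J Y ∧
          (∀ t ∈ J, covDeriv c J Y t = 0) ∧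
          (A t₀ = LinearMap.id → ∀ t ∈ J, Y t = A t v)) := by
  exact ⟨fun t ht ↦ hA.eventually_isRegularPt hJ hJ' hc ht₀ ht,
    fun t ht ↦ virtualLength_le hJ hJ' hc hA ht₀ ht hv,
    fun t ht hreg ↦ iteratedDerivWithin_two_virtualLength hJ hJ' hc hA ht₀ ht hv hreg,
    continuousOn_virtualLength hJ hJ' hc hA ht₀ hv,
    fun t ht ↦ virtualLength_pos_iff hJ hJ' hc hA ht₀ ht hv,
    fun t ht ↦ ⟨fun h ↦ (virtualLength_pos_iff hJ hJ' hc hA ht₀ ht hv).1 h.2,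
      fun h ↦ ⟨contDiffWithinAt_virtualLength hJ hJ' hc hA ht₀ ht hv h,
        (virtualLength_pos_iff hJ hJ' hc hA ht₀ ht hv).2 h⟩⟩,
    fun t ht ↦ contDiffAt_virtualLength_iff hJ hJ' hc hA ht₀ ht hv,
    fun hsec K hKJ hK hpos ↦ concaveOn_virtualLength hJ hJ' hc hA ht₀ hv hsec hKJ hK hpos,
    fun hsec K hKJ hK hpos ↦ strictConcaveOn_virtualLength hJ hJ' hc hA ht₀ hv hsec hKJ hK hpos,
    fun hsec ⟨_, hk⟩ ↦ exists_parallel_of_virtualLength_const hJ hJ' hc hA ht₀ hv hsec hk⟩
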